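/- **Setting.** Let $A$ be a $C^*$-algebra and let $\mathbb K$ be the compact operators on a separable infinite-dimensional Hilbert space; identify $A$ with $A\otimes e_{1,1}\subset A\otimes\mathbb K$. $\mathrm{Ped}(\cdot)$ denotes the Pedersen ideal (the smallest dense two-sided ideal), and $\mathrm{Her}(a)$ the hereditary $C^*$-subalgebra of $A\otimes\mathbb K$ generated by $a\in(A\otimes\mathbb K)_+$. For $\varepsilon>0$ let $f_\varepsilon:\mathbb R\to[0,1]$ be $0$ on $(-\infty,\varepsilon]$, $1$ on $[2\varepsilon,\infty)$ and linear on $[\varepsilon,2\varepsilon]$. For $a,b\in(A\otimes\mathbb K)_+$ write $b\lesssim a$ if $x_k^*ax_k\to b$ in norm for some sequence $x_k\in A\otimes\mathbb K$. A quasitrace on a pre-$C^*$-algebra $P$ is a map $\tau:P\to\mathbb C$ with $0\le\tau(x^*x)=\tau(xx^*)$ for all $x$, linear on commutative $*$-subalgebras, and with $\tau(a+ib)=\tau(a)+i\tau(b)$ for self-adjoint $a,b$; it is a 2-quasitrace if it extends to a quasitrace on $M_2(P)$. Let $\widetilde{QT}(A)$ be the cone of all 2-quasitraces on $\mathrm{Ped}(A\otimes\mathbb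 K)$ with the topology of pointwise convergence. For $\tau\in\widetilde{QT}(A)$ and $a\in(A\otimes\mathbb K)_+$ put $\tau(a)=\lim_{\varepsilon\to0}\tau((a-\varepsilon)_+)\in[0,\infty]$ (this agrees with $\tau$ on $\mathrm{Ped}(A\otimes\mathbb K)_+$) and $d_\tau(a)=\lim_n\tau(f_{1/n}(a))$. Let $QT(A)$ be the set of $\tau\in\widetilde{QT}(A)$ with $\sup\{\tau(a\otimes e_{1,1}):a\in\mathrm{Ped}(A)_+,\ \|a\|\le1\}=1$, and $S_A$ its closure in $\widetilde{QT}(A)$. For $x\in A\otimes\mathbb K$ put $\|x\|_2=\sup_{\tau\in S_A}\tau(x^*x)^{1/2}$, and for $a\in(A\otimes\mathbb K)_+$ put $$\omega(a)=\lim_{n\to\infty}\ \sup_{\tau\in S_A}\bigl(d_\tau(a)-\tau(f_{1/n}(a))\bigr).$$ *Hereditary surjectivity.* $\mathrm{Aff}_+$ consists of $0$ and of all continuous, additive, $\mathbb R_+$-homogeneous functions $\widetilde{QT}(A)\to\mathbb R$ that are strictly positive off $0$; $\mathrm{LAff}_+$ consists of all pointwise limits $\widetilde{QT}(A)\to[0,\infty]$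 of increasing sequences in $\mathrm{Aff}_+$. The canonical map $\Gamma:\mathrm{Cu}(A)\to\mathrm{LAff}_+$, $[a]\mapsto(\tau\mapsto d_\tau(a))$, is *hereditary surjective* if for all $a\in(A\otimes\mathbb K)_+$ and $f\in\mathrm{LAff}_+$ with $f(\tau)<d_\tau(a)$ for all $\tau\ne0$ there is $b\in(A\otimes\mathbb K)_+$ with $b\lesssim a$ and $d_\tau(b)=f(\tau)$ for all $\tau\in\widetilde{QT}(A)$. *Tracial approximate oscillation zero.* An algebraically simple $C^*$-algebra $B$ with $QT(B)\ne\emptyset$ has tracial approximate oscillation zero if for every $a\in\mathrm{Ped}(B\otimes\mathbb K)_+$ and every $\varepsilon>0$ there is $c\in\mathrm{Her}(a)_+$ with $\|a-c\|_2<\varepsilon$, $\|c\|\le\|a\|$ and $\omega(c)<\varepsilon$. Any other $C^*$-algebra $A$ has tracial approximate oscillation zero if $A\otimes\mathbb K\cong B\otimes\mathbb K$ for some algebraically simple $C^*$-algebra $B$ with $QT(B)\neq\emptyset$ that has it. **Theorem.** Let $A$ be a $\sigma$-unital simple $C^*$-algebra with $QT(A)\ne\emptyset$ such that $\Gamma$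 is hereditary surjective. Then $A$ has tracial approximate oscillation zero. -/

import Mathlib

open scoped ComplexOrder NNReal ENNReal Topology
open Filter UniformSpace

set_option linter.unusedSectionVars false

universe u

noncomputable section

namespace TAOZ

/-! ### The stabilization `A ⊗ 𝕂`

`A ⊗ 𝕂` is the C⋆-inductive limit of the matrix algebras `M_n(A)` under the upper left corner
embeddings, i.e. the completion of the ⋆-algebra of finitely supported infinite matrices over `A`.
-/

section Stabilization

variable (A : Type u) [NonUnitalCStarAlgebra A] [PartialOrder A] [StarOrderedRing A]

/-- The C⋆-algebra `M_n(A)`. -/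
abbrev MatAlg (n : ℕ) : Type u := CStarMatrix (Fin n) (Fin n) A

variable {A} in
/-- The upper left corner embedding `M_m(A) → M_n(A)` (used for `m ≤ n`): pad with zeros. -/
def padMatrix (m n : ℕ) (x : MatAlg A m) : MatAlg A n :=
  CStarMatrix.ofMatrix fun i j =>
    if h : (i : ℕ) < m ∧ (j : ℕ) < m then x ⟨i, h.1⟩ ⟨j, h.2⟩ else 0

theorem padMatrix_apply {m n : ℕ} (x : MatAlg A m) (i j : Fin n) :
    padMatrix m n x i j =
      if h : (i : ℕ) < m ∧ (j : ℕ) < m then x ⟨i, h.1⟩ ⟨j, h.2⟩ else 0 := rfl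

theorem padMatrix_mul {m n : ℕ} (hmn : m ≤ n) (x y : MatAlg A m) :
    padMatrix m n (x * y) = padMatrix m n x * padMatrix m n y := by
  ext i j
  simp only [CStarMatrix.mul_apply, padMatrix_apply]
  by_cases h : (i : ℕ) < m ∧ (j : ℕ) < m
  · rw [dif_pos h]
    rw [← Finset.sum_subset (Finset.subset_univ (Finset.univ.map (Fin.castLEEmb hmn)))]
    · simp [h.1, h.2]
    · intro k _ hk
      have hk' : ¬ (k : ℕ) < m := fun hlt =>
        hk (Finset.mem_map.2 ⟨⟨k, hlt⟩, Finset.mem_univ _, by ext; simp⟩)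
      simp [hk']
  · rw [dif_neg h]
    symm
    refine Finset.sum_eq_zero fun k _ => ?_
    by_cases hi : (i : ℕ) < m
    · have hj : ¬ (j : ℕ) < m := fun hj => h ⟨hi, hj⟩
      simp [hj]
    · simp [hi]

/-- The corner embedding `M_m(A) → M_n(A)` as a ⋆-homomorphism. -/
def padHom {m n : ℕ} (hmn : m ≤ n) : MatAlg A m →⋆ₙₐ[ℂ] MatAlg A n where
  toFun := padMatrix m n
  map_smul' c x := by
    ext i j
    simp only [padMatrix_apply, CStarMatrix.smul_apply, MonoidHom.id_apply]
    split_ifs <;> simp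
  map_zero' := by
    ext i j
    simp [padMatrix_apply]
  map_add' x y := by
    ext i j
    simp only [padMatrix_apply, CStarMatrix.add_apply]
    split_ifs <;> simp
  map_mul' := padMatrix_mul A hmn
  map_star' x := by
    ext i j
    simp only [padMatrix_apply, CStarMatrix.star_apply]
    by_cases h : (i : ℕ) < m ∧ (j : ℕ) < m
    · rw [dif_pos h, dif_pos h.symm]
    · rw [dif_neg h, dif_neg (fun h' => h h'.symm), star_zero]

theorem padMatrix_norm {m n : ℕ} (hmn : m ≤ n) (x : MatAlg A m) : ‖padMatrix m n x‖ = ‖x‖ := by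
  refine NonUnitalStarAlgHom.norm_map (padHom A hmn) (fun x y hxy => ?_) x
  ext i j
  have := congrFun (congrFun hxy (Fin.castLE hmn i)) (Fin.castLE hmn j)
  change padMatrix m n x _ _ = padMatrix m n y _ _ at this
  simpa [padMatrix_apply] using this

theorem padMatrix_padMatrix {k m n : ℕ} (hkm : k ≤ m) (x : MatAlg A k) :
    padMatrix m n (padMatrix k m x) = padMatrix k n x := by
  ext i j
  simp only [padMatrix_apply]
  by_cases h : (i : ℕ) < k ∧ (j : ℕ) < k
  · rw [dif_pos h, dif_pos ⟨h.1.trans_le hkm, h.2.trans_le hkm⟩, dif_pos h]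
  · rw [dif_neg h]
    split_ifs <;> rfl

/-- From index `N` on, the sequence `x` consists of the images of one matrix in `M_N(A)`. -/
def IsCoherentFrom (N : ℕ) (x : (n : ℕ) → MatAlg A n) : Prop :=
  ∀ n, N ≤ n → x n = padMatrix N n (x N)

variable {A} in
theorem IsCoherentFrom.mono {N M : ℕ} (h : N ≤ M) {x : (n : ℕ) → MatAlg A n}
    (hx : IsCoherentFrom A N x) : IsCoherentFrom A M x := by
  intro n hn
  rw [hx n (h.trans hn), hx M h, padMatrix_padMatrix A h]

/-- Sequences of matrices that are eventually the images of one finite matrix. Modulo the sequences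
that are eventually zero this is the algebraic union of the `M_n(A)`. -/
def finMat : NonUnitalStarSubalgebra ℂ ((n : ℕ) → MatAlg A n) where
  carrier := {x | ∃ N, IsCoherentFrom A N x}
  add_mem' := by
    rintro x y ⟨N, hx⟩ ⟨M, hy⟩
    have hx' := hx.mono (le_max_left N M)
    have hy' := hy.mono (le_max_right N M)
    refine ⟨max N M, fun n hn => ?_⟩
    simp only [Pi.add_apply]
    rw [hx' n hn, hy' n hn]
    exact (map_add (padHom A hn) _ _).symm
  zero_mem' := ⟨0, fun n hn => (map_zero (padHom A hn)).symm⟩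
  mul_mem' := by
    rintro x y ⟨N, hx⟩ ⟨M, hy⟩
    have hx' := hx.mono (le_max_left N M)
    have hy' := hy.mono (le_max_right N M)
    refine ⟨max N M, fun n hn => ?_⟩
    simp only [Pi.mul_apply]
    rw [hx' n hn, hy' n hn]
    exact (map_mul (padHom A hn) _ _).symm
  smul_mem' := by
    rintro c x ⟨N, hx⟩
    refine ⟨N, fun n hn => ?_⟩
    simp only [Pi.smul_apply]
    rw [hx n hn]
    exact (map_smul (padHom A hn) c _).symm
  star_mem' := by
    rintro x ⟨N, hx⟩
    refine ⟨N, fun n hn => ?_⟩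
    simp only [Pi.star_apply]
    rw [hx n hn]
    exact (map_star (padHom A hn) _).symm

/-- `finMat A` as a type, with the seminorm `lim ‖x n‖` (whose null space is the set of
eventually zero sequences). -/
def FinMat : Type u := finMat A

namespace FinMat

instance : NonUnitalRing (FinMat A) := inferInstanceAs (NonUnitalRing (finMat A))
instance : StarRing (FinMat A) := inferInstanceAs (StarRing (finMat A))
instance : Module ℂ (FinMat A) := inferInstanceAs (Module ℂ (finMat A))
instance : StarModule ℂ (FinMat A) := inferInstanceAs (StarModule ℂ (finMat A))
instance : IsScalarTower ℂ (FinMat A) (FinMat A) :=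
  inferInstanceAs (IsScalarTower ℂ (finMat A) (finMat A))
instance : SMulCommClass ℂ (FinMat A) (FinMat A) :=
  inferInstanceAs (SMulCommClass ℂ (finMat A) (finMat A))


instance : Norm (FinMat A) := ⟨fun x => limUnder atTop fun n => ‖x.1 n‖⟩

variable {A}

theorem norm_eq {N : ℕ} {x : FinMat A} (hx : IsCoherentFrom A N x.1) : ‖x‖ = ‖x.1 N‖ := by
  refine Tendsto.limUnder_eq (tendsto_const_nhds.congr' ?_)
  filter_upwards [eventually_ge_atTop N] with n hn
  rw [hx n hn, padMatrix_norm A hn]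

theorem exists_coherent (x y : FinMat A) :
    ∃ N, IsCoherentFrom A N x.1 ∧ IsCoherentFrom A N y.1 := by
  obtain ⟨N, hN⟩ := x.2
  obtain ⟨M, hM⟩ := y.2
  exact ⟨max N M, hN.mono (le_max_left _ _), hM.mono (le_max_right _ _)⟩

theorem coherent_mul {N : ℕ} {x y : FinMat A} (hx : IsCoherentFrom A N x.1)
    (hy : IsCoherentFrom A N y.1) : IsCoherentFrom A N (x * y).1 := fun n hn => by
  change x.1 n * y.1 n = padMatrix N n (x.1 N * y.1 N)
  rw [hx n hn, hy n hn, padMatrix_mul A hn]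

theorem coherent_add {N : ℕ} {x y : FinMat A} (hx : IsCoherentFrom A N x.1)
    (hy : IsCoherentFrom A N y.1) : IsCoherentFrom A N (x + y).1 := fun n hn => by
  change x.1 n + y.1 n = padMatrix N n (x.1 N + y.1 N)
  rw [hx n hn, hy n hn]
  exact (map_add (padHom A hn) _ _).symm

theorem coherent_smul {N : ℕ} (c : ℂ) {x : FinMat A} (hx : IsCoherentFrom A N x.1) :
    IsCoherentFrom A N (c • x).1 := fun n hn => by
  change c • x.1 n = padMatrix N n (c • x.1 N)
  rw [hx n hn]
  exact (map_smul (padHom A hn) _ _).symm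

theorem coherent_star {N : ℕ} {x : FinMat A} (hx : IsCoherentFrom A N x.1) :
    IsCoherentFrom A N (star x).1 := fun n hn => by
  change star (x.1 n) = padMatrix N n (star (x.1 N))
  rw [hx n hn]
  exact (map_star (padHom A hn) _).symm

variable (A)

theorem seminormCore : SeminormedSpace.Core ℂ (FinMat A) where
  norm_nonneg x := by
    obtain ⟨N, hN⟩ := x.2
    rw [norm_eq hN]
    exact norm_nonneg _
  norm_smul c x := by
    obtain ⟨N, hN⟩ := x.2
    rw [norm_eq hN, norm_eq (coherent_smul c hN)]
    exact norm_smul c (x.1 N)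
  norm_triangle x y := by
    obtain ⟨N, hx, hy⟩ := exists_coherent x y
    rw [norm_eq hx, norm_eq hy, norm_eq (coherent_add hx hy)]
    exact norm_add_le (x.1 N) (y.1 N)

instance : SeminormedAddCommGroup (FinMat A) :=
  SeminormedAddCommGroup.ofCore (𝕜 := ℂ) (seminormCore A)

instance : NonUnitalSeminormedRing (FinMat A) where
  __ : NonUnitalRing (FinMat A) := inferInstance
  __ : SeminormedAddCommGroup (FinMat A) := inferInstance
  norm_mul_le x y := by
    obtain ⟨N, hx, hy⟩ := exists_coherent x y
    rw [norm_eq hx, norm_eq hy, norm_eq (coherent_mul hx hy)]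
    exact norm_mul_le (x.1 N) (y.1 N)

instance : NormedSpace ℂ (FinMat A) where
  norm_smul_le c x := ((seminormCore A).norm_smul c x).le

instance : NormedStarGroup (FinMat A) where
  norm_star_le x := by
    obtain ⟨N, hN⟩ := x.2
    rw [norm_eq hN, norm_eq (coherent_star hN)]
    exact (norm_star (x.1 N)).le

variable {A} in
theorem norm_mul_self_le (x : FinMat A) : ‖x‖ * ‖x‖ ≤ ‖star x * x‖ := by
  obtain ⟨N, hN⟩ := x.2
  rw [norm_eq hN, norm_eq (coherent_mul (coherent_star hN) hN)]
  exact CStarRing.norm_mul_self_le (x.1 N)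

end FinMat

/-- The stabilization `A ⊗ 𝕂`: the Hausdorff completion of the union of the `M_n(A)`. -/
def Stab : Type u := Completion (FinMat A)

namespace Stab

instance : NormedAddCommGroup (Stab A) :=
  inferInstanceAs (NormedAddCommGroup (Completion (FinMat A)))
instance : NormedSpace ℂ (Stab A) := inferInstanceAs (NormedSpace ℂ (Completion (FinMat A)))
instance : CompleteSpace (Stab A) := inferInstanceAs (CompleteSpace (Completion (FinMat A)))

theorem continuous_smul' (c : ℂ) : Continuous fun x : Stab A => c • x := continuous_const_smul c

variable {A}

/-- The canonical map from finite matrices to `A ⊗ 𝕂`. -/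
def of (x : FinMat A) : Stab A := (x : Completion (FinMat A))

theorem isDenseInducing_of : IsDenseInducing (of : FinMat A → Stab A) :=
  Completion.isDenseInducing_coe

theorem continuous_of : Continuous (of : FinMat A → Stab A) := isDenseInducing_of.continuous
theorem denseRange_of : DenseRange (of : FinMat A → Stab A) := isDenseInducing_of.dense

theorem norm_of (x : FinMat A) : ‖of x‖ = ‖x‖ := Completion.norm_coe x
theorem of_add (x y : FinMat A) : of (x + y) = of x + of y := Completion.coe_add x y
theorem of_zero : of (0 : FinMat A) = 0 := Completion.coe_zero
theorem of_smul (c : ℂ) (x : FinMat A) : of (c • x) = c • of x := Completion.coe_smul c x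

instance : Mul (Stab A) :=
  ⟨Function.curry ((isDenseInducing_of.prodMap isDenseInducing_of).extend
    (of ∘ Function.uncurry (· * ·)))⟩

theorem of_mul (x y : FinMat A) : of (x * y) = of x * of y :=
  ((isDenseInducing_of.prodMap isDenseInducing_of).extend_eq
    (continuous_of.comp continuous_mul) (x, y)).symm

instance : ContinuousMul (Stab A) where
  continuous_mul := by
    let m : FinMat A →+ FinMat A →+ Stab A :=
      (AddMonoidHom.mul : FinMat A →+ FinMat A →+ FinMat A).compr₂ Completion.toCompl
    have hm : Continuous fun p : FinMat A × FinMat A => m p.1 p.2 :=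
      continuous_of.comp continuous_mul
    have di : IsDenseInducing (Completion.toCompl : FinMat A → Completion (FinMat A)) :=
      isDenseInducing_of
    exact di.extend_Z_bilin di hm

instance : Star (Stab A) := ⟨Completion.map (star : FinMat A → FinMat A)⟩

theorem of_star (x : FinMat A) : of (star x) = star (of x) :=
  (Completion.map_coe (star_isometry (E := FinMat A)).uniformContinuous x).symm

theorem continuous_star' : Continuous (star : Stab A → Stab A) := Completion.continuous_map

theorem ind₁ {p : Stab A → Prop} (hp : IsClosed {x | p x}) (h : ∀ x, p (of x)) (x : Stab A) :
    p x := Completion.induction_on x hp h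

theorem ind₂ {p : Stab A → Stab A → Prop} (hp : IsClosed {x : Stab A × Stab A | p x.1 x.2})
    (h : ∀ x y, p (of x) (of y)) (x y : Stab A) : p x y := Completion.induction_on₂ x y hp h

theorem ind₃ {p : Stab A → Stab A → Stab A → Prop}
    (hp : IsClosed {x : Stab A × Stab A × Stab A | p x.1 x.2.1 x.2.2})
    (h : ∀ x y z, p (of x) (of y) (of z)) (x y z : Stab A) : p x y z :=
  Completion.induction_on₃ x y z hp h

variable (A)

instance : NonUnitalRing (Stab A) where
  __ : AddCommGroup (Stab A) := inferInstance
  zero_mul := ind₁ (isClosed_eq (by fun_prop) continuous_const) fun x => by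
    rw [← of_zero, ← of_mul, zero_mul]
  mul_zero := ind₁ (isClosed_eq (by fun_prop) continuous_const) fun x => by
    rw [← of_zero, ← of_mul, mul_zero]
  mul_assoc := ind₃ (isClosed_eq (by fun_prop) (by fun_prop)) fun x y z => by
    rw [← of_mul, ← of_mul, ← of_mul, ← of_mul, mul_assoc]
  left_distrib := ind₃ (isClosed_eq (by fun_prop) (by fun_prop)) fun x y z => by
    rw [← of_add, ← of_mul, ← of_mul, ← of_mul, ← of_add, mul_add]
  right_distrib := ind₃ (isClosed_eq (by fun_prop) (by fun_prop)) fun x y z => by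
    rw [← of_add, ← of_mul, ← of_mul, ← of_mul, ← of_add, add_mul]

instance : NonUnitalNormedRing (Stab A) where
  __ : NonUnitalRing (Stab A) := inferInstance
  __ : NormedAddCommGroup (Stab A) := inferInstance
  norm_mul_le := ind₂ (isClosed_le (by fun_prop) (by fun_prop)) fun x y => by
    rw [← of_mul, norm_of, norm_of, norm_of]
    exact norm_mul_le x y

instance : StarRing (Stab A) where
  star_involutive := ind₁ (isClosed_eq (continuous_star'.comp continuous_star') continuous_id)
    fun x => by rw [← of_star, ← of_star, star_star]
  star_mul := ind₂ (isClosed_eq (continuous_star'.comp (by fun_prop))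
      ((continuous_star'.comp continuous_snd).mul (continuous_star'.comp continuous_fst)))
    fun x y => by rw [← of_mul, ← of_star, ← of_star, ← of_star, ← of_mul, star_mul]
  star_add := ind₂ (isClosed_eq (continuous_star'.comp (by fun_prop))
      ((continuous_star'.comp continuous_fst).add (continuous_star'.comp continuous_snd)))
    fun x y => by rw [← of_add, ← of_star, ← of_star, ← of_star, ← of_add, star_add]


variable {A} in
theorem smul_mul' (c : ℂ) (x y : Stab A) : (c • x) * y = c • (x * y) := by
  refine ind₂ (p := fun x y => (c • x) * y = c • (x * y))
    (isClosed_eq (((continuous_smul' A c).comp continuous_fst).mul continuous_snd)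
      ((continuous_smul' A c).comp (continuous_fst.mul continuous_snd))) (fun x y => ?_) x y
  rw [← of_smul, ← of_mul, ← of_mul, ← of_smul, smul_mul_assoc]

variable {A} in
theorem mul_smul' (c : ℂ) (x y : Stab A) : x * (c • y) = c • (x * y) := by
  refine ind₂ (p := fun x y => x * (c • y) = c • (x * y))
    (isClosed_eq (continuous_fst.mul ((continuous_smul' A c).comp continuous_snd))
      ((continuous_smul' A c).comp (continuous_fst.mul continuous_snd))) (fun x y => ?_) x y
  rw [← of_smul, ← of_mul, ← of_mul, ← of_smul, mul_smul_comm]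

variable {A} in
theorem star_smul' (c : ℂ) (x : Stab A) : star (c • x) = star c • star x := by
  refine ind₁ (p := fun x => star (c • x) = star c • star x)
    (isClosed_eq (continuous_star'.comp (continuous_smul' A c))
      ((continuous_smul' A _).comp continuous_star'))
    (fun x => ?_) x
  rw [← of_smul, ← of_star, ← of_star, ← of_smul, star_smul]

variable {A} in
theorem norm_mul_self_le' (x : Stab A) : ‖x‖ * ‖x‖ ≤ ‖star x * x‖ := by
  refine ind₁ (p := fun x => ‖x‖ * ‖x‖ ≤ ‖star x * x‖) (isClosed_le (by fun_prop)
    (continuous_norm.comp (continuous_star'.mul continuous_id))) (fun x => ?_) x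
  rw [← of_star, ← of_mul, norm_of, norm_of]
  exact x.norm_mul_self_le

instance : NonUnitalCStarAlgebra (Stab A) where
  __ : NonUnitalNormedRing (Stab A) := inferInstance
  __ : NormedSpace ℂ (Stab A) := inferInstance
  __ : StarRing (Stab A) := inferInstance
  __ : CompleteSpace (Stab A) := inferInstance
  norm_mul_self_le := norm_mul_self_le'
  smul_assoc := smul_mul'
  smul_comm c x y := (mul_smul' c x y).symm
  star_smul := star_smul'

instance : PartialOrder (Stab A) := CStarAlgebra.spectralOrder _
instance : StarOrderedRing (Stab A) := CStarAlgebra.spectralOrderedRing _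

end Stab

variable {A} in
/-- The `1 × 1` matrix `(a)`. -/
def oneMatrix (a : A) : MatAlg A 1 := CStarMatrix.ofMatrix fun _ _ => a

variable {A} in
/-- The finite matrix `a ⊗ e₁₁`. -/
def cornerFin (a : A) : FinMat A :=
  ⟨fun n => padMatrix 1 n (oneMatrix a), 1, fun n _ => by
    rw [padMatrix_padMatrix A le_rfl]⟩

variable {A} in
theorem cornerFin_apply (a : A) (n : ℕ) (i j : Fin n) :
    (cornerFin a).1 n i j = if (i : ℕ) < 1 ∧ (j : ℕ) < 1 then a else 0 := by
  change padMatrix 1 n (oneMatrix a) i j = _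
  rw [padMatrix_apply]
  split_ifs <;> rfl

variable {A} in
theorem cornerFin_coherent (a : A) : IsCoherentFrom A 1 (cornerFin a).1 := fun n _ => by
  change padMatrix 1 n _ = padMatrix 1 n (padMatrix 1 1 _)
  rw [padMatrix_padMatrix A le_rfl]

theorem FinMat.ext' {x y : FinMat A} (h : ∀ n i j, x.1 n i j = y.1 n i j) : x = y := by
  refine Subtype.ext (funext fun n => ?_)
  ext i j
  exact h n i j

/-- The embedding `a ↦ a ⊗ e₁₁` of `A` into `A ⊗ 𝕂`. -/
def corner : A →⋆ₙₐ[ℂ] Stab A where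
  toFun a := Stab.of (cornerFin a)
  map_smul' c a := by
    rw [MonoidHom.id_apply, ← Stab.of_smul]
    congr 1
    refine FinMat.ext' A fun n i j => ?_
    change _ = c • (cornerFin a).1 n i j
    rw [cornerFin_apply, cornerFin_apply]
    split_ifs <;> simp
  map_zero' := by
    rw [← Stab.of_zero]
    congr 1
    refine FinMat.ext' A fun n i j => ?_
    change _ = (0 : A)
    rw [cornerFin_apply]
    split_ifs <;> simp
  map_add' a b := by
    rw [← Stab.of_add]
    congr 1
    refine FinMat.ext' A fun n i j => ?_
    change _ = (cornerFin a).1 n i j + (cornerFin b).1 n i j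
    rw [cornerFin_apply, cornerFin_apply, cornerFin_apply]
    split_ifs <;> simp
  map_mul' a b := by
    rw [← Stab.of_mul]
    congr 1
    refine FinMat.ext' A fun n i j => ?_
    have hn : 1 ≤ n := i.pos
    have hab : oneMatrix (a * b) = oneMatrix a * oneMatrix b := by
      ext k l
      rw [CStarMatrix.mul_apply, Fin.sum_univ_one]
      rfl
    change padMatrix 1 n (oneMatrix (a * b)) i j
      = (padMatrix 1 n (oneMatrix a) * padMatrix 1 n (oneMatrix b) : MatAlg A n) i j
    rw [← padMatrix_mul A hn, hab]
  map_star' a := by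
    rw [← Stab.of_star]
    congr 1
    refine FinMat.ext' A fun n i j => ?_
    change _ = star ((cornerFin a).1 n j i)
    rw [cornerFin_apply, cornerFin_apply]
    by_cases h : (i : ℕ) < 1 ∧ (j : ℕ) < 1
    · rw [if_pos h, if_pos h.symm]
    · rw [if_neg h, if_neg (fun h' => h h'.symm), star_zero]

theorem corner_norm (a : A) : ‖corner A a‖ = ‖a‖ := by
  refine le_antisymm (NonUnitalStarAlgHom.norm_apply_le (corner A) a) ?_
  change ‖a‖ ≤ ‖Stab.of (cornerFin a)‖
  rw [Stab.norm_of, FinMat.norm_eq (cornerFin_coherent a)]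
  calc ‖a‖ = ‖(cornerFin a).1 1 0 0‖ := by rw [cornerFin_apply]; simp
    _ ≤ ‖(cornerFin a).1 1‖ := CStarMatrix.norm_entry_le_norm

variable {A} in
theorem corner_mul_mul_corner (u v : A) (z : Stab A) :
    ∃ b, corner A u * z * corner A v = corner A b := by
  have hcl : IsClosed (Set.range (corner A)) :=
    (AddMonoidHomClass.isometry_of_norm (corner A) (corner_norm A)).isClosedEmbedding.isClosed_range
  have key : ∀ z : Stab A, corner A u * z * corner A v ∈ Set.range (corner A) := by
    refine Stab.ind₁ (hcl.preimage (by fun_prop :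
      Continuous fun z : Stab A => corner A u * z * corner A v)) fun x => ?_
    obtain ⟨N, hx⟩ := x.2
    have hx := hx.mono (Nat.le_succ N)
    refine ⟨u * x.1 (N + 1) 0 0 * v, ?_⟩
    change Stab.of (cornerFin _) = Stab.of (cornerFin u) * Stab.of x * Stab.of (cornerFin v)
    rw [← Stab.of_mul, ← Stab.of_mul, ← sub_eq_zero]
    have hsub : ∀ p q : FinMat A, Stab.of p - Stab.of q = Stab.of (p - q) := fun p q => by
      rw [sub_eq_iff_eq_add, ← Stab.of_add, sub_add_cancel]
    rw [hsub, ← norm_eq_zero, Stab.norm_of]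
    have h1 : 1 ≤ N + 1 := by omega
    have hcu := (cornerFin_coherent u).mono h1
    have hcv := (cornerFin_coherent v).mono h1
    have hcw := (cornerFin_coherent (u * x.1 (N + 1) 0 0 * v)).mono h1
    have hprod := FinMat.coherent_mul (FinMat.coherent_mul hcu hx) hcv
    have hneg := FinMat.coherent_smul (-1) hprod
    rw [neg_one_smul] at hneg
    rw [sub_eq_add_neg, FinMat.norm_eq (FinMat.coherent_add hcw hneg), norm_eq_zero]
    ext i j
    change (cornerFin _).1 (N + 1) i j + -(((cornerFin u).1 (N + 1) * x.1 (N + 1)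
      * (cornerFin v).1 (N + 1) : MatAlg A (N + 1)) i j) = 0
    rw [add_neg_eq_zero]
    simp only [CStarMatrix.mul_apply, cornerFin_apply, Nat.lt_one_iff, Fin.val_eq_zero_iff]
    by_cases hi : i = 0 <;> by_cases hj : j = 0 <;> simp [hi, hj]
  obtain ⟨b, hb⟩ := key z
  exact ⟨b, hb.symm⟩

end Stabilization

/-! ### Ideals and the Pedersen ideal -/

section Pedersen

section
variable {A : Type u} [NonUnitalCStarAlgebra A]

/-- Two-sided ideals of the algebra `A`. -/
def IsIdeal (I : Submodule ℂ A) : Prop :=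
  ∀ x ∈ I, ∀ a : A, a * x ∈ I ∧ x * a ∈ I

variable (A) in
/-- `A` is nonzero and has no nontrivial closed two-sided ideals. -/
def IsSimpleCStar : Prop :=
  Nontrivial A ∧ ∀ I : Submodule ℂ A, IsIdeal I → IsClosed (I : Set A) → I = ⊥ ∨ I = ⊤

variable (A) in
/-- `A` is nonzero and has no nontrivial two-sided ideals at all. -/
def IsAlgSimple : Prop :=
  Nontrivial A ∧ ∀ I : Submodule ℂ A, IsIdeal I → I = ⊥ ∨ I = ⊤

/-- The image of a subspace under the involution. -/
def starIdeal (I : Submodule ℂ A) : Submodule ℂ A where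
  carrier := {x | star x ∈ I}
  add_mem' {x y} hx hy := by simpa using I.add_mem hx hy
  zero_mem' := by simp
  smul_mem' c x hx := by simpa using I.smul_mem (star c) hx

variable (A) in
/-- The Pedersen ideal, i.e. the smallest dense two-sided ideal: the intersection of all dense
two-sided ideals. -/
def pedersen : NonUnitalStarSubalgebra ℂ A where
  carrier := {x | ∀ I : Submodule ℂ A, IsIdeal I → Dense (I : Set A) → x ∈ I}
  add_mem' hx hy I hI hd := I.add_mem (hx I hI hd) (hy I hI hd)
  zero_mem' I _ _ := I.zero_mem
  mul_mem' {x y} hx _ I hI hd := (hI x (hx I hI hd) y).2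
  smul_mem' c x hx I hI hd := I.smul_mem c (hx I hI hd)
  star_mem' {x} hx I hI hd := by
    refine hx (starIdeal I) (fun y hy a => ?_) ?_
    · have h := hI (star y) hy (star a)
      refine ⟨?_, ?_⟩
      · change star (a * y) ∈ I
        rw [star_mul]; exact h.2
      · change star (y * a) ∈ I
        rw [star_mul]; exact h.1
    · exact hd.preimage (starL ℂ (A := A)).toHomeomorph.isOpenMap

theorem mem_pedersen_of_mul_eq {e b : A} (h : e * b = b) : b ∈ pedersen A := by
  intro I hI hd
  obtain ⟨y, hy, hyI⟩ := Metric.dense_iff.1 hd e 1 one_pos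
  have hw : ‖((e - y : A) : Unitization ℂ A)‖ < 1 := by
    rw [Unitization.norm_inr, ← dist_eq_norm, dist_comm]
    exact hy
  set U := Units.oneSub _ hw with hU
  have h1 : (U : Unitization ℂ A) * (b : Unitization ℂ A) = ((y * b : A) : Unitization ℂ A) := by
    rw [hU, Units.val_oneSub, sub_mul, one_mul, ← Unitization.inr_mul, ← Unitization.inr_sub,
      sub_mul, h, sub_sub_cancel]
  have h2 : (b : Unitization ℂ A) = (↑U⁻¹ : Unitization ℂ A) * ((y * b : A) : Unitization ℂ A) := by
    rw [← h1, Units.inv_mul_cancel_left]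
  have hyb : y * b ∈ I := (hI y hyI b).2
  have h3 := congrArg (fun z : Unitization ℂ A => z.snd) h2
  simp only [Unitization.snd_inr, Unitization.snd_mul, Unitization.fst_inr, zero_smul,
    add_zero] at h3
  rw [h3]
  exact I.add_mem (I.smul_mem _ hyb) (hI _ hyb _).1

/-- The function that is `0` on `(-∞, ε]`, `1` on `[2ε, ∞)` and linear on `[ε, 2ε]`. -/
def fEps (ε t : ℝ) : ℝ := max 0 (min 1 ((t - ε) / ε))

theorem fEps_continuous (ε : ℝ) : Continuous (fEps ε) := by
  unfold fEps; fun_prop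

theorem fEps_eq_zero {ε t : ℝ} (hε : 0 < ε) (ht : t ≤ ε) : fEps ε t = 0 := by
  unfold fEps
  exact max_eq_left ((min_le_right _ _).trans (div_nonpos_of_nonpos_of_nonneg (by linarith) hε.le))

theorem fEps_eq_one {ε t : ℝ} (hε : 0 < ε) (ht : 2 * ε ≤ t) : fEps ε t = 1 := by
  unfold fEps
  rw [min_eq_left ((one_le_div hε).2 (by linarith))]
  norm_num

theorem cfc_mem_pedersen {ε : ℝ} (hε : 0 < ε) (g : ℝ → ℝ) (hg : Continuous g)
    (hg0 : ∀ t ≤ ε, g t = 0) (a : A) : cfcₙ g a ∈ pedersen A := by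
  have hε' : 0 < ε / 2 := by positivity
  refine mem_pedersen_of_mul_eq (e := cfcₙ (fEps (ε / 2)) a) ?_
  rw [← cfcₙ_mul (fEps (ε / 2)) g a (fEps_continuous _).continuousOn
    (fEps_eq_zero hε' hε'.le) hg.continuousOn (hg0 0 hε.le)]
  congr 1
  funext t
  rcases le_or_gt t ε with h | h
  · rw [hg0 t h, mul_zero]
  · rw [fEps_eq_one hε' (by linarith), one_mul]

/-- `f_ε(a)` as an element of the Pedersen ideal. -/
def pedF (ε : ℝ) (hε : 0 < ε) (a : A) : pedersen A :=
  ⟨cfcₙ (fEps ε) a, cfc_mem_pedersen hε _ (fEps_continuous ε) (fun _ ht => fEps_eq_zero hε ht) a⟩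

/-- `(a - ε)₊` as an element of the Pedersen ideal. -/
def pedCut (ε : ℝ) (hε : 0 < ε) (a : A) : pedersen A :=
  ⟨cfcₙ (fun t : ℝ => max (t - ε) 0) a,
    cfc_mem_pedersen hε _ (by fun_prop) (fun _ ht => max_eq_right (by linarith)) a⟩

end

variable {A : Type u} [NonUnitalCStarAlgebra A] [PartialOrder A] [StarOrderedRing A]

theorem corner_mem_pedersen {a : A} (ha : a ∈ pedersen A) : corner A a ∈ pedersen (Stab A) := by
  intro I hI hd
  let J : Submodule ℂ A :=
    { carrier := {b | corner A b ∈ I}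
      add_mem' := fun {x y} hx hy => by
        change corner A (x + y) ∈ I
        rw [map_add]; exact I.add_mem hx hy
      zero_mem' := by
        change corner A 0 ∈ I
        rw [map_zero]; exact I.zero_mem
      smul_mem' := fun c x hx => by
        change corner A (c • x) ∈ I
        rw [map_smul]; exact I.smul_mem c hx }
  have hiso : Isometry (corner A) := AddMonoidHomClass.isometry_of_norm (corner A) (corner_norm A)
  have huv : ∀ u b v : A, u * b * v ∈ closure (J : Set A) := by
    intro u b v
    rw [hiso.isEmbedding.closure_eq_preimage_closure_image]
    rw [Set.mem_preimage, map_mul, map_mul]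
    have hc : Continuous fun z : Stab A => corner A u * z * corner A v := by fun_prop
    refine map_mem_closure (f := fun z => corner A u * z * corner A v) hc (hd (corner A b)) fun z hz => ?_
    obtain ⟨w, hw⟩ := corner_mul_mul_corner u v z
    refine ⟨w, ?_, hw.symm⟩
    change corner A w ∈ I
    rw [← hw]
    exact (hI _ (hI z hz _).1 _).2
  refine ha J (fun x hx b => ?_) ?_
  · have hx' : corner A x ∈ I := hx
    refine ⟨?_, ?_⟩
    · change corner A (b * x) ∈ I
      rw [map_mul]; exact (hI _ hx' _).1
    · change corner A (x * b) ∈ I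
      rw [map_mul]; exact (hI _ hx' _).2
  · intro b
    have hl := CStarAlgebra.increasingApproximateUnit A
    have := hl.toIsApproximateUnit.neBot
    have h1 : ∀ u : A, u * b ∈ closure (J : Set A) := fun u =>
      isClosed_closure.mem_of_tendsto
        (hl.toIsApproximateUnit.tendsto_mul_left (u * b)) (Eventually.of_forall fun v => huv u b v)
    exact isClosed_closure.mem_of_tendsto
      (hl.toIsApproximateUnit.tendsto_mul_right b) (Eventually.of_forall fun u => h1 u)

end Pedersen

/-! ### Quasitraces -/

section Quasitraces

/-- Quasitraces on a pre-C⋆-algebra `P`. -/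
structure IsQuasitrace {P : Type u} [NonUnitalRing P] [StarRing P] [Module ℂ P]
    (τ : P → ℂ) : Prop where
  nonneg : ∀ x, 0 ≤ τ (star x * x)
  trace : ∀ x, τ (star x * x) = τ (x * star x)
  linear : ∀ C : NonUnitalStarSubalgebra ℂ P, (∀ x ∈ C, ∀ y ∈ C, x * y = y * x) →
    (∀ x ∈ C, ∀ y ∈ C, τ (x + y) = τ x + τ y) ∧ ∀ c : ℂ, ∀ x ∈ C, τ (c • x) = c * τ x
  decomp : ∀ a b, IsSelfAdjoint a → IsSelfAdjoint b →
    τ (a + Complex.I • b) = τ a + Complex.I * τ b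

/-- A 2-quasitrace is a quasitrace that extends to a quasitrace on `M₂(P)`. -/
def IsTwoQuasitrace {P : Type u} [NonUnitalRing P] [StarRing P] [Module ℂ P]
    (τ : P → ℂ) : Prop :=
  IsQuasitrace τ ∧ ∃ τ₂ : Matrix (Fin 2) (Fin 2) P → ℂ,
    IsQuasitrace τ₂ ∧ ∀ x, τ₂ (Matrix.single 0 0 x) = τ x

section
variable {P : Type u} [NonUnitalRing P] [StarRing P] [Module ℂ P]

theorem IsQuasitrace.zero : IsQuasitrace (0 : P → ℂ) where
  nonneg _ := le_rfl
  trace _ := rfl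
  linear _ _ := by simp
  decomp := by simp

theorem IsQuasitrace.add {τ σ : P → ℂ} (hτ : IsQuasitrace τ) (hσ : IsQuasitrace σ) :
    IsQuasitrace (τ + σ) where
  nonneg x := add_nonneg (hτ.nonneg x) (hσ.nonneg x)
  trace x := by simp only [Pi.add_apply, hτ.trace, hσ.trace]
  linear C hC := by
    obtain ⟨h1, h2⟩ := hτ.linear C hC
    obtain ⟨h3, h4⟩ := hσ.linear C hC
    refine ⟨fun x hx y hy => ?_, fun c x hx => ?_⟩
    · simp only [Pi.add_apply, h1 x hx y hy, h3 x hx y hy]; ring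
    · simp only [Pi.add_apply, h2 c x hx, h4 c x hx]; ring
  decomp a b ha hb := by
    simp only [Pi.add_apply, hτ.decomp a b ha hb, hσ.decomp a b ha hb]; ring

theorem IsQuasitrace.smul (s : ℝ≥0) {τ : P → ℂ} (hτ : IsQuasitrace τ) :
    IsQuasitrace (fun x => ((s : ℝ) : ℂ) * τ x) where
  nonneg x := mul_nonneg (by exact_mod_cast s.2) (hτ.nonneg x)
  trace x := by rw [hτ.trace]
  linear C hC := by
    obtain ⟨h1, h2⟩ := hτ.linear C hC
    refine ⟨fun x hx y hy => ?_, fun c x hx => ?_⟩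
    · rw [h1 x hx y hy]; ring
    · rw [h2 c x hx]; ring
  decomp a b ha hb := by rw [hτ.decomp a b ha hb]; ring

end

variable (A : Type u) [NonUnitalCStarAlgebra A] [PartialOrder A] [StarOrderedRing A]

/-- The densely defined 2-quasitraces on `A ⊗ 𝕂`, i.e. the 2-quasitraces on `Ped(A ⊗ 𝕂)`, with the
topology of pointwise convergence on `Ped(A ⊗ 𝕂)`. -/
def DenseQT : Type u := {τ : pedersen (Stab A) → ℂ // IsTwoQuasitrace τ}

namespace DenseQT

instance : TopologicalSpace (DenseQT A) :=
  inferInstanceAs (TopologicalSpace {τ : pedersen (Stab A) → ℂ // IsTwoQuasitrace τ})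

instance : Zero (DenseQT A) := ⟨0, IsQuasitrace.zero, 0, IsQuasitrace.zero, fun _ => rfl⟩

instance : Add (DenseQT A) := ⟨fun τ σ => ⟨τ.1 + σ.1, τ.2.1.add σ.2.1, by
  obtain ⟨τ₂, h1, h2⟩ := τ.2.2
  obtain ⟨σ₂, h3, h4⟩ := σ.2.2
  exact ⟨τ₂ + σ₂, h1.add h3, fun x => by simp only [Pi.add_apply, h2, h4]⟩⟩⟩

instance : SMul ℝ≥0 (DenseQT A) := ⟨fun s τ => ⟨fun x => ((s : ℝ) : ℂ) * τ.1 x, τ.2.1.smul s, by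
  obtain ⟨τ₂, h1, h2⟩ := τ.2.2
  exact ⟨fun x => ((s : ℝ) : ℂ) * τ₂ x, h1.smul s,
    fun x => congrArg (fun z => ((s : ℝ) : ℂ) * z) (h2 x)⟩⟩⟩

variable {A}

/-- The value `τ(x) ∈ [0, ∞)` at a positive element `x` of the Pedersen ideal. -/
def val (τ : DenseQT A) (x : pedersen (Stab A)) : ℝ≥0∞ := ENNReal.ofReal (τ.1 x).re

/-- The lower semicontinuous extension `a ↦ lim_{ε → 0} τ((a - ε)₊)` of `τ` to the positive cone of
`A ⊗ 𝕂`; the limit is a supremum since the expression is antitone in `ε`. -/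
def ext (τ : DenseQT A) (a : Stab A) : ℝ≥0∞ :=
  ⨆ ε : {ε : ℝ // 0 < ε}, τ.val (pedCut ε.1 ε.2 a)

/-- `d_τ(a) = lim_n τ(f_{1/n}(a))`; the limit is a supremum since the sequence increases. -/
def dim (τ : DenseQT A) (a : Stab A) : ℝ≥0∞ :=
  ⨆ n : ℕ, τ.val (pedF (1 / ((n : ℝ) + 1)) Nat.one_div_pos_of_nat a)

variable (A) in
/-- `‖τ|_A‖ = sup {τ(a ⊗ e₁₁) : a ∈ Ped(A)₊, ‖a‖ ≤ 1}`. -/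
def normOn (τ : DenseQT A) : ℝ≥0∞ :=
  ⨆ a : {a : pedersen A // 0 ≤ (a : A) ∧ ‖(a : A)‖ ≤ 1},
    τ.val ⟨corner A (a.1 : A), corner_mem_pedersen a.1.2⟩

end DenseQT

/-- The densely defined 2-quasitraces with `‖τ|_A‖ = 1`. -/
def QT : Set (DenseQT A) := {τ | τ.normOn = 1}

variable {A}

/-- `‖x‖₂ = sup {τ(x⋆x)^{1/2} : τ ∈ closure of QT(A)}`. -/
def twoNorm (x : Stab A) : ℝ≥0∞ :=
  ⨆ τ ∈ closure (QT A), (τ.ext (star x * x)) ^ (1 / 2 : ℝ)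

/-- The tracial oscillation
`ω(a) = lim_n sup {d_τ(a) - τ(f_{1/n}(a)) : τ ∈ closure of QT(A)}`;
the limit is an infimum since the sequence decreases. -/
def oscillation (a : Stab A) : ℝ≥0∞ :=
  ⨅ n : ℕ, ⨆ τ ∈ closure (QT A),
    (τ.dim a - τ.val (pedF (1 / ((n : ℝ) + 1)) Nat.one_div_pos_of_nat a))

/-- The hereditary C⋆-subalgebra of `A ⊗ 𝕂` generated by a positive element `a`, that is, the norm
closure of `a (A ⊗ 𝕂) a`. -/
def her (a : Stab A) : Set (Stab A) := closure (Set.range fun x => a * x * a)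

/-- Cuntz subequivalence `a ≲ b` in `A ⊗ 𝕂`. -/
def CuntzLE (a b : Stab A) : Prop :=
  ∃ x : ℕ → Stab A, Tendsto (fun k => ‖a - star (x k) * b * x k‖) atTop (𝓝 0)

/-- Continuous, additive, `ℝ≥0`-homogeneous real functions on the cone of densely defined
2-quasitraces. -/
structure IsAff (f : DenseQT A → ℝ) : Prop where
  continuous : Continuous f
  map_smul : ∀ (s : ℝ≥0) (τ : DenseQT A), f (s • τ) = s * f τ
  map_add : ∀ τ σ : DenseQT A, f (τ + σ) = f τ + f σ

/-- `Aff₊`: the members of `Aff` that are strictly positive off zero, and the zero function. -/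
def IsAffPos (f : DenseQT A → ℝ) : Prop :=
  IsAff f ∧ ((∀ τ : DenseQT A, τ ≠ 0 → 0 < f τ) ∨ ∀ τ, f τ = 0)

/-- `LAff₊`: the pointwise limits, with values in `[0, ∞]`, of increasing sequences in `Aff₊`. -/
def IsLAffPos (f : DenseQT A → ℝ≥0∞) : Prop :=
  ∃ g : ℕ → DenseQT A → ℝ, (∀ n, IsAffPos (g n)) ∧ (∀ n τ, g n τ ≤ g (n + 1) τ) ∧
    ∀ τ, Tendsto (fun n => ENNReal.ofReal (g n τ)) atTop (𝓝 (f τ))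

variable (A)

/-- The canonical map `Γ : [a] ↦ (τ ↦ d_τ(a))` is hereditary surjective: below every positive `a`,
every function in `LAff₊` that is strictly smaller than `Γ([a])` off zero is of the form `Γ([b])`
for some positive `b ≲ a`. -/
def HereditarySurjective : Prop :=
  ∀ a : Stab A, 0 ≤ a → ∀ f : DenseQT A → ℝ≥0∞, IsLAffPos f →
    (∀ τ : DenseQT A, τ ≠ 0 → f τ < τ.dim a) →
      ∃ b : Stab A, 0 ≤ b ∧ CuntzLE b a ∧ ∀ τ : DenseQT A, τ.dim b = f τ

/-- `A` has a countable increasing approximate unit of positive contractions. -/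
def IsSigmaUnital : Prop :=
  ∃ e : ℕ → A, Monotone e ∧ (∀ n, 0 ≤ e n ∧ ‖e n‖ ≤ 1) ∧
    ∀ a : A, Tendsto (fun n => e n * a) atTop (𝓝 a) ∧ Tendsto (fun n => a * e n) atTop (𝓝 a)

variable {A} in
/-- The element `a` has tracial approximate oscillation zero. -/
def ElementTAOZ (a : Stab A) : Prop :=
  ∀ ε : ℝ, 0 < ε → ∃ c ∈ her a, 0 ≤ c ∧ twoNorm (a - c) < ENNReal.ofReal ε ∧ ‖c‖ ≤ ‖a‖ ∧
    oscillation c < ENNReal.ofReal ε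

/-- Every positive element of `Ped(A ⊗ 𝕂)` has tracial approximate oscillation zero. -/
def AllElementsTAOZ : Prop :=
  ∀ a ∈ pedersen (Stab A), 0 ≤ a → ElementTAOZ a

/-- Tracial approximate oscillation zero. For an algebraically simple `A` with `QT(A) ≠ ∅` this says
that all positive elements of `Ped(A ⊗ 𝕂)` have tracial approximate oscillation zero; any other `A`
has it if it is stably isomorphic to an algebraically simple `B` with `QT(B) ≠ ∅` that has it. -/
def HasTAOZ : Prop :=
  (IsAlgSimple A ∧ (QT A).Nonempty ∧ AllElementsTAOZ A) ∨
  (¬ (IsAlgSimple A ∧ (QT A).Nonempty) ∧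
    ∃ (B : Type u) (_ : NonUnitalCStarAlgebra B) (_ : PartialOrder B) (_ : StarOrderedRing B),
      IsAlgSimple B ∧ (QT B).Nonempty ∧ AllElementsTAOZ B ∧
        Nonempty (Stab A ≃⋆ₐ[ℂ] Stab B))

end Quasitraces

end TAOZ

end

/-!
A hereditary surjective `Γ` makes it possible to enlarge an element of `A ⊗ 𝕂` inside a hereditary
subalgebra by a prescribed continuous rank, and tracial approximate oscillation zero is obtained by
an induction that does this infinitely often. Write `d_τ` for `DenseQT.dim` and `S` for the closure
of `QT A`.

*Positive elements `a` of the Pedersen ideal of `A ⊗ 𝕂`, for simple `A`* (`allElementsTAOZ`). The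
functions `τ ↦ τ(f_ε(a))` are continuous and affine and increase to `d_τ(a)`; `lowerRank a η k` is a
strictly increasing sequence of this kind. A stage (`IsStage`) is an element `s` of `her a` whose
rank is at most `lowerRank a η k`, and whose spectral part above a threshold has nearly this rank on
`S`. Given a stage, cut a neighbourhood of the spectral part of `s` out of `f_{η'}(a)`. What is left
has rank greater than `lowerRank a η (k + 1) - lowerRank a η k`, so hereditary surjectivity yields
an element of exactly this rank below it, which can be added orthogonally to `s`
(`IsStage.exists_next`). As its rank is continuous and `S` is compact (`isCompact_closure_QT`),
Dini's theorem makes nearly all of the rank appear in a spectral part away from `0`, and this gives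
the next stage. With ramp functions `y_k` of the stages, `c_k = a^{1/2} y_k a^{1/2}` increases, and
`d_τ(a - c_k) ≤ d_τ(a) - lowerRank a η k (τ) + δ` tends to at most `δ` pointwise. Compactness of `S`
then produces one `k` for which a spectral part of `a - c_k` has uniformly small rank, so that
`‖a - c_k‖₂` is small, while the oscillation of `c_k` is at most `δ` by construction.

The facts about quasitraces that this uses, none of which needs linearity, are monotonicity,
subadditivity and invariance of `d_τ`; the finiteness of `τ` on the Pedersen ideal in terms of its
norm on `A`, which holds because the elements that are dominated in the sense of `IsDominated` form
a nonzero ideal (`isDominated_of_mem_pedersen`) and which gives compactness of `S`; faithfulness of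
nonzero quasitraces (`DenseQT.dim_pos`); and that every quasitrace on the Pedersen ideal of a stable
algebra is a 2-quasitrace (`IsQuasitrace.isTwoQuasitrace`).

*Reduction to algebraically simple algebras* (`exists_isAlgSimple_stab_equiv`). If `A` itself does
not qualify, take `e = f_ε(a) ≠ 0` in `A` and let `B` be the hereditary subalgebra generated by `e`.
It lies in the Pedersen ideal of `A`, hence is algebraically simple (`isAlgSimple_of_unit`). For
`σ`-unital `A`, the stabilizations of `A` and `B` are isomorphic (`Stab.nonempty_starAlgEquiv`).
This is Brown's theorem, and the special case needed here has a short proof. `A ⊗ 𝕂` and `B ⊗ 𝕂` are the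
hereditary subalgebras of closed right ideals `K` and `H` of `A ⊗ 𝕂` that are invariant under row
operations; an explicit infinite matrix `r` (`Stab.absorb`) has source `H` and range `K ⊕ H`,
because simplicity makes the translates of `H` exhaust `K`; polar decomposition of `r` gives
`H ≅ K ⊕ H` (`herEquiv`), and exchanging the roles gives `K ≅ K ⊕ H`. Hereditary surjectivity and
nonzero quasitraces are transported along the stable isomorphism
(`HereditarySurjective.of_stab_equiv`, `DenseQT.pull`); a nonzero quasitrace on `B ⊗ 𝕂` is bounded
on `B`, so it can be normalized (`QT_nonempty_of_ne_zero`).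
-/

noncomputable section

namespace TAOZ

/-! ### Functional calculus in C⋆-algebras -/

section CStarGeneral

variable {D : Type u} [NonUnitalCStarAlgebra D] [PartialOrder D] [StarOrderedRing D]

open scoped ContinuousMapZero in
/-- If `z` intertwines `a` and `b`, it intertwines every function of `a` with the same function
of `b`. -/
theorem cfcₙ_intertwine {a b z : D} (ha : IsSelfAdjoint a) (hb : IsSelfAdjoint b)
    (h : a * z = z * b) (f : ℝ → ℝ) (hf : Continuous f) (hf0 : f 0 = 0) :
    cfcₙ f a * z = z * cfcₙ f b := by
  let s : Set ℝ := quasispectrum ℝ a ∪ quasispectrum ℝ b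
  have hsa : quasispectrum ℝ a ⊆ s := Set.subset_union_left
  have hsb : quasispectrum ℝ b ⊆ s := Set.subset_union_right
  have : Fact ((0 : ℝ) ∈ s) := ⟨hsa (quasispectrum.zero_mem ℝ a)⟩
  have hcs : IsCompact s :=
    (NonUnitalContinuousFunctionalCalculus.isCompact_quasispectrum a).union
      (NonUnitalContinuousFunctionalCalculus.isCompact_quasispectrum b)
  have : CompactSpace s := isCompact_iff_compactSpace.mp hcs
  have key : ∀ g : ContinuousMapZero s ℝ,
      cfcₙHomSuperset ha hsa g * z = z * cfcₙHomSuperset hb hsb g := by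
    intro g
    induction g using ContinuousMapZero.induction_on_of_compact with
    | zero => rw [map_zero, map_zero, zero_mul, mul_zero]
    | id => rw [cfcₙHomSuperset_id ha hsa, cfcₙHomSuperset_id hb hsb]; exact h
    | star_id =>
      rw [map_star, map_star, cfcₙHomSuperset_id ha hsa, cfcₙHomSuperset_id hb hsb, ha.star_eq,
        hb.star_eq]; exact h
    | add g k hg hk => rw [map_add, map_add, add_mul, mul_add, hg, hk]
    | mul g k hg hk => rw [map_mul, map_mul, mul_assoc, hk, ← mul_assoc, hg, mul_assoc]
    | smul r g hg => rw [map_smul, map_smul, smul_mul_assoc, mul_smul_comm, hg]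
    | frequently g hg =>
      have h1 := cfcₙHomSuperset_continuous ha hsa
      have h2 := cfcₙHomSuperset_continuous hb hsb
      exact isClosed_eq (h1.mul continuous_const) (continuous_const.mul h2)
        |>.mem_of_frequently_of_tendsto hg tendsto_id
  have := key ⟨⟨fun x => f x, hf.comp continuous_subtype_val⟩, hf0⟩
  rw [cfcₙ_apply f a hf.continuousOn hf0 ha, cfcₙ_apply f b hf.continuousOn hf0 hb]
  exact this

theorem cfcₙ_mul_eq_zero {a z : D} (ha : IsSelfAdjoint a) (h : a * z = 0) (f : ℝ → ℝ)
    (hf : Continuous f) (hf0 : f 0 = 0) : cfcₙ f a * z = 0 := by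
  have := cfcₙ_intertwine ha (IsSelfAdjoint.zero D) (z := z) (by rw [h, mul_zero]) f hf hf0
  rw [this, cfcₙ_apply_zero, mul_zero]

theorem mul_cfcₙ_eq_zero {a z : D} (ha : IsSelfAdjoint a) (h : z * a = 0) (f : ℝ → ℝ)
    (hf : Continuous f) (hf0 : f 0 = 0) : z * cfcₙ f a = 0 := by
  have := cfcₙ_intertwine (IsSelfAdjoint.zero D) ha (z := z) (by rw [h, zero_mul]) f hf hf0
  rw [← this, cfcₙ_apply_zero, zero_mul]

/-- The functional calculus is additive on sums of orthogonal positive elements; both summands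
are functions of the difference `p - q`, namely its positive and negative part. -/
theorem cfcₙ_add_of_mul_eq_zero {p q : D} (hp : 0 ≤ p) (hq : 0 ≤ q) (hpq : p * q = 0)
    (f : ℝ → ℝ) (hf : Continuous f) (hf0 : f 0 = 0) :
    cfcₙ f (p + q) = cfcₙ f p + cfcₙ f q := by
  obtain ⟨h1, h2⟩ := CFC.posPart_negPart_unique (a := p - q) rfl hpq hp hq
  rw [CFC.posPart_def] at h1
  rw [CFC.negPart_def] at h2
  have hsa : IsSelfAdjoint (p - q) := (IsSelfAdjoint.of_nonneg hp).sub (IsSelfAdjoint.of_nonneg hq)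
  generalize p - q = x at h1 h2 hsa
  subst h1 h2
  have hc1 : Continuous (fun t : ℝ => t⁺) := by
    simp only [posPart_def]; fun_prop
  have hc2 : Continuous (fun t : ℝ => t⁻) := by
    simp only [negPart_def]; fun_prop
  have e3 : cfcₙ (fun t : ℝ => t⁺) x + cfcₙ (fun t : ℝ => t⁻) x
      = cfcₙ (fun t : ℝ => t⁺ + t⁻) x :=
    (cfcₙ_add _ _ _ hc1.continuousOn (by simp) hc2.continuousOn (by simp)).symm
  rw [e3, ← cfcₙ_comp' f (fun t : ℝ => t⁺) x hf.continuousOn hf0 hc1.continuousOn (by simp) hsa,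
    ← cfcₙ_comp' f (fun t : ℝ => t⁻) x hf.continuousOn hf0 hc2.continuousOn (by simp) hsa,
    ← cfcₙ_comp' f (fun t : ℝ => t⁺ + t⁻) x hf.continuousOn hf0 (hc1.add hc2).continuousOn
      (by simp) hsa,
    ← cfcₙ_add (fun t => f t⁺) (fun t => f t⁻) x (hf.comp hc1).continuousOn (by simp [hf0])
    (hf.comp hc2).continuousOn (by simp [hf0])]
  congr 1
  funext t
  rcases le_total 0 t with ht | ht
  · simp [posPart_eq_self.2 ht, negPart_eq_zero.2 ht, hf0]
  · simp [posPart_eq_zero.2 ht, hf0]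

/-- An element fixed by `E` is fixed by every function of `E` that is `1` near `1`. -/
theorem cfcₙ_fEps_mul_eq {E z : D} (hE : IsSelfAdjoint E) (h : E * z = z) :
    cfcₙ (fEps (1 / 4)) E * z = z := by
  -- `f - id = m · (1 - id)` with `m` continuous, because `f = 1` near `1`
  let m : ℝ → ℝ := fun t => 1 - (1 - fEps (1 / 4) t) / max (1 / 2) (1 - t)
  have hden : ∀ t : ℝ, max (1 / 2) (1 - t) ≠ 0 := fun t =>
    (lt_of_lt_of_le (by norm_num) (le_max_left _ _)).ne'
  have hm : Continuous m := by
    have := fEps_continuous (1 / 4)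
    exact continuous_const.sub ((continuous_const.sub this).div (by fun_prop) hden)
  have hf0 : fEps (1 / 4) 0 = 0 := fEps_eq_zero (by norm_num) (by norm_num)
  have hm0 : m 0 = 0 := by
    simp only [m, hf0]; norm_num
  have hid : ∀ t, fEps (1 / 4) t = t + (m t - m t * t) := by
    intro t
    rcases le_total (1 / 2) t with ht | ht
    · have : fEps (1 / 4) t = 1 := fEps_eq_one (by norm_num) (by linarith)
      simp only [m, this]
      norm_num
    · have hmx : max (1 / 2) (1 - t) = 1 - t := max_eq_right (by linarith)
      have : (1 - t) ≠ 0 := by linarith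
      simp only [m, hmx]
      field_simp
      ring
  have : cfcₙ (fEps (1 / 4)) E = E + (cfcₙ m E - cfcₙ m E * E) := by
    conv_lhs => rw [show fEps (1 / 4) = fun t => t + (m t - m t * t) from funext hid]
    rw [cfcₙ_add (fun t => t) _ _ (by fun_prop) (by simp) (by fun_prop) (by simp [hm0]),
      cfcₙ_sub _ _ _ hm.continuousOn hm0 (by fun_prop) (by simp [hm0]),
      cfcₙ_mul m (fun t => t) _ hm.continuousOn hm0 (by fun_prop) (by simp)]
    rw [cfcₙ_id' ℝ E]
  rw [this, add_mul, sub_mul, mul_assoc, h, sub_self, add_zero]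

/-- If `w⋆w ≤ y`, then `w (1 - q(y))` is controlled by the values of `t (1 - q(t))²`. -/
theorem norm_sub_mul_cfcₙ_sq_le {w y : D} (hy : 0 ≤ y) (h : star w * w ≤ y) (q : ℝ → ℝ)
    (hq : Continuous q) (hq0 : q 0 = 0) {c : ℝ}
    (hc : ∀ t, 0 ≤ t → |t * (1 - q t) ^ 2| ≤ c) : ‖w - w * cfcₙ q y‖ ^ 2 ≤ c := by
  set k := cfcₙ q y with hk
  have hksa : star k = k := (cfcₙ_predicate q y : IsSelfAdjoint k).star_eq
  have h1 : star (w - w * k) * (w - w * k) ≤ y - k * y - y * k + k * y * k := by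
    obtain ⟨v, hv⟩ := CStarAlgebra.nonneg_iff_eq_star_mul_self.1 (sub_nonneg.2 h)
    rw [← sub_nonneg]
    have : y - k * y - y * k + k * y * k - star (w - w * k) * (w - w * k)
        = star (v - v * k) * (v - v * k) := by
      have h2 : y = star v * v + star w * w := by rw [← hv]; abel
      rw [h2]
      simp only [star_sub, star_mul, hksa]
      noncomm_ring
    rw [this]
    exact star_mul_self_nonneg _
  have h2 : y - k * y - y * k + k * y * k = cfcₙ (fun t => t * (1 - q t) ^ 2) y := by
    have hy' : cfcₙ (fun t : ℝ => t) y = y := cfcₙ_id' ℝ y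
    have e : (fun t => t * (1 - q t) ^ 2) = fun t => t - q t * t - t * q t + q t * t * q t := by
      funext t; ring
    rw [e, cfcₙ_add _ _ _ (by fun_prop) (by simp) (by fun_prop) (by simp),
      cfcₙ_sub _ _ _ (by fun_prop) (by simp) (by fun_prop) (by simp),
      cfcₙ_sub _ _ _ (by fun_prop) (by simp) (by fun_prop) (by simp),
      cfcₙ_mul (fun t => q t * t) q _ (by fun_prop) (by simp) (by fun_prop) hq0,
      cfcₙ_mul q (fun t => t) _ (by fun_prop) hq0 (by fun_prop) (by simp),
      cfcₙ_mul (fun t => t) q _ (by fun_prop) (by simp) (by fun_prop) hq0, hy']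
  rw [sq, ← CStarRing.norm_star_mul_self]
  refine (CStarAlgebra.norm_le_norm_of_nonneg_of_le (star_mul_self_nonneg _) h1).trans ?_
  rw [h2]
  refine norm_cfcₙ_le fun t ht => ?_
  rw [Real.norm_eq_abs]
  exact hc t (quasispectrum_nonneg_of_nonneg y hy t ht)

/-- `(a - ε)₊`. -/
def cut (ε : ℝ) (a : D) : D := cfcₙ (fun t : ℝ => max (t - ε) 0) a

theorem cut_nonneg (ε : ℝ) (a : D) : 0 ≤ cut ε a := cfcₙ_nonneg fun _ _ => le_max_right _ _

theorem cfcₙ_fEps_nonneg (ε : ℝ) (a : D) : 0 ≤ cfcₙ (fEps ε) a :=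
  cfcₙ_nonneg fun _ _ => le_max_left _ _

theorem fEps_nonneg (ε t : ℝ) : 0 ≤ fEps ε t := le_max_left _ _

theorem fEps_le_one (ε t : ℝ) : fEps ε t ≤ 1 := max_le zero_le_one (min_le_left _ _)

theorem fEps_zero {ε : ℝ} (hε : 0 < ε) : fEps ε 0 = 0 := fEps_eq_zero hε hε.le

theorem fEps_anti {ε δ : ℝ} (hδ : 0 < δ) (h : δ ≤ ε) (t : ℝ) : fEps ε t ≤ fEps δ t := by
  rcases le_total t δ with ht | ht
  · rw [fEps_eq_zero (hδ.trans_le h) (ht.trans h)]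
    exact fEps_nonneg _ _
  · unfold fEps
    have hε : 0 < ε := hδ.trans_le h
    refine max_le_max le_rfl (min_le_min le_rfl ?_)
    rw [sub_div, sub_div, div_self hε.ne', div_self hδ.ne', sub_le_sub_iff_right]
    exact div_le_div_of_nonneg_left (by linarith) hδ h

/-- If `‖p - q‖ < ε`, then `(p - ε)₊` is dominated by a compression of `q`. -/
theorem exists_cut_le_conj {p q : D} (hp : 0 ≤ p) (hq : 0 ≤ q) {ε : ℝ} (h : ‖p - q‖ < ε) :
    ∃ g : D, IsSelfAdjoint g ∧ cut ε p ≤ g * q * g := by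
  have hε : 0 < ε := (norm_nonneg _).trans_lt h
  set ε' := ‖p - q‖ with hε'
  let G : ℝ → ℝ := fun t => Real.sqrt (max (t - ε) 0 / (ε - ε'))
  have hGc : Continuous G := by fun_prop
  have hG0 : G 0 = 0 := by simp [G, hε.le]
  set g := cfcₙ G p with hg
  have hgsa : IsSelfAdjoint g := cfcₙ_predicate G p
  refine ⟨g, hgsa, ?_⟩
  have hsa : IsSelfAdjoint (p - q) := (IsSelfAdjoint.of_nonneg hp).sub (IsSelfAdjoint.of_nonneg hq)
  have h1 := CStarAlgebra.star_left_conjugate_le_norm_smul (a := g) (b := p - q) hsa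
  rw [hgsa.star_eq] at h1
  have h2 : g * p * g - ε' • (g * g) ≤ g * q * g := by
    have : g * (p - q) * g = g * p * g - g * q * g := by noncomm_ring
    rw [this, sub_le_iff_le_add] at h1
    rw [sub_le_iff_le_add, add_comm]
    exact h1
  refine le_trans ?_ h2
  have h3 : g * p * g - ε' • (g * g) = cfcₙ (fun t => G t * t * G t - ε' * (G t * G t)) p := by
    have hp' : cfcₙ (fun t : ℝ => t) p = p := cfcₙ_id' ℝ p
    rw [cfcₙ_sub _ _ _ (by fun_prop) (by simp) (by fun_prop) (by simp [hG0]),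
      cfcₙ_const_mul _ _ _ (by fun_prop) (by simp [hG0]),
      cfcₙ_mul (fun t => G t * t) G _ (by fun_prop) (by simp) (by fun_prop) hG0,
      cfcₙ_mul G (fun t => t) _ (by fun_prop) hG0 (by fun_prop) (by simp),
      cfcₙ_mul G G _ (by fun_prop) hG0 (by fun_prop) hG0, hp']
  rw [h3]
  refine cfcₙ_mono (fun t _ => ?_) (by fun_prop) (by fun_prop) (by simp [hε.le]) (by simp [hG0])
  have hd : 0 < ε - ε' := sub_pos.2 h
  have hGG : G t * G t = max (t - ε) 0 / (ε - ε') :=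
    Real.mul_self_sqrt (div_nonneg (le_max_right _ _) hd.le)
  have : G t * t * G t - ε' * (G t * G t) = max (t - ε) 0 / (ε - ε') * (t - ε') := by
    rw [← hGG]; ring
  rw [this]
  rcases le_total t ε with ht | ht
  · simp [ht]
  · rw [max_eq_left (by linarith), div_mul_eq_mul_div, le_div_iff₀ hd]
    nlinarith

/-! ### Polar decomposition -/

/-- The function `√t / (t + 1/(n+1))`, an approximation of `t^{-1/2}` vanishing at `0`. -/
def polarFun (n : ℕ) (t : ℝ) : ℝ := Real.sqrt |t| / (|t| + 1 / ((n : ℝ) + 1))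

theorem polarFun_continuous (n : ℕ) : Continuous (polarFun n) := by
  unfold polarFun
  refine Continuous.div (by fun_prop) (by fun_prop) fun t => ?_
  have : 0 < 1 / ((n : ℝ) + 1) := Nat.one_div_pos_of_nat
  positivity

theorem polarFun_zero (n : ℕ) : polarFun n 0 = 0 := by simp [polarFun]

theorem mul_polarFun_sq {n : ℕ} {t : ℝ} (ht : 0 ≤ t) :
    polarFun n t * t * polarFun n t = (t / (t + 1 / ((n : ℝ) + 1))) ^ 2 := by
  have : 0 < 1 / ((n : ℝ) + 1) := Nat.one_div_pos_of_nat
  have hs := Real.mul_self_sqrt ht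
  unfold polarFun
  rw [abs_of_nonneg ht]
  field_simp
  rw [Real.sq_sqrt ht, sq]

/-- Contractions approximating the partial isometry in the polar decomposition of `r`. -/
def polarSeq (r : D) (n : ℕ) : D := r * cfcₙ (polarFun n) (star r * r)

theorem star_polarSeq (r : D) (n : ℕ) : star (polarSeq r n) = polarSeq (star r) n := by
  unfold polarSeq
  rw [star_mul, star_star,
    (cfcₙ_predicate (polarFun n) (star r * r) : IsSelfAdjoint _).star_eq]
  exact cfcₙ_intertwine (.star_mul_self r) (.mul_star_self r) (by rw [mul_assoc]) _
    (polarFun_continuous n) (polarFun_zero n)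

theorem star_polarSeq_mul_polarSeq (r : D) (n : ℕ) :
    star (polarSeq r n) * polarSeq r n
      = cfcₙ (fun t => polarFun n t * t * polarFun n t) (star r * r) := by
  have hc := polarFun_continuous n
  have h0 := polarFun_zero n
  rw [cfcₙ_mul (fun t => polarFun n t * t) _ _ (by fun_prop) (by simp) (by fun_prop) h0,
    cfcₙ_mul _ (fun t => t) _ (by fun_prop) h0 (by fun_prop) (by simp),
    cfcₙ_id' ℝ (star r * r) (IsSelfAdjoint.star_mul_self r)]
  unfold polarSeq
  rw [star_mul, (cfcₙ_predicate (polarFun n) (star r * r) : IsSelfAdjoint _).star_eq]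
  noncomm_ring

theorem norm_polarSeq_le_one (r : D) (n : ℕ) : ‖polarSeq r n‖ ≤ 1 := by
  have h : ‖polarSeq r n‖ * ‖polarSeq r n‖ ≤ 1 := by
    rw [← CStarRing.norm_star_mul_self, star_polarSeq_mul_polarSeq]
    refine norm_cfcₙ_le fun t ht => ?_
    have ht0 := quasispectrum_nonneg_of_nonneg _ (star_mul_self_nonneg r) t ht
    have : 0 < 1 / ((n : ℝ) + 1) := Nat.one_div_pos_of_nat
    rw [mul_polarFun_sq ht0, Real.norm_eq_abs, abs_of_nonneg (sq_nonneg _)]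
    refine pow_le_one₀ (by positivity) ?_
    rw [div_le_one (by positivity)]
    linarith
  nlinarith [norm_nonneg (polarSeq r n)]

theorem one_div_nat_tendsto : Tendsto (fun n : ℕ => 4 * (1 / ((n : ℝ) + 1))) atTop (𝓝 0) := by
  simpa using (tendsto_one_div_add_atTop_nhds_zero_nat (𝕜 := ℝ)).const_mul 4

/-- If `w⋆w ≤ r⋆r`, then the polar approximations fix `w⋆` asymptotically. -/
theorem tendsto_star_polarSeq_mul {r w : D} (h : star w * w ≤ star r * r) :
    Tendsto (fun n => star (polarSeq r n) * polarSeq r n * star w) atTop (𝓝 (star w)) := by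
  have key : ∀ n : ℕ, ‖w - w * (star (polarSeq r n) * polarSeq r n)‖ ^ 2
      ≤ 4 * (1 / ((n : ℝ) + 1)) := by
    intro n
    have hc := polarFun_continuous n
    have h0 := polarFun_zero n
    rw [star_polarSeq_mul_polarSeq]
    refine norm_sub_mul_cfcₙ_sq_le (star_mul_self_nonneg r) h _ (by fun_prop) (by simp) ?_
    intro t ht
    have hn : 0 < 1 / ((n : ℝ) + 1) := Nat.one_div_pos_of_nat
    set c := 1 / ((n : ℝ) + 1)
    rw [mul_polarFun_sq ht, abs_of_nonneg (by positivity)]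
    have e : t * (1 - (t / (t + c)) ^ 2) ^ 2
        = (t / (t + c)) * (c / (t + c)) * ((2 * t + c) / (t + c)) ^ 2 * c := by
      field_simp
      ring
    rw [e]
    have h1 : t / (t + c) ≤ 1 := by rw [div_le_one (by positivity)]; linarith
    have h2 : c / (t + c) ≤ 1 := by rw [div_le_one (by positivity)]; linarith
    have h3 : (2 * t + c) / (t + c) ≤ 2 := by rw [div_le_iff₀ (by positivity)]; linarith
    have h4 : ((2 * t + c) / (t + c)) ^ 2 ≤ 4 := by
      have : 0 ≤ (2 * t + c) / (t + c) := by positivity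
      nlinarith
    have h5 : (t / (t + c)) * (c / (t + c)) ≤ 1 := mul_le_one₀ h1 (by positivity) h2
    have h6 : (t / (t + c)) * (c / (t + c)) * ((2 * t + c) / (t + c)) ^ 2 ≤ 4 := by
      calc _ ≤ 1 * ((2 * t + c) / (t + c)) ^ 2 := by gcongr
        _ ≤ 4 := by linarith
    nlinarith
  have h2 : Tendsto (fun n => ‖w - w * (star (polarSeq r n) * polarSeq r n)‖ ^ 2) atTop (𝓝 0) :=
    squeeze_zero (fun _ => by positivity) key one_div_nat_tendsto
  have h3 : Tendsto (fun n => ‖w - w * (star (polarSeq r n) * polarSeq r n)‖) atTop (𝓝 0) := by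
    have := h2.sqrt
    simpa using this
  rw [tendsto_iff_norm_sub_tendsto_zero]
  refine h3.congr fun n => ?_
  rw [← norm_star, star_sub, star_mul, star_mul, star_star, ← norm_neg, neg_sub]

/-- The closed right ideal generated by `r`. -/
def rid (r : D) : Set D := closure (Set.range fun d => r * d)

theorem isClosed_rid (r : D) : IsClosed (rid r) := isClosed_closure

theorem mul_mem_rid {r x : D} (hx : x ∈ rid r) (d : D) : x * d ∈ rid r := by
  refine map_mem_closure (f := fun z => z * d) (by fun_prop) hx ?_
  rintro _ ⟨e, rfl⟩
  exact ⟨e * d, (mul_assoc _ _ _).symm⟩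

theorem add_mem_rid {r x y : D} (hx : x ∈ rid r) (hy : y ∈ rid r) : x + y ∈ rid r := by
  refine map_mem_closure₂ (f := fun z w => z + w) (by fun_prop) hx hy ?_
  rintro _ ⟨e, rfl⟩ _ ⟨f, rfl⟩
  exact ⟨e + f, mul_add _ _ _⟩

theorem zero_mem_rid (r : D) : (0 : D) ∈ rid r := subset_closure ⟨0, mul_zero r⟩

theorem smul_mem_rid {r x : D} (c : ℂ) (hx : x ∈ rid r) : c • x ∈ rid r := by
  refine map_mem_closure (f := fun z => c • z) (by fun_prop) hx ?_
  rintro _ ⟨e, rfl⟩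
  exact ⟨c • e, mul_smul_comm _ _ _⟩

theorem mul_mem_rid_self (r d : D) : r * d ∈ rid r := subset_closure ⟨d, rfl⟩

theorem self_mem_rid (r : D) : r ∈ rid r := by
  have hl := CStarAlgebra.increasingApproximateUnit D
  have := hl.toIsApproximateUnit.neBot
  exact mem_closure_of_tendsto (hl.toIsApproximateUnit.tendsto_mul_left r)
    (Eventually.of_forall fun v => ⟨v, rfl⟩)

theorem rid_subset {r x : D} (hx : x ∈ rid r) : rid x ⊆ rid r := by
  refine closure_minimal ?_ (isClosed_rid r)
  rintro _ ⟨d, rfl⟩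
  exact mul_mem_rid hx d

theorem mul_eq_of_mem_rid {E r z : D} (h : E * r = r) (hz : z ∈ rid r) : E * z = z := by
  have hc : IsClosed {x : D | E * x = x} := isClosed_eq (by fun_prop) continuous_id
  refine closure_minimal ?_ hc hz
  rintro _ ⟨d, rfl⟩
  change E * (r * d) = r * d
  rw [← mul_assoc, h]

theorem mul_eq_zero_of_mem_rid {E r z : D} (h : E * r = 0) (hz : z ∈ rid r) : E * z = 0 := by
  have hc : IsClosed {x : D | E * x = 0} := isClosed_eq (by fun_prop) continuous_const
  refine closure_minimal ?_ hc hz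
  rintro _ ⟨d, rfl⟩
  change E * (r * d) = 0
  rw [← mul_assoc, h, zero_mul]

theorem polarSeq_mul_mem_rid (r : D) (n : ℕ) (x : D) : polarSeq r n * x ∈ rid r := by
  unfold polarSeq
  rw [mul_assoc]
  exact mul_mem_rid_self _ _

/-- An equicontinuous sequence of left multiplications that converges on `r` converges on the closed
right ideal generated by `r`. -/
theorem cauchySeq_mul_of_mem_rid {r w : D} {p : ℕ → D} (hp : ∀ n, ‖p n‖ ≤ 1)
    (hr : CauchySeq fun n => p n * r) (hw : w ∈ rid r) : CauchySeq fun n => p n * w := by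
  rw [Metric.cauchySeq_iff] at *
  intro ε hε
  obtain ⟨_, ⟨d, rfl⟩, hd⟩ := Metric.mem_closure_iff.1 hw (ε / 4) (by positivity)
  obtain ⟨N, hN⟩ := hr (ε / (2 * (‖d‖ + 1))) (by positivity)
  refine ⟨N, fun m hm n hn => ?_⟩
  have h1 := hN m hm n hn
  rw [dist_eq_norm] at h1 hd ⊢
  have e : p m * w - p n * w = p m * (w - r * d) - p n * (w - r * d)
      + (p m * r - p n * r) * d := by noncomm_ring
  rw [e]
  have b : ∀ k, ‖p k * (w - r * d)‖ ≤ ε / 4 := fun k => by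
    refine (norm_mul_le _ _).trans ?_
    have := hp k
    nlinarith [norm_nonneg (w - r * d), norm_nonneg (p k)]
  have h2 : ‖(p m * r - p n * r) * d‖ < ε / 2 := by
    refine (norm_mul_le _ _).trans_lt ?_
    have hd0 := norm_nonneg d
    calc ‖p m * r - p n * r‖ * ‖d‖ ≤ ε / (2 * (‖d‖ + 1)) * ‖d‖ := by gcongr
      _ < ε / (2 * (‖d‖ + 1)) * (‖d‖ + 1) := by gcongr; linarith
      _ = ε / 2 := by field_simp
  calc _ ≤ ‖p m * (w - r * d)‖ + ‖p n * (w - r * d)‖ + ‖(p m * r - p n * r) * d‖ :=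
        (norm_add_le _ _).trans (add_le_add_left (norm_sub_le _ _) _)
    _ < ε := by linarith [b m, b n]

theorem cauchySeq_polarSeq_mul_star (r : D) : CauchySeq fun n => polarSeq r n * star r := by
  set y := r * star r with hy
  have hy0 : 0 ≤ y := mul_star_self_nonneg r
  have e : ∀ n, polarSeq r n * star r = cfcₙ (fun t => t * polarFun n t) y := by
    intro n
    have hc := polarFun_continuous n
    have h0 := polarFun_zero n
    rw [cfcₙ_mul (fun t => t) _ _ (by fun_prop) (by simp) (by fun_prop) h0, cfcₙ_id' ℝ y,
      polarSeq, mul_assoc, cfcₙ_intertwine (.star_mul_self r) (.mul_star_self r)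
        (by rw [mul_assoc]) _ hc h0, ← mul_assoc]
  simp_rw [e]
  have key : ∀ n : ℕ, ‖cfcₙ (fun t => t * polarFun n t) y - cfcₙ (fun t => Real.sqrt |t|) y‖
      ≤ Real.sqrt (4 * (1 / ((n : ℝ) + 1))) := by
    intro n
    have hc := polarFun_continuous n
    have h0 := polarFun_zero n
    rw [← cfcₙ_sub _ _ _ (by fun_prop) (by simp) (by fun_prop) (by simp)]
    refine norm_cfcₙ_le fun t ht => ?_
    have ht0 := quasispectrum_nonneg_of_nonneg _ hy0 t ht
    rw [Real.norm_eq_abs, ← Real.sqrt_sq_eq_abs]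
    refine Real.sqrt_le_sqrt ?_
    unfold polarFun
    have hn : 0 < 1 / ((n : ℝ) + 1) := Nat.one_div_pos_of_nat
    set c := 1 / ((n : ℝ) + 1)
    rw [abs_of_nonneg ht0]
    have hs := Real.mul_self_sqrt ht0
    have : t * (√t / (t + c)) - √t = - (√t * (c / (t + c))) := by field_simp; ring
    rw [this, neg_sq, mul_pow, sq, hs]
    have h2 : (c / (t + c)) ≤ 1 := by rw [div_le_one (by positivity)]; linarith
    have h1 : t * (c / (t + c)) ≤ c := by
      rw [mul_div_assoc', div_le_iff₀ (by positivity)]; nlinarith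
    have h3 : 0 ≤ c / (t + c) := by positivity
    nlinarith [mul_nonneg ht0 h3]
  refine Tendsto.cauchySeq (x := cfcₙ (fun t => Real.sqrt |t|) y) ?_
  rw [tendsto_iff_norm_sub_tendsto_zero]
  refine squeeze_zero (fun _ => norm_nonneg _) key ?_
  simpa using one_div_nat_tendsto.sqrt

theorem tendsto_star_polarSeq_mul_of_mem {r w : D} (hw : w ∈ rid (star r)) :
    Tendsto (fun n => star (polarSeq r n) * (polarSeq r n * w)) atTop (𝓝 w) := by
  have h1 : Tendsto (fun n => star (polarSeq r n) * polarSeq r n * star r) atTop (𝓝 (star r)) :=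
    tendsto_star_polarSeq_mul le_rfl
  have hq : ∀ n, ‖star (polarSeq r n) * polarSeq r n‖ ≤ 1 := fun n => by
    refine (norm_mul_le _ _).trans ?_
    rw [norm_star]
    exact mul_le_one₀ (norm_polarSeq_le_one r n) (norm_nonneg _) (norm_polarSeq_le_one r n)
  rw [Metric.tendsto_atTop]
  intro ε hε
  obtain ⟨_, ⟨d, rfl⟩, hd⟩ := Metric.mem_closure_iff.1 hw (ε / 4) (by positivity)
  obtain ⟨N, hN⟩ := Metric.tendsto_atTop.1 h1 (ε / (2 * (‖d‖ + 1))) (by positivity)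
  refine ⟨N, fun n hn => ?_⟩
  have h2 := hN n hn
  rw [dist_eq_norm] at h2 hd ⊢
  set Q := star (polarSeq r n) * polarSeq r n
  have e : star (polarSeq r n) * (polarSeq r n * w) - w
      = Q * (w - star r * d) - (w - star r * d) + (Q * star r - star r) * d := by
    simp only [Q]; noncomm_ring
  rw [e]
  have b : ‖Q * (w - star r * d)‖ ≤ ε / 4 := by
    refine (norm_mul_le _ _).trans ?_
    nlinarith [norm_nonneg (w - star r * d), norm_nonneg Q, hq n]
  have h3 : ‖(Q * star r - star r) * d‖ < ε / 2 := by
    refine (norm_mul_le _ _).trans_lt ?_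
    have hd0 := norm_nonneg d
    calc ‖Q * star r - star r‖ * ‖d‖ ≤ ε / (2 * (‖d‖ + 1)) * ‖d‖ := by gcongr
      _ < ε / (2 * (‖d‖ + 1)) * (‖d‖ + 1) := by gcongr; linarith
      _ = ε / 2 := by field_simp
  calc _ ≤ ‖Q * (w - star r * d)‖ + ‖w - star r * d‖ + ‖(Q * star r - star r) * d‖ :=
        (norm_add_le _ _).trans (add_le_add_left (norm_sub_le _ _) _)
    _ < ε := by linarith [b]

/-- The image of `w` under the partial isometry in the polar decomposition of `r`. -/
theorem exists_polar_image {r w : D} (hw : w ∈ rid (star r)) :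
    ∃ z ∈ rid r, star z * z = star w * w := by
  obtain ⟨z, hz⟩ := cauchySeq_tendsto_of_complete
    (cauchySeq_mul_of_mem_rid (norm_polarSeq_le_one r) (cauchySeq_polarSeq_mul_star r) hw)
  refine ⟨z, (isClosed_rid r).mem_of_tendsto hz
    (Eventually.of_forall fun n => polarSeq_mul_mem_rid r n w), ?_⟩
  have h1 : Tendsto (fun n => star (polarSeq r n * w) * (polarSeq r n * w)) atTop
      (𝓝 (star z * z)) := hz.star.mul hz
  have h2 : Tendsto (fun n => star w * (star (polarSeq r n) * (polarSeq r n * w))) atTop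
      (𝓝 (star w * w)) := tendsto_const_nhds.mul (tendsto_star_polarSeq_mul_of_mem hw)
  refine tendsto_nhds_unique h1 (h2.congr fun n => ?_)
  rw [star_mul]; noncomm_ring

theorem star_mem_rid_of_le {r w : D} (h : star w * w ≤ star r * r) : star w ∈ rid (star r) := by
  refine (isClosed_rid _).mem_of_tendsto (tendsto_star_polarSeq_mul h) (Eventually.of_forall ?_)
  intro n
  rw [star_polarSeq]
  refine mul_mem_rid ?_ _
  exact polarSeq_mul_mem_rid _ _ _

theorem exists_sqrt {x : D} (hx : 0 ≤ x) : ∃ w : D, IsSelfAdjoint w ∧ 0 ≤ w ∧ w * w = x :=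
  ⟨CFC.sqrt x, (IsSelfAdjoint.of_nonneg (CFC.sqrt_nonneg x)), CFC.sqrt_nonneg x,
    CFC.sqrt_mul_sqrt_self x hx⟩

/-- A positive element below `r⋆r` is of the form `z⋆z` with `z` in the closed right ideal generated
by `r`. -/
theorem exists_eq_star_mul_self_of_le {R r : D} (hR : 0 ≤ R) (h : R ≤ star r * r) :
    ∃ z ∈ rid r, star z * z = R := by
  obtain ⟨w, hw, -, rfl⟩ := exists_sqrt hR
  have h1 : star w * w ≤ star r * r := by rwa [hw.star_eq]
  have h2 := star_mem_rid_of_le h1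
  rw [hw.star_eq] at h2
  obtain ⟨z, hz, e⟩ := exists_polar_image h2
  exact ⟨z, hz, by rw [e, hw.star_eq]⟩

end CStarGeneral

/-! ### Row operations on the stabilization -/

section Rows

variable {A : Type u} [NonUnitalCStarAlgebra A] [PartialOrder A] [StarOrderedRing A]

namespace FinMat

theorem coherent_apply_eq {N M M' : ℕ} {x : FinMat A} (hx : IsCoherentFrom A N x.1) (hM : N ≤ M)
    (hM' : N ≤ M') {i j : ℕ} (hi : i < M) (hj : j < M) (hi' : i < M') (hj' : j < M') :
    x.1 M ⟨i, hi⟩ ⟨j, hj⟩ = x.1 M' ⟨i, hi'⟩ ⟨j, hj'⟩ := by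
  rw [hx M hM, hx M' hM', padMatrix_apply, padMatrix_apply]

/-- The entry of a finite matrix at the place `(i, j)`. -/
def entry (x : FinMat A) (i j : ℕ) : A :=
  x.1 (max x.2.choose (max i j + 1)) ⟨i, by omega⟩ ⟨j, by omega⟩

theorem apply_eq_entry {N M : ℕ} {x : FinMat A} (hx : IsCoherentFrom A N x.1) (hM : N ≤ M)
    (i j : Fin M) : x.1 M i j = x.entry i j := by
  have h2 := x.2.choose_spec
  set N' := x.2.choose
  have e1 : x.1 M i j = x.1 (max M (max N' (max (i : ℕ) j + 1))) ⟨i, by omega⟩ ⟨j, by omega⟩ :=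
    coherent_apply_eq hx hM (by omega) i.2 j.2 _ _
  have e2 : x.entry i j = x.1 (max M (max N' (max (i : ℕ) j + 1))) ⟨i, by omega⟩ ⟨j, by omega⟩ :=
    coherent_apply_eq h2 (le_max_left _ _) (by omega) _ _ _ _
  rw [e1, e2]

theorem entry_eq_zero {N : ℕ} {x : FinMat A} (hx : IsCoherentFrom A N x.1) {i j : ℕ}
    (h : ¬ (i < N ∧ j < N)) : x.entry i j = 0 := by
  have e := apply_eq_entry (M := max N (max i j + 1)) hx (le_max_left _ _) ⟨i, by omega⟩
    ⟨j, by omega⟩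
  rw [← e, hx _ (le_max_left _ _), padMatrix_apply, dif_neg h]

theorem entry_add (x y : FinMat A) (i j : ℕ) : (x + y).entry i j = x.entry i j + y.entry i j := by
  obtain ⟨N, hx, hy⟩ := exists_coherent x y
  have h := le_max_left N (max i j + 1)
  rw [← apply_eq_entry (M := max N (max i j + 1)) hx h ⟨i, by omega⟩ ⟨j, by omega⟩,
    ← apply_eq_entry (M := max N (max i j + 1)) hy h ⟨i, by omega⟩ ⟨j, by omega⟩,
    ← apply_eq_entry (M := max N (max i j + 1)) (coherent_add hx hy) h ⟨i, by omega⟩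
      ⟨j, by omega⟩]
  rfl

theorem entry_smul (c : ℂ) (x : FinMat A) (i j : ℕ) : (c • x).entry i j = c • x.entry i j := by
  obtain ⟨N, hx⟩ := x.2
  have h := le_max_left N (max i j + 1)
  rw [← apply_eq_entry (M := max N (max i j + 1)) hx h ⟨i, by omega⟩ ⟨j, by omega⟩,
    ← apply_eq_entry (M := max N (max i j + 1)) (coherent_smul c hx) h ⟨i, by omega⟩
      ⟨j, by omega⟩]
  rfl

theorem entry_star (x : FinMat A) (i j : ℕ) : (star x).entry i j = star (x.entry j i) := by
  obtain ⟨N, hx⟩ := x.2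
  have h := le_max_left N (max i j + 1)
  rw [← apply_eq_entry (M := max N (max i j + 1)) hx h ⟨j, by omega⟩ ⟨i, by omega⟩,
    ← apply_eq_entry (M := max N (max i j + 1)) (coherent_star hx) h ⟨i, by omega⟩
      ⟨j, by omega⟩]
  rfl

theorem entry_mul {N : ℕ} {x y : FinMat A} (hx : IsCoherentFrom A N x.1)
    (hy : IsCoherentFrom A N y.1) (i j : ℕ) :
    (x * y).entry i j = ∑ k ∈ Finset.range N, x.entry i k * y.entry k j := by
  have h := le_max_left N (max i j + 1)
  rw [← apply_eq_entry (M := max N (max i j + 1)) (coherent_mul hx hy) h ⟨i, by omega⟩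
      ⟨j, by omega⟩]
  change (x.1 _ * y.1 _ : MatAlg A _) _ _ = _
  rw [CStarMatrix.mul_apply]
  have e : ∀ k : Fin (max N (max i j + 1)), x.1 (max N (max i j + 1)) ⟨i, by omega⟩ k
      * y.1 (max N (max i j + 1)) k ⟨j, by omega⟩ = x.entry i k * y.entry k j := fun k => by
    rw [apply_eq_entry hx h, apply_eq_entry hy h]
  rw [Finset.sum_congr rfl fun k _ => e k,
    Fin.sum_univ_eq_sum_range (fun k => x.entry i k * y.entry k j)]
  symm
  refine Finset.sum_subset (Finset.range_mono h) fun k _ hk => ?_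
  rw [entry_eq_zero hx (by simp at hk; omega), zero_mul]

/-- The finite matrix with entries `m i j` for `i, j < N`. -/
def ofEntries (N : ℕ) (m : ℕ → ℕ → A) : FinMat A :=
  ⟨fun n => CStarMatrix.ofMatrix fun i j => if (i : ℕ) < N ∧ (j : ℕ) < N then m i j else 0, N,
    fun n _ => by
      ext i j
      rw [padMatrix_apply]
      change (if (i : ℕ) < N ∧ (j : ℕ) < N then m i j else 0) = _
      split_ifs with h
      · change _ = (if (i : ℕ) < N ∧ (j : ℕ) < N then m i j else 0)
        rw [if_pos h]
      · rfl⟩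

theorem entry_ofEntries (N : ℕ) (m : ℕ → ℕ → A) (i j : ℕ) :
    (ofEntries N m).entry i j = if i < N ∧ j < N then m i j else 0 := rfl

theorem of_eq_of {x y : FinMat A} (h : ∀ i j, x.entry i j = y.entry i j) :
    Stab.of x = Stab.of y := by
  rw [← sub_eq_zero]
  have e : Stab.of x - Stab.of y = Stab.of (x + (-1 : ℂ) • y) := by
    rw [Stab.of_add, Stab.of_smul, neg_one_smul, sub_eq_add_neg]
  rw [e, ← norm_eq_zero, Stab.norm_of]
  obtain ⟨N, hx, hy⟩ := exists_coherent x y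
  have hc := coherent_add hx (coherent_smul (-1) hy)
  rw [norm_eq hc, norm_eq_zero]
  ext i j
  rw [apply_eq_entry hc le_rfl, entry_add, entry_smul, h, neg_one_smul, add_neg_cancel]
  rfl

/-- The row of `m` that the partial injection `f` selects for the index `i`. -/
def selectRow (f : ℕ ≃. ℕ) (m : ℕ → ℕ → A) (i j : ℕ) : A := (f i).elim 0 fun k => m k j

/-- A bound for the indices sent below `N` by `f`. -/
def rowBound (f : ℕ ≃. ℕ) (N : ℕ) : ℕ :=
  max N ((Finset.range N).sup fun k => (f.symm k).elim 0 Nat.succ)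

theorem lt_rowBound {f : ℕ ≃. ℕ} {N i k : ℕ} (h : f i = some k) (hk : k < N) :
    i < rowBound f N := by
  have h2 : f.symm k = some i := (f.eq_some_iff).2 h
  have := Finset.le_sup (f := fun k => (f.symm k).elim 0 Nat.succ) (Finset.mem_range.2 hk)
  simp only [h2, Option.elim_some] at this
  exact lt_of_lt_of_le (Nat.lt_of_succ_le this) (le_max_right _ _)

/-- The matrix whose `i`-th row is the `f i`-th row of `x`, or zero where `f` is undefined. -/
def row (f : ℕ ≃. ℕ) (x : FinMat A) : FinMat A :=
  ofEntries (rowBound f x.2.choose) (selectRow f x.entry)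

theorem entry_row (f : ℕ ≃. ℕ) (x : FinMat A) (i j : ℕ) :
    (row f x).entry i j = selectRow f x.entry i j := by
  have hx := x.2.choose_spec
  rw [row, entry_ofEntries]
  split_ifs with h
  · rfl
  · unfold selectRow
    cases hf : f i with
    | none => rfl
    | some k =>
      symm
      refine entry_eq_zero hx fun ⟨hk, hj⟩ => h ⟨lt_rowBound hf hk, hj.trans_le (le_max_left _ _)⟩

end FinMat

namespace Stab

open FinMat

theorem of_row_star_mul (f : ℕ ≃. ℕ) (x y : FinMat A) :
    star (of (row f x)) * of y = star (of x) * of (row f.symm y) := by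
  rw [← of_star, ← of_star, ← of_mul, ← of_mul]
  refine of_eq_of fun i j => ?_
  obtain ⟨N1, h1, h2⟩ := exists_coherent (row f x) x
  obtain ⟨N2, h3, h4⟩ := exists_coherent (row f.symm y) y
  set N := max N1 N2
  replace h1 := h1.mono (le_max_left N1 N2)
  replace h2 := h2.mono (le_max_left N1 N2)
  replace h3 := h3.mono (le_max_right N1 N2)
  replace h4 := h4.mono (le_max_right N1 N2)
  rw [entry_mul (coherent_star h1) h4, entry_mul (coherent_star h2) h3]
  simp only [entry_star, entry_row]
  refine Finset.sum_bij_ne_zero (fun k _ hk => (f k).getD 0) ?_ ?_ ?_ ?_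
  · intro k hk hne
    unfold selectRow at hne
    cases hf : f k with
    | none => simp [hf] at hne
    | some l =>
      simp only [hf, Option.elim_some, Option.getD_some] at hne ⊢
      rw [Finset.mem_range]
      by_contra hl
      exact hne (by rw [entry_eq_zero h2 (by omega)]; simp)
  · intro k hk hne k' hk' hne' he
    unfold selectRow at hne hne'
    cases hf : f k with
    | none => simp [hf] at hne
    | some l =>
      cases hf' : f k' with
      | none => simp [hf'] at hne'
      | some l' =>
        simp only [hf, hf', Option.getD_some] at he
        subst he
        exact f.inj hf hf'
  · intro l hl hne
    unfold selectRow at hne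
    cases hf : f.symm l with
    | none => simp [hf] at hne
    | some k =>
      have hf' : f k = some l := (f.eq_some_iff).1 hf
      simp only [hf, Option.elim_some] at hne
      refine ⟨k, ?_, ?_, ?_⟩
      · rw [Finset.mem_range]
        by_contra hk
        exact hne (by rw [entry_eq_zero h4 (by omega)]; simp)
      · simpa [selectRow, hf'] using hne
      · simp [hf']
  · intro k hk hne
    unfold selectRow at hne ⊢
    cases hf : f k with
    | none => simp [hf] at hne
    | some l =>
      have hf' : f.symm l = some k := (f.eq_some_iff).2 hf
      simp [hf']

theorem of_row_row (f g : ℕ ≃. ℕ) (x : FinMat A) :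
    of (row f (row g x)) = of (row (f.trans g) x) := by
  refine of_eq_of fun i j => ?_
  rw [entry_row, entry_row]
  unfold selectRow
  cases hf : f i with
  | none => simp [PEquiv.trans, hf]
  | some k => simp [PEquiv.trans, hf, entry_row, selectRow]

theorem norm_row_le_aux (f : ℕ ≃. ℕ) (x : FinMat A) : ‖of (row f x)‖ ≤ ‖x‖ := by
  have key : ∀ p : ℕ ≃. ℕ, p.symm.trans p = p → ‖of (row p x)‖ ≤ ‖x‖ := by
    intro p hp
    have h : ‖of (row p x)‖ * ‖of (row p x)‖ ≤ ‖x‖ * ‖of (row p x)‖ := by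
      rw [← CStarRing.norm_star_mul_self, of_row_star_mul, of_row_row, hp]
      refine (norm_mul_le _ _).trans ?_
      rw [norm_star, norm_of x]
    by_contra hlt
    push Not at hlt
    nlinarith [norm_nonneg x]
  have hp : (f.symm.trans f).symm.trans (f.symm.trans f) = f.symm.trans f := by
    rw [PEquiv.symm_trans_self f, PEquiv.ofSet_symm]
    ext a b
    rw [← Option.mem_def, ← Option.mem_def, PEquiv.mem_trans]
    simp only [PEquiv.mem_ofSet_iff]
    constructor
    · rintro ⟨c, ⟨rfl, _⟩, h⟩
      exact h
    · rintro ⟨rfl, h⟩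
      exact ⟨_, ⟨rfl, h⟩, rfl, h⟩
  have h : ‖of (row f x)‖ * ‖of (row f x)‖ ≤ ‖x‖ * ‖x‖ := by
    rw [← CStarRing.norm_star_mul_self, of_row_star_mul, of_row_row]
    refine (norm_mul_le _ _).trans ?_
    rw [norm_star, norm_of x]
    exact mul_le_mul_of_nonneg_left (key _ hp) (norm_nonneg _)
  nlinarith [norm_nonneg x, norm_nonneg (of (row f x))]

/-- The row operation as a bounded additive map on finite matrices. -/
def rowFinHom (f : ℕ ≃. ℕ) : NormedAddGroupHom (FinMat A) (Stab A) where
  toFun x := of (row f x)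
  map_add' x y := by
    rw [← of_add]
    refine of_eq_of fun i j => ?_
    rw [entry_add, entry_row, entry_row, entry_row]
    unfold selectRow
    cases f i with
    | none => simp
    | some k => simp [entry_add]
  bound' := ⟨1, fun x => by rw [one_mul]; exact norm_row_le_aux f x⟩

/-- The row operation of the partial injection `f` on `A ⊗ 𝕂`: the `i`-th row of `row f x` is the
`f i`-th row of `x`, or zero where `f` is undefined. In other words, left multiplication by a
partial permutation matrix. -/
def row (f : ℕ ≃. ℕ) : Stab A → Stab A := (rowFinHom f).extension

theorem row_of (f : ℕ ≃. ℕ) (x : FinMat A) : row f (of x) = of (FinMat.row f x) :=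
  NormedAddGroupHom.extension_coe (rowFinHom f) x

@[fun_prop]
theorem continuous_row (f : ℕ ≃. ℕ) : Continuous (row f : Stab A → Stab A) :=
  (rowFinHom f).extension.continuous

theorem row_add (f : ℕ ≃. ℕ) (x y : Stab A) : row f (x + y) = row f x + row f y :=
  map_add (rowFinHom f).extension x y

theorem row_sub (f : ℕ ≃. ℕ) (x y : Stab A) : row f (x - y) = row f x - row f y :=
  map_sub (rowFinHom f).extension x y

theorem row_zero (f : ℕ ≃. ℕ) : row f (0 : Stab A) = 0 := map_zero (rowFinHom f).extension

theorem row_smul (f : ℕ ≃. ℕ) (c : ℂ) (x : Stab A) : row f (c • x) = c • row f x := by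
  refine ind₁ (p := fun x => row f (c • x) = c • row f x)
    (isClosed_eq ((continuous_row f).comp (continuous_smul' A c))
      ((continuous_smul' A c).comp (continuous_row f))) (fun x => ?_) x
  rw [← of_smul, row_of, row_of, ← of_smul]
  refine of_eq_of fun i j => ?_
  rw [entry_smul, entry_row, entry_row]
  unfold selectRow
  cases f i with
  | none => simp
  | some k => simp [entry_smul]

theorem row_mul (f : ℕ ≃. ℕ) (x y : Stab A) : row f (x * y) = row f x * y := by
  refine ind₂ (p := fun x y => row f (x * y) = row f x * y)
    (isClosed_eq (by fun_prop) (by fun_prop)) (fun x y => ?_) x y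
  rw [← of_mul, row_of, row_of, ← of_mul]
  refine of_eq_of fun i j => ?_
  obtain ⟨N1, h1, h2⟩ := exists_coherent (FinMat.row f x) x
  obtain ⟨N2, h3⟩ := y.2
  set N := max N1 N2
  replace h1 := h1.mono (le_max_left N1 N2)
  replace h2 := h2.mono (le_max_left N1 N2)
  replace h3 := IsCoherentFrom.mono (le_max_right N1 N2) h3
  rw [entry_row, entry_mul h1 h3]
  simp only [entry_row]
  unfold selectRow
  cases f i with
  | none => simp
  | some k => simp [entry_mul h2 h3]

theorem star_row_mul (f : ℕ ≃. ℕ) (x y : Stab A) :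
    star (row f x) * y = star x * row f.symm y := by
  have hs : Continuous (star : Stab A → Stab A) := continuous_star
  refine ind₂ (p := fun x y => star (row f x) * y = star x * row f.symm y)
    (isClosed_eq (by fun_prop) (by fun_prop)) (fun x y => ?_) x y
  rw [row_of, row_of, of_row_star_mul]

theorem row_row (f g : ℕ ≃. ℕ) (x : Stab A) : row f (row g x) = row (f.trans g) x := by
  refine ind₁ (p := fun x => row f (row g x) = row (f.trans g) x)
    (isClosed_eq (by fun_prop) (by fun_prop)) (fun x => ?_) x
  rw [row_of, row_of, row_of, of_row_row]

theorem row_refl (x : Stab A) : row (PEquiv.refl ℕ) x = x := by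
  refine ind₁ (p := fun x => row (PEquiv.refl ℕ) x = x)
    (isClosed_eq (by fun_prop) (by fun_prop)) (fun x => ?_) x
  rw [row_of]
  refine of_eq_of fun i j => ?_
  rw [entry_row]
  simp [selectRow]

theorem row_bot (x : Stab A) : row ⊥ x = 0 := by
  refine ind₁ (p := fun x => row ⊥ x = 0)
    (isClosed_eq (by fun_prop) (by fun_prop)) (fun x => ?_) x
  rw [row_of, ← of_zero]
  refine of_eq_of fun i j => ?_
  rw [entry_row]
  simp only [selectRow, PEquiv.bot_apply, Option.elim_none]
  rfl

theorem norm_row_le (f : ℕ ≃. ℕ) (x : Stab A) : ‖row f x‖ ≤ ‖x‖ := by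
  refine ind₁ (p := fun x => ‖row f x‖ ≤ ‖x‖)
    (isClosed_le (by fun_prop) (by fun_prop)) (fun x => ?_) x
  rw [row_of, norm_of x]
  exact norm_row_le_aux f x

theorem ofSet_Iio_apply (n i : ℕ) :
    PEquiv.ofSet (Set.Iio n) i = if i < n then some i else none := by
  split_ifs with h
  · exact PEquiv.mem_ofSet_iff.2 ⟨rfl, h⟩
  · rw [Option.eq_none_iff_forall_not_mem]
    intro a ha
    obtain ⟨rfl, h2⟩ := PEquiv.mem_ofSet_iff.1 ha
    exact h h2

/-- The first `n` rows of a matrix. -/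
theorem sum_row_single_of (n : ℕ) (x : Stab A) :
    ∑ i ∈ Finset.range n, row (PEquiv.single i i) x = row (PEquiv.ofSet (Set.Iio n)) x := by
  refine ind₁ (p := fun x => ∑ i ∈ Finset.range n, row (PEquiv.single i i) x
      = row (PEquiv.ofSet (Set.Iio n)) x)
    (isClosed_eq (by fun_prop) (by fun_prop)) (fun x => ?_) x
  induction n with
  | zero =>
    rw [Finset.sum_range_zero, row_of, ← of_zero]
    refine of_eq_of fun i j => ?_
    rw [entry_row]
    simp only [selectRow, ofSet_Iio_apply]
    simp only [not_lt_zero, ↓reduceIte, Option.elim_none]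
    rfl
  | succ n ih =>
    rw [Finset.sum_range_succ, ih, row_of, row_of, row_of, ← of_add]
    refine of_eq_of fun i j => ?_
    rw [entry_add, entry_row, entry_row, entry_row]
    simp only [selectRow, ofSet_Iio_apply]
    rcases lt_trichotomy i n with h | h | h
    · have h1 : i < n + 1 := by omega
      rw [PEquiv.single_apply_of_ne h.ne' n]
      simp [h, h1]
    · simp [h]
    · have h1 : ¬ i < n + 1 := by omega
      rw [PEquiv.single_apply_of_ne h.ne n]
      simp [h1, h.not_gt]

theorem tendsto_sum_row_single (x : Stab A) :
    Tendsto (fun n => ∑ i ∈ Finset.range n, row (PEquiv.single i i) x) atTop (𝓝 x) := by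
  simp_rw [sum_row_single_of]
  rw [Metric.tendsto_atTop]
  intro ε hε
  obtain ⟨_, ⟨y, rfl⟩, hy⟩ := Metric.mem_closure_iff.1 (denseRange_of x) (ε / 2) (by positivity)
  obtain ⟨N, hN⟩ := y.2
  refine ⟨N, fun n hn => ?_⟩
  have e : row (PEquiv.ofSet (Set.Iio n)) (of y) = of y := by
    rw [row_of]
    refine of_eq_of fun i j => ?_
    rw [entry_row]
    simp only [selectRow, ofSet_Iio_apply]
    by_cases h : i < n
    · simp only [h, if_true, Option.elim_some]
    · simp only [h, if_false, Option.elim_none]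
      rw [entry_eq_zero hN]
      intro hi
      exact h (lt_of_lt_of_le hi.1 hn)
  have e2 : row (PEquiv.ofSet (Set.Iio n)) x - x
      = row (PEquiv.ofSet (Set.Iio n)) (x - of y) - (x - of y) := by
    rw [row_sub, e]; abel
  rw [dist_eq_norm] at hy ⊢
  rw [e2]
  have := norm_row_le (PEquiv.ofSet (Set.Iio n)) (x - of y)
  linarith [norm_sub_le (row (PEquiv.ofSet (Set.Iio n)) (x - of y)) (x - of y)]

end Stab

end Rows

/-! ### Matrix units, ideals and simplicity of the stabilization -/

section Simple

variable {A : Type u} [NonUnitalCStarAlgebra A] [PartialOrder A] [StarOrderedRing A]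

namespace Stab

open FinMat

/-- The column operation adjoint to `row f`: right multiplication by the adjoint of the partial
permutation matrix of `f`. -/
def col (f : ℕ ≃. ℕ) (x : Stab A) : Stab A := star (row f (star x))

theorem continuous_col (f : ℕ ≃. ℕ) : Continuous (col f : Stab A → Stab A) :=
  continuous_star.comp ((continuous_row f).comp continuous_star)

theorem mul_col (f : ℕ ≃. ℕ) (x y : Stab A) : x * col f y = col f (x * y) := by
  unfold col
  rw [star_mul x y, row_mul, star_mul, star_star]

theorem col_mul (f : ℕ ≃. ℕ) (x y : Stab A) : col f x * y = x * row f.symm y := by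
  unfold col
  rw [star_row_mul, star_star]

theorem col_col (f g : ℕ ≃. ℕ) (x : Stab A) : col f (col g x) = col (f.trans g) x := by
  unfold col
  rw [star_star, row_row]

theorem row_col (f g : ℕ ≃. ℕ) (x : Stab A) : row f (col g x) = col g (row f x) := by
  have hl := CStarAlgebra.increasingApproximateUnit (Stab A)
  have hne := hl.toIsApproximateUnit.neBot
  have hc : Continuous fun x : Stab A => row f (col g x) := (continuous_row f).comp
    (continuous_col g)
  have hc' : Continuous fun x : Stab A => col g (row f x) := (continuous_col g).comp
    (continuous_row f)
  have h1 := (hc.tendsto x).comp (hl.toIsApproximateUnit.tendsto_mul_right x)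
  have h2 := (hc'.tendsto x).comp (hl.toIsApproximateUnit.tendsto_mul_right x)
  refine tendsto_nhds_unique h1 (h2.congr fun u => ?_)
  change col g (row f (u * x)) = row f (col g (u * x))
  rw [row_mul, ← mul_col, ← mul_col, row_mul]

theorem entry_cornerFin (a : A) (i j : ℕ) :
    (cornerFin a).entry i j = if i < 1 ∧ j < 1 then a else 0 := by
  have h : IsCoherentFrom A 1 (cornerFin a).1 := cornerFin_coherent a
  rw [← apply_eq_entry (M := max 1 (max i j + 1)) h (le_max_left _ _) ⟨i, by omega⟩ ⟨j, by omega⟩,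
    cornerFin_apply]

theorem row_single_corner (a : A) : row (PEquiv.single 0 0) (corner A a) = corner A a := by
  change row _ (of (cornerFin a)) = of (cornerFin a)
  rw [row_of]
  refine of_eq_of fun i j => ?_
  rw [entry_row]
  unfold selectRow
  by_cases h : i = 0
  · subst h
    rw [PEquiv.single_apply]
    rfl
  · rw [PEquiv.single_apply_of_ne (Ne.symm h)]
    rw [entry_cornerFin, if_neg (by omega)]
    rfl

theorem col_single_corner (a : A) : col (PEquiv.single 0 0) (corner A a) = corner A a := by
  unfold col
  rw [← map_star, row_single_corner, map_star, star_star]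

theorem isClosed_range_corner : IsClosed (Set.range (corner A)) :=
  (AddMonoidHomClass.isometry_of_norm (corner A) (corner_norm A)).isClosedEmbedding.isClosed_range

theorem corner_injective : Function.Injective (corner A) :=
  (AddMonoidHomClass.isometry_of_norm (corner A) (corner_norm A)).injective

/-- The compression of a matrix to the corner `A ⊗ e₁₁`. -/
theorem exists_compress_eq_corner (x : Stab A) :
    ∃ a, row (PEquiv.single 0 0) (col (PEquiv.single 0 0) x) = corner A a := by
  have key : ∀ x : Stab A, row (PEquiv.single 0 0) (col (PEquiv.single 0 0) x)
      ∈ Set.range (corner A) := by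
    refine ind₁ (isClosed_range_corner.preimage
      ((continuous_row _).comp (continuous_col _))) fun x => ?_
    refine ⟨x.entry 0 0, ?_⟩
    unfold col
    rw [← of_star, row_of, ← of_star, row_of]
    refine of_eq_of fun i j => ?_
    rw [entry_cornerFin, entry_row]
    by_cases hi : i = 0
    · subst hi
      simp only [selectRow, PEquiv.single_apply, Option.elim_some]
      rw [entry_star, entry_row]
      by_cases hj : j = 0
      · subst hj
        simp only [selectRow, PEquiv.single_apply, Option.elim_some]
        rw [entry_star, star_star]
        simp
      · simp only [selectRow]
        rw [PEquiv.single_apply_of_ne (Ne.symm hj), if_neg (by omega)]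
        simp
    · simp only [selectRow]
      rw [PEquiv.single_apply_of_ne (Ne.symm hi), if_neg (by omega)]
      rfl
  obtain ⟨a, ha⟩ := key x
  exact ⟨a, ha.symm⟩

theorem single_trans_single' (i j k : ℕ) :
    (PEquiv.single i j : ℕ ≃. ℕ).trans (PEquiv.single j k) = PEquiv.single i k :=
  PEquiv.single_trans_single i j k

theorem row_mem_of_isClosed {I : Submodule ℂ (Stab A)} (hI : IsIdeal I)
    (hc : IsClosed (I : Set (Stab A))) (f : ℕ ≃. ℕ) {x : Stab A} (hx : x ∈ I) : row f x ∈ I := by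
  have hl := CStarAlgebra.increasingApproximateUnit (Stab A)
  have hne := hl.toIsApproximateUnit.neBot
  refine hc.mem_of_tendsto (((continuous_row f).tendsto x).comp
    (hl.toIsApproximateUnit.tendsto_mul_right x)) (Eventually.of_forall fun u => ?_)
  change row f (u * x) ∈ I
  rw [row_mul]
  exact (hI x hx _).1

theorem col_mem_of_isClosed {I : Submodule ℂ (Stab A)} (hI : IsIdeal I)
    (hc : IsClosed (I : Set (Stab A))) (f : ℕ ≃. ℕ) {x : Stab A} (hx : x ∈ I) : col f x ∈ I := by
  have hl := CStarAlgebra.increasingApproximateUnit (Stab A)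
  have hne := hl.toIsApproximateUnit.neBot
  refine hc.mem_of_tendsto (((continuous_col f).tendsto x).comp
    (hl.toIsApproximateUnit.tendsto_mul_left x)) (Eventually.of_forall fun u => ?_)
  change col f (x * u) ∈ I
  rw [← mul_col]
  exact (hI x hx _).2

/-- A closed set that contains all matrices with a single nonzero entry, taken from `x`, and is
closed under sums contains `x`. -/
theorem mem_of_entries {S : AddSubmonoid (Stab A)} (hS : IsClosed (S : Set (Stab A))) {x : Stab A}
    (h : ∀ i j, row (PEquiv.single i i) (col (PEquiv.single j j) x) ∈ S) : x ∈ S := by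
  have h1 : ∀ j, col (PEquiv.single j j) x ∈ S := fun j =>
    hS.mem_of_tendsto (tendsto_sum_row_single _)
      (Eventually.of_forall fun n => S.sum_mem fun i _ => h i j)
  have h2 := (tendsto_sum_row_single (star x)).star
  rw [star_star] at h2
  refine hS.mem_of_tendsto h2 (Eventually.of_forall fun n => ?_)
  rw [star_sum]
  exact S.sum_mem fun j _ => h1 j

theorem isSimpleCStar (hA : IsSimpleCStar A) : IsSimpleCStar (Stab A) := by
  obtain ⟨hnt, hs⟩ := hA
  refine ⟨(corner_injective (A := A)).nontrivial, fun I hI hc => ?_⟩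
  by_cases hbot : I = ⊥
  · exact Or.inl hbot
  right
  let J : Submodule ℂ A :=
    { carrier := {b | corner A b ∈ I}
      add_mem' := fun {x y} hx hy => by
        change corner A (x + y) ∈ I
        rw [map_add]; exact I.add_mem hx hy
      zero_mem' := by
        change corner A 0 ∈ I
        rw [map_zero]; exact I.zero_mem
      smul_mem' := fun c x hx => by
        change corner A (c • x) ∈ I
        rw [map_smul]; exact I.smul_mem c hx }
  have hJ : IsIdeal J := fun x hx a => by
    constructor
    · change corner A (a * x) ∈ I
      rw [map_mul]; exact (hI _ hx _).1
    · change corner A (x * a) ∈ I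
      rw [map_mul]; exact (hI _ hx _).2
  have hJc : IsClosed (J : Set A) := hc.preimage
    (AddMonoidHomClass.isometry_of_norm (corner A) (corner_norm A)).continuous
  have hfac : ∀ (x : Stab A) (i j : ℕ), row (PEquiv.single i i) (col (PEquiv.single j j) x)
      = row (PEquiv.single i 0) (col (PEquiv.single j 0) (row (PEquiv.single 0 0)
        (col (PEquiv.single 0 0) (row (PEquiv.single 0 i) (col (PEquiv.single 0 j) x))))) := by
    intro x i j
    simp only [row_col, col_col, row_row, single_trans_single']
  rcases hs J hJ hJc with h | h
  · exfalso
    refine hbot ((Submodule.eq_bot_iff _).2 fun x hx => ?_)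
    refine mem_of_entries (S := ⊥) (by simp) fun i j => ?_
    rw [hfac]
    obtain ⟨a, ha⟩ := exists_compress_eq_corner
      (row (PEquiv.single 0 i) (col (PEquiv.single 0 j) x))
    have h1 : corner A a ∈ I := by
      rw [← ha]
      exact row_mem_of_isClosed hI hc _ (col_mem_of_isClosed hI hc _
        (row_mem_of_isClosed hI hc _ (col_mem_of_isClosed hI hc _ hx)))
    have h2 : a ∈ J := h1
    rw [h, Submodule.mem_bot] at h2
    rw [ha, h2, map_zero]
    unfold col
    rw [star_zero, row_zero, star_zero, row_zero]
    exact AddSubmonoid.zero_mem _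
  · rw [Submodule.eq_top_iff']
    intro x
    refine mem_of_entries (S := I.toAddSubmonoid) hc fun i j => ?_
    rw [hfac]
    obtain ⟨a, ha⟩ := exists_compress_eq_corner
      (row (PEquiv.single 0 i) (col (PEquiv.single 0 j) x))
    have h2 : a ∈ J := h ▸ Submodule.mem_top
    rw [ha]
    exact row_mem_of_isClosed hI hc _ (col_mem_of_isClosed hI hc _ h2)

/-- The Pedersen ideal is invariant under row operations: for a dense ideal `I`, the elements of `I`
that are moved into `I` again form a dense ideal. -/
theorem row_mem_pedersen (f : ℕ ≃. ℕ) {x : Stab A} (hx : x ∈ pedersen (Stab A)) :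
    row f x ∈ pedersen (Stab A) := by
  intro I hI hd
  let J : Submodule ℂ (Stab A) :=
    { carrier := {y | y ∈ I ∧ row f y ∈ I}
      add_mem' := fun {y z} hy hz => ⟨I.add_mem hy.1 hz.1, by
        rw [row_add]; exact I.add_mem hy.2 hz.2⟩
      zero_mem' := ⟨I.zero_mem, by rw [row_zero]; exact I.zero_mem⟩
      smul_mem' := fun c y hy => ⟨I.smul_mem c hy.1, by
        rw [row_smul]; exact I.smul_mem c hy.2⟩ }
  refine (hx J (fun y hy a => ⟨⟨(hI y hy.1 a).1, ?_⟩, ⟨(hI y hy.1 a).2, ?_⟩⟩) ?_).2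
  · rw [row_mul]; exact (hI y hy.1 _).1
  · rw [row_mul]; exact (hI _ hy.2 a).2
  · have h1 : ∀ a, ∀ y ∈ I, a * y ∈ J := fun a y hy =>
      ⟨(hI y hy a).1, by rw [row_mul]; exact (hI y hy _).1⟩
    have hl := CStarAlgebra.increasingApproximateUnit (Stab A)
    have hne := hl.toIsApproximateUnit.neBot
    have h2 : (I : Set (Stab A)) ⊆ closure J := fun y hy =>
      mem_closure_of_tendsto (hl.toIsApproximateUnit.tendsto_mul_right y)
        (Eventually.of_forall fun u => h1 u y hy)
    exact dense_closure.1 (hd.mono h2)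

theorem col_mem_pedersen (f : ℕ ≃. ℕ) {x : Stab A} (hx : x ∈ pedersen (Stab A)) :
    col f x ∈ pedersen (Stab A) :=
  star_mem (row_mem_pedersen f (star_mem hx))

/-! ### A sequence of isometries with orthogonal ranges -/

/-- The partial bijection `pair n i ↦ i` of `ℕ`. -/
def shiftEquiv (n : ℕ) : ℕ ≃. ℕ where
  toFun k := if k.unpair.1 = n then some k.unpair.2 else none
  invFun i := some (Nat.pair n i)
  inv k i := by
    simp only [Option.some.injEq, Option.ite_none_right_eq_some]
    constructor
    · rintro rfl
      simp
    · rintro ⟨rfl, rfl⟩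
      simp

/-- Left multiplication by the `n`-th of a sequence of isometries with orthogonal ranges. -/
def shift (n : ℕ) : Stab A → Stab A := row (shiftEquiv n)

theorem shiftEquiv_symm_trans (m n : ℕ) :
    (shiftEquiv m).symm.trans (shiftEquiv n) = if m = n then PEquiv.refl ℕ else ⊥ := by
  ext i j
  have h : (shiftEquiv m).symm.trans (shiftEquiv n) i
      = if (Nat.pair m i).unpair.1 = n then some (Nat.pair m i).unpair.2 else none := rfl
  rw [h]
  split_ifs with h1 h2 h2
  · simp
  · simp at h1; exact absurd h1 h2
  · simp at h1; exact absurd h2 h1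
  · simp

theorem shift_symm_shift (m n : ℕ) (x : Stab A) :
    row (shiftEquiv m).symm (shift n x) = if m = n then x else 0 := by
  unfold shift
  rw [row_row, shiftEquiv_symm_trans]
  split_ifs
  · exact row_refl x
  · exact row_bot x

theorem star_shift_mul_shift (m n : ℕ) (x y : Stab A) :
    star (shift m x) * shift n y = if m = n then star x * y else 0 := by
  rw [shift, star_row_mul, shift_symm_shift]
  split_ifs <;> simp

theorem shift_mul (n : ℕ) (x y : Stab A) : shift n (x * y) = shift n x * y := row_mul _ _ _

theorem shift_add (n : ℕ) (x y : Stab A) : shift n (x + y) = shift n x + shift n y := row_add _ _ _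

end Stab

end Simple

/-! ### Quasitraces on commuting elements and on functions of one element -/

section QuasitraceBasics

section
variable {P : Type u} [NonUnitalRing P] [StarRing P] [Module ℂ P] [IsScalarTower ℂ P P]
  [SMulCommClass ℂ P P] [StarModule ℂ P]

theorem IsQuasitrace.add_of_commute {τ : P → ℂ} (hτ : IsQuasitrace τ) {x y : P}
    (hx : IsSelfAdjoint x) (hy : IsSelfAdjoint y) (hxy : x * y = y * x) :
    τ (x + y) = τ x + τ y := by
  let C := NonUnitalStarAlgebra.adjoin ℂ ({x, y} : Set P)
  have hs : ∀ a ∈ ({x, y} : Set P), ∀ b ∈ ({x, y} : Set P), a * b = b * a := by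
    rintro a (rfl | rfl) b (rfl | rfl)
    exacts [rfl, hxy, hxy.symm, rfl]
  have hs' : ∀ a ∈ ({x, y} : Set P), ∀ b ∈ ({x, y} : Set P), a * star b = star b * a := by
    intro a ha b hb
    have : star b = b := by
      rcases hb with rfl | rfl
      exacts [hx.star_eq, hy.star_eq]
    rw [this]; exact hs a ha b hb
  have hC : ∀ a ∈ C, ∀ b ∈ C, a * b = b * a := fun a ha b hb =>
    have := NonUnitalStarAlgebra.isMulCommutative_adjoin ℂ hs hs'
    setLike_mul_comm ha hb
  exact (hτ.linear C hC).1 x (NonUnitalStarAlgebra.subset_adjoin ℂ _ (by simp)) y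
    (NonUnitalStarAlgebra.subset_adjoin ℂ _ (by simp))

theorem IsQuasitrace.smul_of_isSelfAdjoint {τ : P → ℂ} (hτ : IsQuasitrace τ) {x : P}
    (hx : IsSelfAdjoint x) (c : ℂ) : τ (c • x) = c * τ x := by
  let C := NonUnitalStarAlgebra.adjoin ℂ ({x} : Set P)
  have hs : ∀ a ∈ ({x} : Set P), ∀ b ∈ ({x} : Set P), a * b = b * a := by
    rintro a rfl b rfl
    rfl
  have hs' : ∀ a ∈ ({x} : Set P), ∀ b ∈ ({x} : Set P), a * star b = star b * a := by
    rintro a rfl b rfl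
    rw [hx.star_eq]
  have hC : ∀ a ∈ C, ∀ b ∈ C, a * b = b * a := fun a ha b hb =>
    have := NonUnitalStarAlgebra.isMulCommutative_adjoin ℂ hs hs'
    setLike_mul_comm ha hb
  exact (hτ.linear C hC).2 c x (NonUnitalStarAlgebra.subset_adjoin ℂ _ (by simp))

end

/-- Continuous functions that vanish on `(-∞, κ]` for some `κ > 0`. They map every element into the
Pedersen ideal. -/
structure IsCutoff (g : ℝ → ℝ) : Prop where
  continuous : Continuous g
  vanish : ∃ κ > 0, ∀ t ≤ κ, g t = 0

namespace IsCutoff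

theorem map_zero {g : ℝ → ℝ} (hg : IsCutoff g) : g 0 = 0 := by
  obtain ⟨κ, hκ, h⟩ := hg.vanish
  exact h 0 hκ.le

theorem fEps {ε : ℝ} (hε : 0 < ε) : IsCutoff (TAOZ.fEps ε) :=
  ⟨fEps_continuous ε, ε, hε, fun _ ht => fEps_eq_zero hε ht⟩

theorem comp_left {g h : ℝ → ℝ} (hg : IsCutoff g) (hh : Continuous h) (h0 : h 0 = 0) :
    IsCutoff (fun t => h (g t)) := by
  obtain ⟨κ, hκ, hv⟩ := hg.vanish
  exact ⟨hh.comp hg.continuous, κ, hκ, fun t ht => by rw [hv t ht, h0]⟩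

theorem add {g h : ℝ → ℝ} (hg : IsCutoff g) (hh : IsCutoff h) : IsCutoff (fun t => g t + h t) := by
  obtain ⟨κ, hκ, hv⟩ := hg.vanish
  obtain ⟨κ', hκ', hv'⟩ := hh.vanish
  exact ⟨hg.continuous.add hh.continuous, min κ κ', lt_min hκ hκ', fun t ht => by
    rw [hv t (ht.trans (min_le_left _ _)), hv' t (ht.trans (min_le_right _ _)), add_zero]⟩

theorem const_mul {g : ℝ → ℝ} (hg : IsCutoff g) (c : ℝ) : IsCutoff (fun t => c * g t) :=
  hg.comp_left (h := fun s => c * s) (by fun_prop) (mul_zero c)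

theorem sub {g h : ℝ → ℝ} (hg : IsCutoff g) (hh : IsCutoff h) : IsCutoff (fun t => g t - h t) := by
  have := hg.add (hh.const_mul (-1))
  simpa [sub_eq_add_neg] using this

theorem comp_right {g h : ℝ → ℝ} (hg : IsCutoff g) (hh : Continuous h)
    (hle : ∀ κ > 0, ∃ κ' > 0, ∀ t ≤ κ', h t ≤ κ) : IsCutoff (fun t => g (h t)) := by
  obtain ⟨κ, hκ, hv⟩ := hg.vanish
  obtain ⟨κ', hκ', hl⟩ := hle κ hκ
  exact ⟨hg.continuous.comp hh, κ', hκ', fun t ht => hv _ (hl t ht)⟩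

theorem mem {B : Type u} [NonUnitalCStarAlgebra B] {g : ℝ → ℝ} (hg : IsCutoff g) (x : B) :
    cfcₙ g x ∈ pedersen B := by
  obtain ⟨κ, hκ, h⟩ := hg.vanish
  exact cfc_mem_pedersen hκ g hg.continuous h x

end IsCutoff

variable {A : Type u} [NonUnitalCStarAlgebra A] [PartialOrder A] [StarOrderedRing A]

namespace DenseQT

open Classical in
/-- The real part of `τ(x)` for `x` in the Pedersen ideal (and zero elsewhere). -/
def rval (τ : DenseQT A) (x : Stab A) : ℝ :=
  if h : x ∈ pedersen (Stab A) then (τ.1 ⟨x, h⟩).re else 0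

variable (τ : DenseQT A)

theorem rval_eq {x : Stab A} (h : x ∈ pedersen (Stab A)) : τ.rval x = (τ.1 ⟨x, h⟩).re := dif_pos h

theorem val_eq (x : pedersen (Stab A)) : τ.val x = ENNReal.ofReal (τ.rval x) := by
  rw [rval_eq τ x.2]; rfl

theorem rval_add {x y : Stab A} (hx : x ∈ pedersen (Stab A)) (hy : y ∈ pedersen (Stab A))
    (hxs : IsSelfAdjoint x) (hys : IsSelfAdjoint y) (h : x * y = y * x) :
    τ.rval (x + y) = τ.rval x + τ.rval y := by
  rw [rval_eq τ hx, rval_eq τ hy, rval_eq τ (add_mem hx hy), ← Complex.add_re]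
  congr 1
  exact τ.2.1.add_of_commute (x := ⟨x, hx⟩) (y := ⟨y, hy⟩) (Subtype.ext hxs.star_eq)
    (Subtype.ext hys.star_eq) (Subtype.ext h)

theorem rval_smul {x : Stab A} (hx : x ∈ pedersen (Stab A)) (hxs : IsSelfAdjoint x) (c : ℝ) :
    τ.rval (c • x) = c * τ.rval x := by
  have e : c • x = (c : ℂ) • x := (Complex.coe_smul c x).symm
  have hcx : (c : ℂ) • x ∈ pedersen (Stab A) := SMulMemClass.smul_mem _ hx
  rw [e, rval_eq τ hx, rval_eq τ hcx, ← Complex.re_ofReal_mul]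
  congr 1
  exact τ.2.1.smul_of_isSelfAdjoint (x := ⟨x, hx⟩) (Subtype.ext hxs.star_eq) c

theorem rval_star_mul_self_nonneg {z : Stab A} (hz : z ∈ pedersen (Stab A)) :
    0 ≤ τ.rval (star z * z) := by
  rw [rval_eq τ (mul_mem (star_mem hz) hz)]
  exact (Complex.nonneg_iff.1 (τ.2.1.nonneg ⟨z, hz⟩)).1

theorem rval_star_mul_self {z : Stab A} (hz : z ∈ pedersen (Stab A)) :
    τ.rval (star z * z) = τ.rval (z * star z) := by
  rw [rval_eq τ (mul_mem (star_mem hz) hz), rval_eq τ (mul_mem hz (star_mem hz))]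
  exact congrArg Complex.re (τ.2.1.trace ⟨z, hz⟩)

theorem rval_zero : τ.rval 0 = 0 := by
  have := rval_smul τ (x := 0) (zero_mem _) (IsSelfAdjoint.zero _) 0
  simpa using this

theorem rval_cfcₙ_add {g h : ℝ → ℝ} (hg : IsCutoff g) (hh : IsCutoff h) (x : Stab A) :
    τ.rval (cfcₙ (fun t => g t + h t) x) = τ.rval (cfcₙ g x) + τ.rval (cfcₙ h x) := by
  rw [cfcₙ_add _ _ _ hg.continuous.continuousOn hg.map_zero hh.continuous.continuousOn hh.map_zero]
  exact rval_add τ (hg.mem x) (hh.mem x) (cfcₙ_predicate _ _) (cfcₙ_predicate _ _)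
    (cfcₙ_commute_cfcₙ g h x)

theorem rval_cfcₙ_const_mul {g : ℝ → ℝ} (hg : IsCutoff g) (c : ℝ) (x : Stab A) :
    τ.rval (cfcₙ (fun t => c * g t) x) = c * τ.rval (cfcₙ g x) := by
  rw [cfcₙ_const_mul _ _ _ hg.continuous.continuousOn hg.map_zero]
  exact rval_smul τ (hg.mem x) (cfcₙ_predicate _ _) c

theorem rval_cfcₙ_nonneg {g : ℝ → ℝ} (hg : IsCutoff g) {x : Stab A} (hx : 0 ≤ x)
    (h : ∀ t, 0 ≤ t → 0 ≤ g t) : 0 ≤ τ.rval (cfcₙ g x) := by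
  have hs := hg.comp_left Real.continuous_sqrt Real.sqrt_zero
  have e : cfcₙ g x = star (cfcₙ (fun t => Real.sqrt (g t)) x)
      * cfcₙ (fun t => Real.sqrt (g t)) x := by
    rw [(cfcₙ_predicate _ x : IsSelfAdjoint (cfcₙ (fun t => Real.sqrt (g t)) x)).star_eq,
      ← cfcₙ_mul _ _ _ hs.continuous.continuousOn hs.map_zero hs.continuous.continuousOn
        hs.map_zero]
    exact cfcₙ_congr fun t ht =>
      (Real.mul_self_sqrt (h t (quasispectrum_nonneg_of_nonneg x hx t ht))).symm
  rw [e]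
  exact rval_star_mul_self_nonneg τ (hs.mem x)

theorem rval_cfcₙ_mono {g h : ℝ → ℝ} (hg : IsCutoff g) (hh : IsCutoff h) {x : Stab A} (hx : 0 ≤ x)
    (hle : ∀ t, 0 ≤ t → g t ≤ h t) : τ.rval (cfcₙ g x) ≤ τ.rval (cfcₙ h x) := by
  have h1 := rval_cfcₙ_add τ hg (hh.sub hg) x
  have h2 := rval_cfcₙ_nonneg τ (hh.sub hg) hx fun t ht => sub_nonneg.2 (hle t ht)
  simp only [add_sub_cancel] at h1
  linarith

/-- A quasitrace takes the same values on cut-off functions of `z⋆z` and of `zz⋆`. -/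
theorem rval_cfcₙ_star_mul_self {g : ℝ → ℝ} (hg : IsCutoff g) (h : ∀ t, 0 ≤ g t) (z : Stab A) :
    τ.rval (cfcₙ g (star z * z)) = τ.rval (cfcₙ g (z * star z)) := by
  obtain ⟨κ, hκ, hv⟩ := hg.vanish
  -- `G = √(g/t)`, so that `t = z G(z⋆z)` satisfies `t⋆t = g(z⋆z)` and `tt⋆ = g(zz⋆)`
  let G : ℝ → ℝ := fun t => Real.sqrt (g t / max t κ)
  have hm : ∀ t, max t κ ≠ 0 := fun t => (hκ.trans_le (le_max_right t κ)).ne'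
  have hGc : Continuous G := by
    have := hg.continuous
    exact (this.div (by fun_prop) hm).sqrt
  have hGv : ∀ t ≤ κ, G t = 0 := fun t ht => by simp [G, hv t ht]
  have hG : IsCutoff G := ⟨hGc, κ, hκ, hGv⟩
  have hG0 := hG.map_zero
  have hGG : ∀ t, G t * G t = g t / max t κ := fun t =>
    Real.mul_self_sqrt (div_nonneg (h t) (hκ.le.trans (le_max_right _ _)))
  have hGGt : ∀ t, G t * G t * t = g t := fun t => by
    rw [hGG]
    rcases le_total t κ with ht | ht
    · rw [hv t ht]; simp
    · rw [max_eq_left ht, div_mul_cancel₀ _ (hκ.trans_le ht).ne']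
  set k := cfcₙ G (star z * z) with hk
  have hks : star k = k := (cfcₙ_predicate G _ : IsSelfAdjoint k).star_eq
  have ht : z * k ∈ pedersen (Stab A) := by
    have : star (z * k) ∈ pedersen (Stab A) := by
      refine mem_pedersen_of_mul_eq (e := cfcₙ (TAOZ.fEps (κ / 2)) (star z * z)) ?_
      have hf := IsCutoff.fEps (ε := κ / 2) (by positivity)
      rw [star_mul, hks, ← mul_assoc, hk, ← cfcₙ_mul _ _ _ hf.continuous.continuousOn
        hf.map_zero hGc.continuousOn hG0]
      congr 2
      funext t
      rcases le_total t κ with h' | h'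
      · rw [hGv t h', mul_zero]
      · rw [fEps_eq_one (by positivity) (by linarith), one_mul]
    simpa using star_mem this
  have e1 : star (z * k) * (z * k) = cfcₙ g (star z * z) := by
    rw [star_mul, hks]
    have : k * star z * (z * k) = k * (star z * z) * k := by noncomm_ring
    rw [this, hk]
    conv_lhs => enter [1, 2]; rw [← cfcₙ_id' ℝ (star z * z) (IsSelfAdjoint.star_mul_self z)]
    rw [← cfcₙ_mul G (fun t => t) _ hGc.continuousOn hG0 (by fun_prop) (by simp),
      ← cfcₙ_mul (fun t => G t * t) G _ (by fun_prop) (by simp) hGc.continuousOn hG0]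
    congr 1
    funext t
    rw [← hGGt t]; ring
  have e2 : z * k * star (z * k) = cfcₙ g (z * star z) := by
    rw [star_mul, hks]
    have h1 : z * k * (k * star z) = z * (k * k) * star z := by noncomm_ring
    rw [h1, hk, ← cfcₙ_mul _ _ _ hGc.continuousOn hG0 hGc.continuousOn hG0,
      ← cfcₙ_intertwine (.mul_star_self z) (.star_mul_self z) (by rw [mul_assoc]) _
        (show Continuous fun t => G t * G t by fun_prop) (by simp [hG0]), mul_assoc]
    conv_lhs => enter [2]; rw [← cfcₙ_id' ℝ (z * star z) (IsSelfAdjoint.mul_star_self z)]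
    rw [← cfcₙ_mul (fun t => G t * G t) (fun t => t) _ (by fun_prop) (by simp [hG0])
      (by fun_prop) (by simp)]
    congr 1
    funext t
    exact hGGt t
  rw [← e1, ← e2]
  exact rval_star_mul_self τ ht

/-- If `e = k²` acts as a unit on the positive contraction `p`, then `τ(p) ≤ τ(e)`. -/
theorem rval_le_of_unit {k p : Stab A} (hk : k ∈ pedersen (Stab A)) (hks : IsSelfAdjoint k)
    (hk0 : 0 ≤ k) (hp : 0 ≤ p) (hp1 : ‖p‖ ≤ 1) (h : k * k * p = p) :
    p ∈ pedersen (Stab A) ∧ τ.rval p ≤ τ.rval (k * k) := by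
  have hps : IsSelfAdjoint p := .of_nonneg hp
  have hpm : p ∈ pedersen (Stab A) := mem_pedersen_of_mul_eq h
  refine ⟨hpm, ?_⟩
  have hcomm : k * k * p = p * (k * k) := by
    have := congrArg star h
    rw [star_mul, star_mul, hks.star_eq, hps.star_eq] at this
    rw [h, this]
  have hkp : k * p = p * k := by
    have e : k = cfcₙ Real.sqrt (k * k) := by
      conv_lhs => rw [← cfcₙ_id' ℝ k]
      rw [show k * k = cfcₙ (fun t : ℝ => t * t) k by
        rw [cfcₙ_mul (fun t : ℝ => t) (fun t => t) k (by fun_prop) rfl (by fun_prop) rfl,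
          cfcₙ_id' ℝ k], ← cfcₙ_comp' Real.sqrt (fun t : ℝ => t * t) k (by fun_prop)]
      exact cfcₙ_congr fun t ht =>
        (Real.sqrt_mul_self (quasispectrum_nonneg_of_nonneg k hk0 t ht)).symm
    have : Commute (cfcₙ Real.sqrt (k * k)) p := Commute.cfcₙ_real hcomm _
    rw [← e] at this
    exact this
  -- `e - p = z⋆z` for `z = (1-p)^{1/2} k`
  let m : ℝ → ℝ := fun t => 1 - Real.sqrt (1 - t)
  have hm0 : m 0 = 0 := by simp [m]
  have hmc : Continuous m := by fun_prop
  set M := cfcₙ m p with hM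
  have hMs : star M = M := (cfcₙ_predicate m p : IsSelfAdjoint M).star_eq
  have hMM : M + M - M * M = p := by
    rw [hM, ← cfcₙ_mul _ _ _ hmc.continuousOn hm0 hmc.continuousOn hm0,
      ← cfcₙ_add _ _ _ hmc.continuousOn hm0 hmc.continuousOn hm0,
      ← cfcₙ_sub _ _ _ (by fun_prop) (by simp [hm0]) (by fun_prop) (by simp [hm0])]
    conv_rhs => rw [← cfcₙ_id' ℝ p]
    refine cfcₙ_congr fun t ht => ?_
    have h1 : t ≤ 1 := by
      have := NonUnitalIsometricContinuousFunctionalCalculus.norm_quasispectrum_le p ht hps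
      rw [Real.norm_eq_abs] at this
      exact (le_abs_self t).trans (this.trans hp1)
    have := Real.mul_self_sqrt (sub_nonneg.2 h1)
    simp only [m]
    linarith
  have hz : k - M * k ∈ pedersen (Stab A) := by
    have h1 : star (k - M * k) ∈ pedersen (Stab A) := by
      intro I hI hd
      rw [star_sub, star_mul, hks.star_eq, hMs]
      have := hk I hI hd
      exact I.sub_mem this (hI k this M).2
    simpa using star_mem h1
  have e : star (k - M * k) * (k - M * k) = k * k - p := by
    rw [star_sub, star_mul, hks.star_eq, hMs]
    have : (k - k * M) * (k - M * k) = k * k - k * (M + M - M * M) * k := by noncomm_ring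
    rw [this, hMM, mul_assoc, ← hkp, ← mul_assoc, h]
  have h2 := rval_star_mul_self_nonneg τ hz
  rw [e] at h2
  have hkk : k * k ∈ pedersen (Stab A) := mul_mem hk hk
  have hkks : IsSelfAdjoint (k * k) := by
    change star (k * k) = k * k
    rw [star_mul, hks.star_eq]
  have h3 := rval_add τ (x := k * k - p) (y := p) (sub_mem hkk hpm) hpm (hkks.sub hps) hps
    (by rw [sub_mul, mul_sub, hcomm])
  rw [sub_add_cancel] at h3
  linarith

/-! ### The dimension function -/

theorem dim_eq (x : Stab A) :
    τ.dim x = ⨆ n : ℕ, ENNReal.ofReal (τ.rval (cfcₙ (fEps (1 / ((n : ℝ) + 1))) x)) := by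
  unfold dim
  congr 1
  funext n
  rw [val_eq]
  rfl

theorem rval_fEps_mono {δ ε : ℝ} (hδ : 0 < δ) (h : δ ≤ ε) {x : Stab A} (hx : 0 ≤ x) :
    τ.rval (cfcₙ (fEps ε) x) ≤ τ.rval (cfcₙ (fEps δ) x) :=
  rval_cfcₙ_mono τ (.fEps (hδ.trans_le h)) (.fEps hδ) hx fun t _ => fEps_anti hδ h t

/-- `τ(F(x)) ≤ d_τ(x)` for cut-off functions `F ≤ 1`. -/
theorem rval_le_dim {F : ℝ → ℝ} (hF : IsCutoff F) (h1 : ∀ t, 0 ≤ t → F t ≤ 1) {x : Stab A}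
    (hx : 0 ≤ x) : ENNReal.ofReal (τ.rval (cfcₙ F x)) ≤ τ.dim x := by
  obtain ⟨κ, hκ, hv⟩ := hF.vanish
  obtain ⟨n, hn⟩ := exists_nat_one_div_lt (show 0 < κ / 2 by positivity)
  rw [dim_eq]
  refine le_trans ?_ (le_iSup _ n)
  refine ENNReal.ofReal_le_ofReal (rval_cfcₙ_mono τ hF (.fEps Nat.one_div_pos_of_nat) hx ?_)
  intro t ht
  rcases le_total t κ with h | h
  · rw [hv t h]; exact fEps_nonneg _ _
  · rw [fEps_eq_one Nat.one_div_pos_of_nat (by linarith)]; exact h1 t ht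

/-- `d_τ(G(x)) ≤ τ(F(x))` for cut-off functions `F` that are at least `1` where `G` is positive. -/
theorem dim_cfcₙ_le {F G : ℝ → ℝ} (hF : IsCutoff F) (h0 : ∀ t, 0 ≤ t → 0 ≤ F t)
    (hG : Continuous G) (hG0 : G 0 = 0) (h1 : ∀ t, 0 ≤ t → 0 < G t → 1 ≤ F t) {x : Stab A}
    (hx : 0 ≤ x) : τ.dim (cfcₙ G x) ≤ ENNReal.ofReal (τ.rval (cfcₙ F x)) := by
  rw [dim_eq]
  refine iSup_le fun n => ENNReal.ofReal_le_ofReal ?_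
  obtain ⟨κ, hκ, hv⟩ := hF.vanish
  have hn : 0 < 1 / ((n : ℝ) + 1) := Nat.one_div_pos_of_nat
  rw [← cfcₙ_comp' _ _ x (fEps_continuous _).continuousOn (fEps_zero hn) hG.continuousOn hG0]
  -- on `[0, κ]` the function `G` is nonpositive, because `F` vanishes there
  let H : ℝ → ℝ := fun t => fEps (1 / ((n : ℝ) + 1)) (G (max t 0))
  have hH : IsCutoff H := by
    refine ⟨(fEps_continuous _).comp (hG.comp (by fun_prop)), κ, hκ, fun t ht => ?_⟩
    refine fEps_eq_zero hn ?_
    by_contra hc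
    push Not at hc
    have := h1 (max t 0) (le_max_right _ _) (hn.trans hc)
    rw [hv _ (max_le ht hκ.le)] at this
    linarith
  have e : cfcₙ (fun t => fEps (1 / ((n : ℝ) + 1)) (G t)) x = cfcₙ H x :=
    cfcₙ_congr fun t ht => by
      simp only [H, max_eq_left (quasispectrum_nonneg_of_nonneg x hx t ht)]
  rw [e]
  refine rval_cfcₙ_mono τ hH hF hx fun t ht => ?_
  simp only [H, max_eq_left ht]
  rcases le_or_gt (G t) 0 with h | h
  · rw [fEps_eq_zero hn (h.trans hn.le)]; exact h0 t ht
  · exact (fEps_le_one _ _).trans (h1 t ht h)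

theorem dim_cfcₙ_le_dim {G : ℝ → ℝ} (hG : Continuous G) (hG0 : G 0 = 0) {x : Stab A}
    (hx : 0 ≤ x) : τ.dim (cfcₙ G x) ≤ τ.dim x := by
  rw [dim_eq]
  refine iSup_le fun n => ?_
  have hn : 0 < 1 / ((n : ℝ) + 1) := Nat.one_div_pos_of_nat
  rw [← cfcₙ_comp' _ _ x (fEps_continuous _).continuousOn (fEps_zero hn) hG.continuousOn hG0]
  let H : ℝ → ℝ := fun t => fEps (1 / ((n : ℝ) + 1)) (G (max t 0))
  have hH : IsCutoff H := by
    obtain ⟨κ, hκ, hv⟩ := Metric.continuousAt_iff.1 (hG.continuousAt (x := 0)) _ hn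
    refine ⟨(fEps_continuous _).comp (hG.comp (by fun_prop)), κ / 2, by positivity,
      fun t ht => fEps_eq_zero hn ?_⟩
    have h2 : dist (max t 0) 0 < κ := by
      rw [Real.dist_eq, sub_zero, abs_of_nonneg (le_max_right _ _)]
      exact max_lt (by linarith) hκ
    have := hv h2
    rw [hG0, Real.dist_eq, sub_zero] at this
    exact (le_abs_self _).trans this.le
  have e : cfcₙ (fun t => fEps (1 / ((n : ℝ) + 1)) (G t)) x = cfcₙ H x :=
    cfcₙ_congr fun t ht => by
      simp only [H, max_eq_left (quasispectrum_nonneg_of_nonneg x hx t ht)]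
  rw [e]
  exact rval_le_dim τ hH (fun t _ => fEps_le_one _ _) hx

theorem dim_cut_le (ε : ℝ) (hε : 0 ≤ ε) {x : Stab A} (hx : 0 ≤ x) : τ.dim (cut ε x) ≤ τ.dim x :=
  dim_cfcₙ_le_dim τ (by fun_prop) (by simp [hε]) hx

/-- `d_τ` is determined by its values on the elements `(x - ε)₊`. -/
theorem dim_le_of_cut {x : Stab A} (hx : 0 ≤ x) {c : ℝ≥0∞}
    (h : ∀ ε > 0, τ.dim (cut ε x) ≤ c) : τ.dim x ≤ c := by
  rw [dim_eq]
  refine iSup_le fun n => ?_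
  have hn : 0 < 1 / ((n : ℝ) + 1) := Nat.one_div_pos_of_nat
  set ε := 1 / ((n : ℝ) + 1)
  refine le_trans ?_ (h (ε / 2) (by positivity))
  -- `f_ε(x) = F((x - ε/2)₊)` with `F(s) = f_ε(s + ε/2)`
  let F : ℝ → ℝ := fun s => fEps ε (s + ε / 2)
  have hF : IsCutoff F := by
    have := fEps_continuous ε
    exact ⟨by fun_prop, ε / 2, by positivity, fun t ht => fEps_eq_zero hn (by linarith)⟩
  have e : cfcₙ (fEps ε) x = cfcₙ F (cut (ε / 2) x) := by
    unfold cut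
    rw [← cfcₙ_comp' F (fun t : ℝ => max (t - ε / 2) 0) x hF.continuous.continuousOn hF.map_zero
      (by fun_prop) (max_eq_right (by linarith))]
    congr 1
    funext t
    simp only [F]
    rcases le_total t (ε / 2) with ht | ht
    · rw [max_eq_right (by linarith), fEps_eq_zero hn (by linarith),
        fEps_eq_zero hn (by linarith)]
    · rw [max_eq_left (by linarith), sub_add_cancel]
  rw [e]
  exact rval_le_dim τ hF (fun t _ => fEps_le_one _ _) (cut_nonneg _ _)

theorem dim_star_mul_self (z : Stab A) : τ.dim (star z * z) = τ.dim (z * star z) := by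
  rw [dim_eq, dim_eq]
  congr 1
  funext n
  rw [rval_cfcₙ_star_mul_self τ (.fEps Nat.one_div_pos_of_nat) (fun t => fEps_nonneg _ t)]

theorem norm_cfcₙ_fEps_le_one (ε : ℝ) (x : Stab A) : ‖cfcₙ (fEps ε) x‖ ≤ 1 :=
  norm_cfcₙ_le fun t _ => by
    rw [Real.norm_eq_abs, abs_of_nonneg (fEps_nonneg _ _)]; exact fEps_le_one _ _

/-- A positive element below `r⋆r`, where `r` has a unit of the form `f_δ(q)`, has dimension at most
that of `q`. -/
theorem dim_le_of_le_star_mul {R r q : Stab A} (hR : 0 ≤ R) (hq : 0 ≤ q) {δ : ℝ} (hδ : 0 < δ)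
    (h : R ≤ star r * r) (hr : cfcₙ (fEps δ) q * r = r) : τ.dim R ≤ τ.dim q := by
  obtain ⟨z, hz, rfl⟩ := exists_eq_star_mul_self_of_le hR h
  have hEz : cfcₙ (fEps δ) q * z = z := mul_eq_of_mem_rid hr hz
  rw [dim_star_mul_self, dim_eq]
  refine iSup_le fun n => ?_
  have hn : 0 < 1 / ((n : ℝ) + 1) := Nat.one_div_pos_of_nat
  let S : ℝ → ℝ := fun t => Real.sqrt (fEps δ t)
  have hS : IsCutoff S := (IsCutoff.fEps hδ).comp_left Real.continuous_sqrt Real.sqrt_zero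
  have hkk : cfcₙ S q * cfcₙ S q = cfcₙ (fEps δ) q := by
    rw [← cfcₙ_mul _ _ _ hS.continuous.continuousOn hS.map_zero hS.continuous.continuousOn
      hS.map_zero]
    congr 1
    funext t
    exact Real.mul_self_sqrt (fEps_nonneg _ _)
  have hmem : cfcₙ (fEps (1 / ((n : ℝ) + 1))) (z * star z) ∈ rid (z * star z) := by
    -- `f_ε(y) = y · (f_ε(y)/y)`
    set ε := 1 / ((n : ℝ) + 1)
    let g : ℝ → ℝ := fun t => fEps ε t / max t ε
    have hm : ∀ t, max t ε ≠ 0 := fun t => (hn.trans_le (le_max_right t ε)).ne'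
    have hgc : Continuous g := (fEps_continuous ε).div (by fun_prop) hm
    have : cfcₙ (fEps ε) (z * star z) = z * star z * cfcₙ g (z * star z) := by
      conv_rhs => enter [1]; rw [← cfcₙ_id' ℝ (z * star z) (IsSelfAdjoint.mul_star_self z)]
      rw [← cfcₙ_mul (fun t => t) g _ (by fun_prop) rfl hgc.continuousOn
        (by simp [g, fEps_zero hn])]
      congr 1
      funext t
      simp only [g]
      rcases le_total t ε with ht | ht
      · rw [fEps_eq_zero hn ht]; simp
      · rw [max_eq_left ht, mul_div_cancel₀ _ (hn.trans_le ht).ne']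
    rw [this]
    exact mul_mem_rid_self _ _
  have h2 := rval_le_of_unit τ (hS.mem q) (cfcₙ_predicate S q)
    (cfcₙ_nonneg fun t _ => Real.sqrt_nonneg _)
    (cfcₙ_fEps_nonneg (1 / ((n : ℝ) + 1)) (z * star z)) (norm_cfcₙ_fEps_le_one _ _)
    (by
      rw [hkk]
      exact mul_eq_of_mem_rid (by rw [← mul_assoc, hEz]) hmem)
  refine (ENNReal.ofReal_le_ofReal h2.2).trans ?_
  rw [hkk]
  exact rval_le_dim τ (.fEps hδ) (fun t _ => fEps_le_one _ _) hq

theorem dim_mono {p q : Stab A} (hp : 0 ≤ p) (hpq : p ≤ q) : τ.dim p ≤ τ.dim q := by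
  have hq : 0 ≤ q := hp.trans hpq
  refine dim_le_of_cut τ hp fun ε hε => ?_
  obtain ⟨w, hws, hw0, hw⟩ := exists_sqrt hp
  -- `f_δ(q) p f_δ(q)` is close to `p` for small `δ`
  have hlim : Tendsto (fun n : ℕ => w * cfcₙ (fEps (1 / ((n : ℝ) + 1))) q) atTop (𝓝 w) := by
    rw [tendsto_iff_norm_sub_tendsto_zero]
    have key : ∀ n : ℕ, ‖w - w * cfcₙ (fEps (1 / ((n : ℝ) + 1))) q‖ ^ 2
        ≤ 4 * (1 / ((n : ℝ) + 1)) := by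
      intro n
      have hn : 0 < 1 / ((n : ℝ) + 1) := Nat.one_div_pos_of_nat
      refine norm_sub_mul_cfcₙ_sq_le hq (by rw [hws.star_eq, hw]; exact hpq) _
        (fEps_continuous _) (fEps_zero hn) fun t ht => ?_
      set ε := 1 / ((n : ℝ) + 1)
      rw [abs_of_nonneg (by positivity)]
      rcases le_total t (2 * ε) with h | h
      · have h1 := fEps_nonneg ε t
        have h2 := fEps_le_one ε t
        have : (1 - fEps ε t) ^ 2 ≤ 1 := by nlinarith
        nlinarith [sq_nonneg (1 - fEps ε t)]
      · rw [fEps_eq_one hn h]; simp [hn.le]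
    have h2 := squeeze_zero (fun n => by positivity) key one_div_nat_tendsto
    have h3 := h2.sqrt
    simp only [Real.sqrt_zero, norm_nonneg, Real.sqrt_sq] at h3
    exact h3.congr fun n => by rw [norm_sub_rev]
  have hlim2 : Tendsto (fun n : ℕ => star (w * cfcₙ (fEps (1 / ((n : ℝ) + 1))) q)
      * (w * cfcₙ (fEps (1 / ((n : ℝ) + 1))) q)) atTop (𝓝 p) := by
    have := hlim.star.mul hlim
    rwa [hws.star_eq, hw] at this
  obtain ⟨N, hN⟩ := Metric.tendsto_atTop.1 hlim2 ε hε
  have hN' := hN N le_rfl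
  have hn : 0 < 1 / ((N : ℝ) + 1) := Nat.one_div_pos_of_nat
  set δ := 1 / ((N : ℝ) + 1)
  set f := cfcₙ (fEps δ) q with hf
  rw [dist_comm, dist_eq_norm] at hN'
  obtain ⟨g, hgs, hg⟩ := exists_cut_le_conj hp (star_mul_self_nonneg _) hN'
  obtain ⟨y, hys, hy0, hy⟩ := exists_sqrt (star_mul_self_nonneg (w * f))
  have hfs : star f = f := (cfcₙ_predicate _ q : IsSelfAdjoint f).star_eq
  refine dim_le_of_le_star_mul τ (r := y * g) (cut_nonneg _ _) hq (δ := δ / 2) (by positivity) ?_ ?_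
  · rw [star_mul, hys.star_eq, hgs.star_eq]
    calc _ ≤ _ := hg
      _ = g * y * (y * g) := by rw [← hy]; noncomm_ring
  · have hEf : cfcₙ (fEps (δ / 2)) q * f = f := by
      rw [hf, ← cfcₙ_mul _ _ _ (fEps_continuous _).continuousOn (fEps_zero (by positivity))
        (fEps_continuous _).continuousOn (fEps_zero hn)]
      congr 1
      funext t
      rcases le_total t δ with ht | ht
      · rw [fEps_eq_zero hn ht, mul_zero]
      · rw [fEps_eq_one (by positivity) (by linarith), one_mul]
    set E := cfcₙ (fEps (δ / 2)) q
    have hEs : star E = E := (cfcₙ_predicate _ q : IsSelfAdjoint E).star_eq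
    have hEyy : E * (y * y) = y * y := by
      rw [hy, star_mul, hfs, mul_assoc, ← mul_assoc E, hEf]
    have hEy : E * y = y := by
      rw [← sub_eq_zero, ← norm_eq_zero, ← mul_self_eq_zero, ← CStarRing.norm_self_mul_star]
      have : (E * y - y) * star (E * y - y) = (E * (y * y) - y * y) * (E - 0) -
          (E * (y * y) - y * y) := by
        rw [star_sub, star_mul, hys.star_eq, hEs, sub_zero]; noncomm_ring
      rw [this, hEyy]; simp
    rw [← mul_assoc, hEy]

theorem dim_smul_le {c : ℝ} (x : Stab A) (hx : 0 ≤ x) : τ.dim (c • x) ≤ τ.dim x := by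
  have e : c • x = cfcₙ (fun t => c * t) x := (cfcₙ_const_mul_id c x).symm
  rw [e]
  exact dim_cfcₙ_le_dim τ (by fun_prop) (mul_zero c) hx

theorem dim_conj_le (x : Stab A) {q : Stab A} (hq : 0 ≤ q) :
    τ.dim (star x * q * x) ≤ τ.dim q := by
  obtain ⟨w, hws, -, rfl⟩ := exists_sqrt hq
  have e : star x * (w * w) * x = star (w * x) * (w * x) := by
    rw [star_mul, hws.star_eq]; noncomm_ring
  rw [e, dim_star_mul_self]
  have h1 : w * x * star (w * x) ≤ ‖x * star x‖ • (w * w) := by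
    have := CStarAlgebra.star_left_conjugate_le_norm_smul (a := w) (b := x * star x)
      (.mul_star_self x)
    rw [hws.star_eq] at this
    rw [star_mul, hws.star_eq]
    calc _ = w * (x * star x) * w := by noncomm_ring
      _ ≤ _ := this
  exact (dim_mono τ (mul_star_self_nonneg _) h1).trans (dim_smul_le τ _ hq)

theorem dim_cut_le_of_norm_sub_lt {p q : Stab A} (hp : 0 ≤ p) (hq : 0 ≤ q) {ε : ℝ}
    (h : ‖p - q‖ < ε) : τ.dim (cut ε p) ≤ τ.dim q := by
  obtain ⟨g, hgs, hg⟩ := exists_cut_le_conj hp hq h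
  refine (dim_mono τ (cut_nonneg _ _) hg).trans ?_
  have := dim_conj_le τ g hq
  rwa [hgs.star_eq] at this

theorem dim_zero : τ.dim 0 = 0 := by
  rw [dim_eq]
  simp only [cfcₙ_apply_zero, rval_zero, ENNReal.ofReal_zero, iSup_const]

/-- Orthogonal sums. -/
theorem dim_add_of_mul_eq_zero {p q : Stab A} (hp : 0 ≤ p) (hq : 0 ≤ q) (h : p * q = 0) :
    τ.dim (p + q) = τ.dim p + τ.dim q := by
  have hmono : ∀ x : Stab A, 0 ≤ x → Monotone fun n : ℕ =>
      ENNReal.ofReal (τ.rval (cfcₙ (fEps (1 / ((n : ℝ) + 1))) x)) := fun x hx m n hmn =>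
    ENNReal.ofReal_le_ofReal (rval_fEps_mono τ Nat.one_div_pos_of_nat
      (Nat.one_div_le_one_div hmn) hx)
  rw [dim_eq, dim_eq, dim_eq, ENNReal.iSup_add_iSup_of_monotone (hmono p hp) (hmono q hq)]
  congr 1
  funext n
  have hf := IsCutoff.fEps (ε := 1 / ((n : ℝ) + 1)) Nat.one_div_pos_of_nat
  rw [cfcₙ_add_of_mul_eq_zero hp hq h _ hf.continuous hf.map_zero,
    rval_add τ (hf.mem p) (hf.mem q) (cfcₙ_predicate _ _) (cfcₙ_predicate _ _),
    ENNReal.ofReal_add (rval_cfcₙ_nonneg τ hf hp fun t _ => fEps_nonneg _ _)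
      (rval_cfcₙ_nonneg τ hf hq fun t _ => fEps_nonneg _ _)]
  have h1 : cfcₙ (fEps (1 / ((n : ℝ) + 1))) p * q = 0 :=
    cfcₙ_mul_eq_zero (.of_nonneg hp) h _ hf.continuous hf.map_zero
  have h2 := mul_cfcₙ_eq_zero (.of_nonneg hq) h1 _ hf.continuous hf.map_zero
  have h3 := congrArg star h2
  rw [star_mul, star_zero, (cfcₙ_predicate _ p : IsSelfAdjoint _).star_eq,
    (cfcₙ_predicate _ q : IsSelfAdjoint _).star_eq] at h3
  rw [h2, h3]

theorem add_star_mul_add_le (a b : Stab A) :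
    (a + b) * star (a + b) ≤ (2 : ℝ) • (a * star a + b * star b) := by
  rw [← sub_nonneg]
  have : (2 : ℝ) • (a * star a + b * star b) - (a + b) * star (a + b)
      = (a - b) * star (a - b) := by
    rw [two_smul, star_add, star_sub]; noncomm_ring
  rw [this]
  exact mul_star_self_nonneg _

/-- Subadditivity: `p + q = r⋆r` for `r = s₀ p^{1/2} + s₁ q^{1/2}` with isometries `s₀`, `s₁` of
orthogonal ranges, and `rr⋆` is dominated by twice an orthogonal sum. -/
theorem dim_add_le {p q : Stab A} (hp : 0 ≤ p) (hq : 0 ≤ q) :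
    τ.dim (p + q) ≤ τ.dim p + τ.dim q := by
  obtain ⟨v, hvs, -, rfl⟩ := exists_sqrt hp
  obtain ⟨w, hws, -, rfl⟩ := exists_sqrt hq
  set a := Stab.shift 0 v
  set b := Stab.shift 1 w
  have haa : star a * a = v * v := by
    simp only [a, Stab.star_shift_mul_shift, if_true, hvs.star_eq]
  have hbb : star b * b = w * w := by
    simp only [b, Stab.star_shift_mul_shift, if_true, hws.star_eq]
  have hab : star a * b = 0 := by
    simp [a, b, Stab.star_shift_mul_shift]
  have hba : star b * a = 0 := by
    simp [a, b, Stab.star_shift_mul_shift]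
  have e : v * v + w * w = star (a + b) * (a + b) := by
    rw [star_add, add_mul, mul_add, mul_add, haa, hbb, hab, hba]; abel
  rw [e, dim_star_mul_self]
  refine (dim_mono τ (mul_star_self_nonneg _) (add_star_mul_add_le a b)).trans ?_
  have ha := mul_star_self_nonneg a
  have hb := mul_star_self_nonneg b
  refine (dim_smul_le τ _ (add_nonneg ha hb)).trans ?_
  rw [dim_add_of_mul_eq_zero τ ha hb (by
    rw [mul_assoc, ← mul_assoc (star a), hab, zero_mul, mul_zero]), ← dim_star_mul_self,
    ← dim_star_mul_self, haa, hbb]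

end DenseQT

end QuasitraceBasics

/-! ### Domination of the Pedersen ideal, compactness and faithfulness -/

section Domination

section
variable {P Q : Type u} [NonUnitalRing P] [StarRing P] [Module ℂ P]
  [NonUnitalRing Q] [StarRing Q] [Module ℂ Q]

theorem IsQuasitrace.comp {τ : Q → ℂ} (hτ : IsQuasitrace τ) (φ : P →⋆ₙₐ[ℂ] Q) :
    IsQuasitrace fun x => τ (φ x) where
  nonneg x := by
    rw [map_mul, map_star]; exact hτ.nonneg _
  trace x := by
    rw [map_mul, map_star, map_mul, map_star]; exact hτ.trace _
  linear C hC := by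
    obtain ⟨h1, h2⟩ := hτ.linear (C.map φ) (by
      rintro _ ⟨x, hx, rfl⟩ _ ⟨y, hy, rfl⟩
      change φ x * φ y = φ y * φ x
      rw [← map_mul, hC x hx y hy, map_mul])
    refine ⟨fun x hx y hy => ?_, fun c x hx => ?_⟩
    · rw [map_add]; exact h1 _ ⟨x, hx, rfl⟩ _ ⟨y, hy, rfl⟩
    · rw [map_smul]; exact h2 c _ ⟨x, hx, rfl⟩
  decomp a b ha hb := by
    rw [map_add, map_smul]
    exact hτ.decomp _ _ (ha.map φ) (hb.map φ)

end

section
variable {D : Type u} [NonUnitalCStarAlgebra D] [PartialOrder D] [StarOrderedRing D]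

theorem exists_cfcₙ_fEps_ne_zero {a : D} (ha : 0 ≤ a) (h : a ≠ 0) :
    ∃ ε₀ > 0, ∀ ε, 0 < ε → ε ≤ ε₀ → cfcₙ (fEps ε) a ≠ 0 := by
  obtain ⟨t, ht, ht0⟩ : ∃ t ∈ quasispectrum ℝ a, t ≠ 0 := by
    by_contra! hc
    apply h
    rw [← cfcₙ_id' ℝ a, ← cfcₙ_zero ℝ a]
    exact cfcₙ_congr fun t ht => by simp [hc t ht]
  have htpos : 0 < t := lt_of_le_of_ne (quasispectrum_nonneg_of_nonneg a ha t ht) (Ne.symm ht0)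
  refine ⟨t / 2, by positivity, fun ε hε hle h0 => ?_⟩
  have := norm_apply_le_norm_cfcₙ (fEps ε) a ht (fEps_continuous ε).continuousOn (fEps_zero hε)
  rw [h0, fEps_eq_one hε (by linarith)] at this
  norm_num at this

theorem self_mem_rid_mul_self {q : D} (hq : 0 ≤ q) : q ∈ rid (q * q) := by
  have hqs : IsSelfAdjoint q := .of_nonneg hq
  have h := tendsto_star_polarSeq_mul (r := q) (w := q) le_rfl
  rw [hqs.star_eq] at h
  refine isClosed_closure.mem_of_tendsto h (Eventually.of_forall fun n => ?_)
  have hc : Commute (q * q) q := (Commute.refl q).mul_left (Commute.refl q)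
  have hc' : cfcₙ (polarFun n) (q * q) * q = q * cfcₙ (polarFun n) (q * q) :=
    Commute.cfcₙ_real hc _
  have e : star (polarSeq q n) * polarSeq q n * q
      = q * q * (cfcₙ (polarFun n) (q * q) * cfcₙ (polarFun n) (q * q) * q) := by
    rw [star_polarSeq, hqs.star_eq, polarSeq, hqs.star_eq]
    have : q * cfcₙ (polarFun n) (q * q) * (q * cfcₙ (polarFun n) (q * q)) * q
      = q * (cfcₙ (polarFun n) (q * q) * q) * cfcₙ (polarFun n) (q * q) * q := by noncomm_ring
    rw [this, hc']; noncomm_ring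
  rw [e]
  exact subset_closure ⟨_, rfl⟩

theorem smul_star_mul_self_le (a x : D) :
    star (a * x) * (a * x) ≤ star ((‖a‖ : ℂ) • x) * ((‖a‖ : ℂ) • x) := by
  have h := CStarAlgebra.star_left_conjugate_le_norm_smul (a := x) (b := star a * a)
    (.star_mul_self a)
  rw [CStarRing.norm_star_mul_self] at h
  calc star (a * x) * (a * x) = star x * (star a * a) * x := by rw [star_mul]; noncomm_ring
    _ ≤ _ := h
    _ = _ := by
      rw [star_smul, smul_mul_smul_comm, Complex.star_def, Complex.conj_ofReal,
        ← Complex.ofReal_mul]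
      exact (Complex.coe_smul _ _).symm

theorem star_add_mul_add_le (a b : D) :
    star (a + b) * (a + b) ≤ (2 : ℝ) • (star a * a + star b * b) := by
  rw [← sub_nonneg]
  have : (2 : ℝ) • (star a * a + star b * b) - star (a + b) * (a + b)
      = star (a - b) * (a - b) := by
    rw [two_smul, star_add, star_sub]; noncomm_ring
  rw [this]
  exact star_mul_self_nonneg _

end

variable {A : Type u} [NonUnitalCStarAlgebra A] [PartialOrder A] [StarOrderedRing A]

namespace Stab

/-- The elements `s_i x s_j⋆`, where `s_0, s_1, …` are isometries with orthogonal ranges. -/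
def conj (i j : ℕ) (x : Stab A) : Stab A := row (shiftEquiv i) (col (shiftEquiv j) x)

theorem conj_add (i j : ℕ) (x y : Stab A) : conj i j (x + y) = conj i j x + conj i j y := by
  simp only [conj, col, star_add, row_add]

theorem conj_smul (i j : ℕ) (c : ℂ) (x : Stab A) : conj i j (c • x) = c • conj i j x := by
  simp only [conj, col, star_smul, row_smul, star_star]

theorem conj_zero (i j : ℕ) : conj i j (0 : Stab A) = 0 := by
  simp only [conj, col, star_zero, row_zero]

theorem star_conj (i j : ℕ) (x : Stab A) : star (conj i j x) = conj j i (star x) := by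
  unfold conj
  rw [row_col]
  simp only [col, star_star]

theorem conj_mul_conj (i j k l : ℕ) (x y : Stab A) :
    conj i j x * conj k l y = if j = k then conj i l (x * y) else 0 := by
  have h := shift_symm_shift j k (col (shiftEquiv l) y)
  unfold shift at h
  unfold conj
  rw [← row_mul, col_mul, h]
  split_ifs
  · rw [mul_col]
  · rw [mul_zero, row_zero]

theorem conj_mem_pedersen (i j : ℕ) {x : Stab A} (hx : x ∈ pedersen (Stab A)) :
    conj i j x ∈ pedersen (Stab A) := row_mem_pedersen _ (col_mem_pedersen _ hx)

end Stab

/-- The elements `x` of `A ⊗ 𝕂` with `x⋆x ≤ r⋆r` for some `r` on which a positive element `E` acts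
as a left unit, where `d_τ(E)` is finite and controlled by the norm of `τ` on `A`. -/
def IsDominated (x : Stab A) : Prop :=
  ∃ r E : Stab A, ∃ C : ℝ≥0, 0 ≤ E ∧ E * r = r ∧
    (∀ τ : DenseQT A, τ.dim E ≤ C * τ.normOn ∧ τ.dim E ≠ ⊤) ∧ star x * x ≤ star r * r

namespace DenseQT

variable (τ : DenseQT A)

theorem ofReal_rval_corner_le {a : A} (ha : a ∈ pedersen A) (h0 : 0 ≤ a) (h1 : ‖a‖ ≤ 1) :
    ENNReal.ofReal (τ.rval (corner A a)) ≤ τ.normOn := by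
  unfold normOn
  refine le_trans (le_of_eq ?_) (le_iSup (fun a : {a : pedersen A // 0 ≤ (a : A) ∧ ‖(a : A)‖ ≤ 1} =>
    τ.val ⟨corner A (a.1 : A), corner_mem_pedersen a.1.2⟩) ⟨⟨a, ha⟩, h0, h1⟩)
  rw [val_eq]

theorem dim_corner_le {e : A} (he : 0 ≤ e) : τ.dim (corner A e) ≤ τ.normOn := by
  rw [dim_eq]
  refine iSup_le fun n => ?_
  have hn : 0 < 1 / ((n : ℝ) + 1) := Nat.one_div_pos_of_nat
  rw [← NonUnitalStarAlgHom.map_cfcₙ (corner A) (fEps (1 / ((n : ℝ) + 1))) e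
    (fEps_continuous _).continuousOn (fEps_zero hn)
    (AddMonoidHomClass.isometry_of_norm (corner A) (corner_norm A)).continuous
    (.of_nonneg he) ((IsSelfAdjoint.of_nonneg he).map _)]
  refine ofReal_rval_corner_le τ ((IsCutoff.fEps hn).mem e) (cfcₙ_fEps_nonneg _ _) ?_
  refine norm_cfcₙ_le fun t _ => ?_
  rw [Real.norm_of_nonneg (fEps_nonneg _ _)]
  exact fEps_le_one _ _

theorem dim_corner_cfcₙ_fEps_ne_top {a : A} (ha : 0 ≤ a) {ε : ℝ} (hε : 0 < ε) :
    τ.dim (corner A (cfcₙ (fEps ε) a)) ≠ ⊤ := by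
  have hε2 : 0 < ε / 2 := by positivity
  rw [NonUnitalStarAlgHom.map_cfcₙ (corner A) (fEps ε) a
    (fEps_continuous _).continuousOn (fEps_zero hε)
    (AddMonoidHomClass.isometry_of_norm (corner A) (corner_norm A)).continuous
    (.of_nonneg ha) ((IsSelfAdjoint.of_nonneg ha).map _)]
  refine ((τ.dim_cfcₙ_le (.fEps hε2) (fun t _ => fEps_nonneg _ _) (fEps_continuous ε)
    (fEps_zero hε) (fun t _ h => (fEps_eq_one hε2 ?_).ge)
    (map_nonneg (corner A) ha)).trans_lt ENNReal.ofReal_lt_top).ne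
  by_contra hc
  rw [fEps_eq_zero hε (by linarith)] at h
  exact lt_irrefl _ h

end DenseQT

namespace IsDominated

theorem mul_left {x : Stab A} (hx : IsDominated x) (a : Stab A) : IsDominated (a * x) := by
  obtain ⟨r, E, C, hE, hEr, hC, h⟩ := hx
  refine ⟨(‖a‖ : ℂ) • r, E, C, hE, by rw [mul_smul_comm, hEr], hC,
    (smul_star_mul_self_le a x).trans ?_⟩
  simp only [star_smul, smul_mul_smul_comm, Complex.star_def, Complex.conj_ofReal,
    ← Complex.ofReal_mul]
  change ((‖a‖ * ‖a‖ : ℝ) : ℂ) • _ ≤ ((‖a‖ * ‖a‖ : ℝ) : ℂ) • _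
  rw [Complex.coe_smul, Complex.coe_smul]
  exact smul_le_smul_of_nonneg_left h (by positivity)

theorem mul_right {x : Stab A} (hx : IsDominated x) (a : Stab A) : IsDominated (x * a) := by
  obtain ⟨r, E, C, hE, hEr, hC, h⟩ := hx
  refine ⟨r * a, E, C, hE, by rw [← mul_assoc, hEr], hC, ?_⟩
  have := star_left_conjugate_le_conjugate h a
  simpa only [star_mul, mul_assoc] using this

theorem smul {x : Stab A} (hx : IsDominated x) (c : ℂ) : IsDominated (c • x) := by
  obtain ⟨r, E, C, hE, hEr, hC, h⟩ := hx
  refine ⟨c • r, E, C, hE, by rw [mul_smul_comm, hEr], hC, ?_⟩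
  have e : star c * c = ((‖c‖ ^ 2 : ℝ) : ℂ) := by
    rw [Complex.star_def, mul_comm, Complex.mul_conj, Complex.normSq_eq_norm_sq]
  rw [star_smul, star_smul, smul_mul_smul_comm, smul_mul_smul_comm, e, Complex.coe_smul,
    Complex.coe_smul]
  exact smul_le_smul_of_nonneg_left h (by positivity)

theorem zero : IsDominated (0 : Stab A) :=
  ⟨0, 0, 0, le_rfl, mul_zero _, fun τ => by rw [τ.dim_zero]; exact ⟨zero_le, ENNReal.zero_ne_top⟩, by simp⟩

/-- With isometries `s_0, s_1` with orthogonal ranges, `r = √2 (s_0 r_1 + s_1 r_2)` satisfies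
`r⋆r = 2 (r_1⋆r_1 + r_2⋆r_2)`. -/
theorem add {x y : Stab A} (hx : IsDominated x) (hy : IsDominated y) : IsDominated (x + y) := by
  obtain ⟨r₀, E₀, C₀, hE₀, hEr₀, hC₀, h₀⟩ := hx
  obtain ⟨r₁, E₁, C₁, hE₁, hEr₁, hC₁, h₁⟩ := hy
  obtain ⟨w₀, hws₀, -, hw₀⟩ := exists_sqrt hE₀
  obtain ⟨w₁, hws₁, -, hw₁⟩ := exists_sqrt hE₁
  have key : ∀ (n m : ℕ) (w r : Stab A), IsSelfAdjoint w →
      Stab.shift n w * star (Stab.shift n w) * Stab.shift m r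
        = if n = m then Stab.shift n (w * w * r) else 0 := by
    intro n m w r hw
    rw [mul_assoc, Stab.star_shift_mul_shift, hw.star_eq]
    split_ifs
    · rw [← Stab.shift_mul, mul_assoc]
    · rw [mul_zero]
  have hdim : ∀ (τ : DenseQT A) (n : ℕ) (w : Stab A), IsSelfAdjoint w →
      τ.dim (Stab.shift n w * star (Stab.shift n w)) = τ.dim (w * w) := by
    intro τ n w hw
    rw [← τ.dim_star_mul_self, Stab.star_shift_mul_shift, if_pos rfl, hw.star_eq]
  refine ⟨((Real.sqrt 2 : ℝ) : ℂ) • (Stab.shift 0 r₀ + Stab.shift 1 r₁),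
    Stab.shift 0 w₀ * star (Stab.shift 0 w₀) + Stab.shift 1 w₁ * star (Stab.shift 1 w₁),
    C₀ + C₁, add_nonneg (mul_star_self_nonneg _) (mul_star_self_nonneg _), ?_, fun τ => ?_, ?_⟩
  · rw [mul_smul_comm]
    congr 1
    rw [add_mul, mul_add, mul_add, key 0 0 _ _ hws₀, key 0 1 _ _ hws₀, key 1 0 _ _ hws₁,
      key 1 1 _ _ hws₁, hw₀, hw₁, hEr₀, hEr₁]
    simp
  · have hle := τ.dim_add_le (mul_star_self_nonneg (Stab.shift 0 w₀))
      (mul_star_self_nonneg (Stab.shift 1 w₁))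
    rw [hdim τ 0 _ hws₀, hdim τ 1 _ hws₁, hw₀, hw₁] at hle
    refine ⟨hle.trans ?_, (hle.trans_lt (ENNReal.add_lt_top.2
      ⟨(hC₀ τ).2.lt_top, (hC₁ τ).2.lt_top⟩)).ne⟩
    push_cast
    rw [add_mul]
    exact add_le_add (hC₀ τ).1 (hC₁ τ).1
  · refine (star_add_mul_add_le x y).trans ?_
    have e : star (((Real.sqrt 2 : ℝ) : ℂ) • (Stab.shift 0 r₀ + Stab.shift 1 r₁))
        * (((Real.sqrt 2 : ℝ) : ℂ) • (Stab.shift 0 r₀ + Stab.shift 1 r₁))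
        = (2 : ℝ) • (star r₀ * r₀ + star r₁ * r₁) := by
      rw [star_smul, smul_mul_smul_comm, Complex.star_def, Complex.conj_ofReal,
        ← Complex.ofReal_mul, Real.mul_self_sqrt (by norm_num), Complex.coe_smul, star_add]
      congr 1
      rw [add_mul, mul_add, mul_add]
      simp only [Stab.star_shift_mul_shift]
      simp
    rw [e]
    exact smul_le_smul_of_nonneg_left (add_le_add h₀ h₁) (by norm_num)

variable (A) in
/-- The dominated elements form a two-sided ideal. -/
def ideal : Submodule ℂ (Stab A) where
  carrier := {x | IsDominated x}
  add_mem' := add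
  zero_mem' := zero
  smul_mem' c _ hx := hx.smul c

theorem isIdeal : IsIdeal (ideal A) := fun _ hx a => ⟨IsDominated.mul_left hx a,
  IsDominated.mul_right hx a⟩

end IsDominated

theorem IsIdeal.topologicalClosure {B : Type u} [NonUnitalCStarAlgebra B] {I : Submodule ℂ B}
    (hI : IsIdeal I) : IsIdeal I.topologicalClosure := by
  intro x hx a
  constructor
  · exact map_mem_closure (f := fun x => a * x) (by fun_prop) hx fun y hy => (hI y hy a).1
  · exact map_mem_closure (f := fun x => x * a) (by fun_prop) hx fun y hy => (hI y hy a).2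

theorem IsSimpleCStar.dense_of_ne_bot {B : Type u} [NonUnitalCStarAlgebra B]
    (hB : IsSimpleCStar B) {I : Submodule ℂ B} (hI : IsIdeal I) (h : I ≠ ⊥) :
    Dense (I : Set B) := by
  rcases hB.2 _ hI.topologicalClosure I.isClosed_topologicalClosure with h0 | h0
  · exact absurd (eq_bot_iff.2 (h0 ▸ I.le_topologicalClosure)) h
  · intro x
    have : x ∈ I.topologicalClosure := h0 ▸ Submodule.mem_top
    exact this

theorem exists_nonneg_ne_zero {B : Type u} [NonUnitalCStarAlgebra B] [PartialOrder B]
    [StarOrderedRing B] [Nontrivial B] : ∃ b : B, 0 ≤ b ∧ b ≠ 0 := by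
  obtain ⟨x, hx⟩ := exists_ne (0 : B)
  exact ⟨star x * x, star_mul_self_nonneg _, fun h => hx (CStarRing.star_mul_self_eq_zero_iff x |>.1 h)⟩

/-- In a simple C⋆-algebra, every element of the Pedersen ideal of the stabilization is
dominated: the dominated elements form a nonzero, hence dense ideal. -/
theorem isDominated_of_mem_pedersen (hA : IsSimpleCStar A) {x : Stab A}
    (hx : x ∈ pedersen (Stab A)) : IsDominated x := by
  refine hx (IsDominated.ideal A) IsDominated.isIdeal
    ((Stab.isSimpleCStar hA).dense_of_ne_bot IsDominated.isIdeal ?_)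
  have := hA.1
  obtain ⟨a, ha, ha0⟩ := exists_nonneg_ne_zero (B := A)
  obtain ⟨ε, hε, hne⟩ := exists_cfcₙ_fEps_ne_zero ha ha0
  have hE : cfcₙ (fEps (ε / 2)) a * cfcₙ (fEps ε) a = cfcₙ (fEps ε) a := by
    rw [← cfcₙ_mul _ _ _ (fEps_continuous _).continuousOn (fEps_zero (by positivity))
      (fEps_continuous _).continuousOn (fEps_zero hε)]
    congr 1
    funext t
    rcases le_total t ε with ht | ht
    · rw [fEps_eq_zero hε ht, mul_zero]
    · rw [fEps_eq_one (by positivity) (by linarith), one_mul]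
  rw [Submodule.ne_bot_iff]
  refine ⟨corner A (cfcₙ (fEps ε) a), ⟨corner A (cfcₙ (fEps ε) a),
    corner A (cfcₙ (fEps (ε / 2)) a), 1, ?_, ?_, fun τ => ?_, le_rfl⟩, fun h => ?_⟩
  · exact map_nonneg (corner A) (cfcₙ_fEps_nonneg _ _)
  · rw [← map_mul, hE]
  · rw [ENNReal.coe_one, one_mul]
    exact ⟨τ.dim_corner_le (cfcₙ_fEps_nonneg _ _),
      τ.dim_corner_cfcₙ_fEps_ne_top ha (by positivity)⟩
  · exact hne ε hε le_rfl (Stab.corner_injective (h.trans (map_zero (corner A)).symm))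

/-- If `E` is a left unit for `r`, every positive element `p` of the left ideal generated by `r` is
of the form `z⋆z` with `E z = z`; in particular `τ(p)` is controlled by `d_τ(E)`. -/
theorem exists_factor_of_mem_rid {r E p : Stab A} (hE : 0 ≤ E) (hEr : E * r = r) (hp : 0 ≤ p)
    (hpr : p ∈ rid (star r)) : ∃ z ∈ pedersen (Stab A), star z * z = p ∧
      ∀ τ : DenseQT A, ENNReal.ofReal (τ.rval p) ≤ ‖p‖₊ * τ.dim E := by
  have hEs : IsSelfAdjoint E := .of_nonneg hE
  have hk : cfcₙ (fEps (1 / 4)) E * r = r := cfcₙ_fEps_mul_eq hEs hEr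
  obtain ⟨w, hws, hw0, hw⟩ := exists_sqrt hp
  have hwr : w ∈ rid (star r) := by
    have := self_mem_rid_mul_self hw0
    rw [hw] at this
    exact rid_subset hpr this
  obtain ⟨z, hz, hzw⟩ := exists_polar_image hwr
  rw [hws.star_eq, hw] at hzw
  have hzE : E * z = z := mul_eq_of_mem_rid hEr hz
  have hzk : cfcₙ (fEps (1 / 4)) E * z = z := mul_eq_of_mem_rid hk hz
  have hzm : z ∈ pedersen (Stab A) := mem_pedersen_of_mul_eq hzE
  refine ⟨z, hzm, hzw, fun τ => ?_⟩
  have hcut := IsCutoff.fEps (ε := 1 / 4) (by norm_num)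
  set k := cfcₙ (fEps (1 / 4)) E with hkd
  have hkm : k ∈ pedersen (Stab A) := hcut.mem E
  have hk0 : 0 ≤ k := cfcₙ_fEps_nonneg _ _
  have hF : IsCutoff fun t => fEps (1 / 4) t * fEps (1 / 4) t :=
    hcut.comp_left (h := fun s => s * s) (by fun_prop) (by simp)
  have hkk : k * k = cfcₙ (fun t => fEps (1 / 4) t * fEps (1 / 4) t) E := by
    rw [hkd, cfcₙ_mul _ _ _ (fEps_continuous _).continuousOn (fEps_zero (by norm_num))
      (fEps_continuous _).continuousOn (fEps_zero (by norm_num))]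
  have hkk1 : ENNReal.ofReal (τ.rval (k * k)) ≤ τ.dim E := by
    rw [hkk]
    exact τ.rval_le_dim hF (fun t _ => mul_le_one₀ (fEps_le_one _ _) (fEps_nonneg _ _)
      (fEps_le_one _ _)) hE
  rw [← hzw, τ.rval_star_mul_self hzm]
  rcases eq_or_ne z 0 with rfl | hz0
  · simp [τ.rval_zero]
  have hn : 0 < ‖star z * z‖ := by
    rw [CStarRing.norm_star_mul_self]
    have := norm_pos_iff.2 hz0
    positivity
  have hzz : z * star z ∈ pedersen (Stab A) := mul_mem hzm (star_mem hzm)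
  have hpn : ‖z * star z‖ = ‖star z * z‖ := by
    rw [CStarRing.norm_self_mul_star, CStarRing.norm_star_mul_self]
  obtain ⟨-, h1⟩ := τ.rval_le_of_unit hkm (.of_nonneg hk0) hk0
    (p := ‖star z * z‖⁻¹ • (z * star z))
    (smul_nonneg (by positivity) (mul_star_self_nonneg _))
    (by rw [norm_smul, hpn, Real.norm_of_nonneg (by positivity), inv_mul_cancel₀ hn.ne'])
    (by rw [mul_smul_comm]; congr 1; rw [← mul_assoc, mul_assoc k k z, hzk, hzk])
  rw [τ.rval_smul hzz (.mul_star_self z), inv_mul_le_iff₀ hn] at h1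
  calc ENNReal.ofReal (τ.rval (z * star z)) ≤ ENNReal.ofReal (‖star z * z‖ * τ.rval (k * k)) :=
        ENNReal.ofReal_le_ofReal h1
    _ = (‖star z * z‖₊ : ℝ≥0∞) * ENNReal.ofReal (τ.rval (k * k)) := by
        rw [ENNReal.ofReal_mul hn.le]
        congr 1
        rw [← ENNReal.ofReal_coe_nnreal]; rfl
    _ ≤ _ := mul_le_mul' le_rfl hkk1

/-- A positive dominated element is of the form `z⋆z` with `z` in the Pedersen ideal. -/
theorem IsDominated.exists_factor {p : Stab A} (hp : 0 ≤ p) (h : IsDominated p) :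
    ∃ z ∈ pedersen (Stab A), star z * z = p ∧ ∃ E : Stab A, ∃ C : ℝ≥0, 0 ≤ E ∧
      (∀ τ : DenseQT A, ENNReal.ofReal (τ.rval p) ≤ C * τ.dim E) ∧
      (∀ τ : DenseQT A, τ.dim p ≤ τ.dim E) ∧ ∀ τ : DenseQT A, τ.dim E ≤ C * τ.normOn := by
  obtain ⟨r, E, C, hE, hEr, hC, hle⟩ := h
  have hps : IsSelfAdjoint p := .of_nonneg hp
  have hk : cfcₙ (fEps (1 / 4)) E * r = r := cfcₙ_fEps_mul_eq (.of_nonneg hE) hEr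
  have hpr : p ∈ rid (star r) := by
    have := star_mem_rid_of_le hle
    rwa [hps.star_eq] at this
  obtain ⟨z, hzm, hzz, hz⟩ := exists_factor_of_mem_rid hE hEr hp hpr
  refine ⟨z, hzm, hzz, E, max C ‖p‖₊, hE, fun τ => (hz τ).trans
    (mul_le_mul' (by exact_mod_cast le_max_right _ _) le_rfl), fun τ => ?_, fun τ =>
    (hC τ).1.trans (mul_le_mul' (by exact_mod_cast le_max_left _ _) le_rfl)⟩
  have h1 := τ.dim_le_of_le_star_mul (R := star p * p) (star_mul_self_nonneg _) hE
    (δ := 1 / 4) (by norm_num) hle hk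
  refine le_trans ?_ h1
  have e : p = cfcₙ Real.sqrt (star p * p) := by
    rw [hps.star_eq, show p * p = cfcₙ (fun t : ℝ => t * t) p by
      rw [cfcₙ_mul (fun t : ℝ => t) (fun t => t) p (by fun_prop) rfl (by fun_prop) rfl,
        cfcₙ_id' ℝ p], ← cfcₙ_comp' Real.sqrt (fun t : ℝ => t * t) p (by fun_prop)]
    conv_lhs => rw [← cfcₙ_id' ℝ p]
    exact cfcₙ_congr fun t ht =>
      (Real.sqrt_mul_self (quasispectrum_nonneg_of_nonneg p hp t ht)).symm
  conv_lhs => rw [e]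
  exact τ.dim_cfcₙ_le_dim (by fun_prop) Real.sqrt_zero (star_mul_self_nonneg _)

/-- Every self-adjoint element of the Pedersen ideal is `z₁⋆z₁ - z₂⋆z₂` with `z₁⋆z₁` and `z₂⋆z₂`
commuting, and `z₁`, `z₂` in the Pedersen ideal. -/
theorem exists_factor_of_isSelfAdjoint (hA : IsSimpleCStar A) {x : Stab A}
    (hx : x ∈ pedersen (Stab A)) (hxs : IsSelfAdjoint x) :
    ∃ z₁ ∈ pedersen (Stab A), ∃ z₂ ∈ pedersen (Stab A), x = star z₁ * z₁ - star z₂ * z₂ ∧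
      star z₁ * z₁ * (star z₂ * z₂) = star z₂ * z₂ * (star z₁ * z₁) := by
  have key : ∀ y : Stab A, IsSelfAdjoint y → IsDominated y →
      ∃ z ∈ pedersen (Stab A), star z * z = cfcₙ (fun t : ℝ => max t 0) y := by
    rintro y hys ⟨r, E, C, hE, hEr, hC, hle⟩
    have h0 : 0 ≤ cfcₙ (fun t : ℝ => max t 0) y := cfcₙ_nonneg fun _ _ => le_max_right _ _
    have : IsDominated (cfcₙ (fun t : ℝ => max t 0) y) := by
      refine ⟨r, E, C, hE, hEr, hC, le_trans ?_ hle⟩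
      rw [(IsSelfAdjoint.of_nonneg h0).star_eq, hys.star_eq,
        ← cfcₙ_mul _ _ _ (by fun_prop) (by simp) (by fun_prop) (by simp)]
      have e : y * y = cfcₙ (fun t : ℝ => t * t) y := by
        rw [cfcₙ_mul (fun t : ℝ => t) (fun t => t) y (by fun_prop) rfl (by fun_prop) rfl,
          cfcₙ_id' ℝ y]
      rw [e]
      refine cfcₙ_mono fun t _ => ?_
      rcases le_total t 0 with ht | ht
      · rw [max_eq_right ht, mul_zero]; exact mul_self_nonneg t
      · rw [max_eq_left ht]
    obtain ⟨z, hz, hzz, -⟩ := this.exists_factor h0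
    exact ⟨z, hz, hzz⟩
  have hd := isDominated_of_mem_pedersen hA hx
  obtain ⟨z₁, hz₁, h₁⟩ := key x hxs hd
  obtain ⟨z₂, hz₂, h₂⟩ := key (-x) hxs.neg (by
    have := hd.smul (-1)
    rwa [neg_one_smul] at this)
  have e : cfcₙ (fun t : ℝ => max t 0) (-x) = cfcₙ (fun t : ℝ => max (-t) 0) x := by
    rw [← cfcₙ_comp_neg (fun t : ℝ => max t 0) x]
  rw [e] at h₂
  refine ⟨z₁, hz₁, z₂, hz₂, ?_, ?_⟩
  · rw [h₁, h₂, ← cfcₙ_sub _ _ _ (by fun_prop) (by simp) (by fun_prop) (by simp)]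
    conv_lhs => rw [← cfcₙ_id' ℝ x]
    congr 1
    funext t
    rcases le_total t 0 with ht | ht
    · rw [max_eq_right ht, max_eq_left (by linarith)]; ring
    · rw [max_eq_left ht, max_eq_right (by linarith)]; ring
  · rw [h₁, h₂]
    exact cfcₙ_commute_cfcₙ _ _ x

/-- The values of a quasitrace on the Pedersen ideal are determined by those at elements `z⋆z`. -/
theorem exists_quasitrace_decomp (hA : IsSimpleCStar A) (x : pedersen (Stab A)) :
    ∃ z₁ z₂ z₃ z₄ : pedersen (Stab A), ∀ τ : pedersen (Stab A) → ℂ, IsQuasitrace τ →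
      τ x = τ (star z₁ * z₁) - τ (star z₂ * z₂)
        + Complex.I * (τ (star z₃ * z₃) - τ (star z₄ * z₄)) := by
  have key : ∀ y : pedersen (Stab A), IsSelfAdjoint y → ∃ z₁ z₂ : pedersen (Stab A),
      ∀ τ : pedersen (Stab A) → ℂ, IsQuasitrace τ →
        τ y = τ (star z₁ * z₁) - τ (star z₂ * z₂) := by
    intro y hy
    obtain ⟨z₁, hz₁, z₂, hz₂, h, hc⟩ :=
      exists_factor_of_isSelfAdjoint hA y.2 (congrArg Subtype.val hy)
    refine ⟨⟨z₁, hz₁⟩, ⟨z₂, hz₂⟩, fun τ hτ => ?_⟩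
    set a : pedersen (Stab A) := star ⟨z₁, hz₁⟩ * ⟨z₁, hz₁⟩
    set b : pedersen (Stab A) := star ⟨z₂, hz₂⟩ * ⟨z₂, hz₂⟩
    have hb : IsSelfAdjoint b := .star_mul_self _
    have e : y = a + (-1 : ℂ) • b := by
      rw [neg_one_smul, ← sub_eq_add_neg]
      exact Subtype.ext h
    have hab : a * b = b * a := Subtype.ext hc
    rw [e, hτ.add_of_commute (.star_mul_self _) (by rw [neg_one_smul]; exact hb.neg)
      (by rw [mul_smul_comm, smul_mul_assoc, hab]), hτ.smul_of_isSelfAdjoint hb]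
    ring
  have hre : IsSelfAdjoint ((1 / 2 : ℂ) • (x + star x)) := by
    change star _ = _
    rw [star_smul, star_add, star_star, add_comm]
    simp
  have him : IsSelfAdjoint ((-Complex.I / 2 : ℂ) • (x - star x)) := by
    change star _ = _
    rw [star_smul, star_sub, star_star]
    simp only [star_div₀, star_neg, Complex.star_def, Complex.conj_I, neg_neg, map_ofNat]
    rw [← neg_sub x, smul_neg, ← neg_smul]
    congr 1
    ring
  obtain ⟨z₁, z₂, h₁⟩ := key _ hre
  obtain ⟨z₃, z₄, h₃⟩ := key _ him
  refine ⟨z₁, z₂, z₃, z₄, fun τ hτ => ?_⟩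
  rw [← h₁ τ hτ, ← h₃ τ hτ, ← hτ.decomp _ _ hre him]
  congr 1
  rw [smul_smul, smul_add, smul_sub]
  have : Complex.I * (-Complex.I / 2) = 1 / 2 := by
    have := Complex.I_mul_I
    linear_combination (-1 / 2 : ℂ) * this
  rw [this]
  have h2 : x = (1 / 2 : ℂ) • x + (1 / 2 : ℂ) • x := by
    rw [← add_smul]; norm_num
  nth_rewrite 1 [h2]
  abel

theorem IsQuasitrace.eq_of_star_mul_self (hA : IsSimpleCStar A) {σ τ : pedersen (Stab A) → ℂ}
    (hσ : IsQuasitrace σ) (hτ : IsQuasitrace τ) (h : ∀ z, σ (star z * z) = τ (star z * z)) :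
    σ = τ := by
  funext x
  obtain ⟨z₁, z₂, z₃, z₄, hz⟩ := exists_quasitrace_decomp hA x
  rw [hz σ hσ, hz τ hτ, h, h, h, h]

/-- `∑ s_i m_{ij} s_j⋆` for a `2 × 2` matrix `m`. -/
def Stab.ofTwoByTwo (m : Fin 2 → Fin 2 → Stab A) : Stab A :=
  Stab.conj 0 0 (m 0 0) + Stab.conj 0 1 (m 0 1) + Stab.conj 1 0 (m 1 0) + Stab.conj 1 1 (m 1 1)

theorem Stab.ofTwoByTwo_mul (m n : Fin 2 → Fin 2 → Stab A) :
    Stab.ofTwoByTwo (fun i j => m i 0 * n 0 j + m i 1 * n 1 j)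
      = Stab.ofTwoByTwo m * Stab.ofTwoByTwo n := by
  unfold Stab.ofTwoByTwo
  simp only [Stab.conj_add, add_mul, mul_add, Stab.conj_mul_conj, zero_ne_one, one_ne_zero,
    if_true, if_false]
  abel

variable (A) in
/-- `M₂(Ped(A ⊗ 𝕂)) → Ped(A ⊗ 𝕂)`, `y ↦ ∑ s_i y_{ij} s_j⋆`. -/
def matrixHom : Matrix (Fin 2) (Fin 2) (pedersen (Stab A)) →⋆ₙₐ[ℂ] pedersen (Stab A) where
  toFun y := ⟨Stab.ofTwoByTwo fun i j => (y i j : Stab A),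
    add_mem (add_mem (add_mem (Stab.conj_mem_pedersen _ _ (y _ _).2)
      (Stab.conj_mem_pedersen _ _ (y _ _).2)) (Stab.conj_mem_pedersen _ _ (y _ _).2))
      (Stab.conj_mem_pedersen _ _ (y _ _).2)⟩
  map_smul' c y := Subtype.ext (by
    change Stab.ofTwoByTwo (fun i j => c • (y i j : Stab A))
      = c • Stab.ofTwoByTwo fun i j => (y i j : Stab A)
    simp only [Stab.ofTwoByTwo, Stab.conj_smul, smul_add])
  map_zero' := Subtype.ext (by
    change Stab.ofTwoByTwo (fun _ _ => (0 : Stab A)) = 0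
    simp only [Stab.ofTwoByTwo, Stab.conj_zero, add_zero])
  map_add' x y := Subtype.ext (by
    change Stab.ofTwoByTwo (fun i j => (x i j : Stab A) + (y i j : Stab A))
      = Stab.ofTwoByTwo (fun i j => (x i j : Stab A)) + Stab.ofTwoByTwo fun i j => (y i j : Stab A)
    simp only [Stab.ofTwoByTwo, Stab.conj_add]
    abel)
  map_mul' x y := Subtype.ext (by
    change Stab.ofTwoByTwo (fun i j => ((x * y) i j : Stab A))
      = Stab.ofTwoByTwo (fun i j => (x i j : Stab A)) * Stab.ofTwoByTwo fun i j => (y i j : Stab A)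
    rw [← Stab.ofTwoByTwo_mul]
    congr 1
    funext i j
    rw [Matrix.mul_apply, Fin.sum_univ_two]
    rfl)
  map_star' x := Subtype.ext (by
    change Stab.ofTwoByTwo (fun i j => star (x j i : Stab A))
      = star (Stab.ofTwoByTwo fun i j => (x i j : Stab A))
    simp only [Stab.ofTwoByTwo, Stab.star_conj, star_add]
    abel)

variable (A) in
/-- `Ped(A ⊗ 𝕂) → Ped(A ⊗ 𝕂)`, `x ↦ s_0 x s_0⋆`. -/
def conjHom : pedersen (Stab A) →⋆ₙₐ[ℂ] pedersen (Stab A) where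
  toFun x := ⟨Stab.conj 0 0 (x : Stab A), Stab.conj_mem_pedersen _ _ x.2⟩
  map_smul' c y := Subtype.ext (Stab.conj_smul _ _ _ _)
  map_zero' := Subtype.ext (Stab.conj_zero _ _)
  map_add' x y := Subtype.ext (Stab.conj_add _ _ _ _)
  map_mul' x y := Subtype.ext (by
    change Stab.conj 0 0 ((x : Stab A) * (y : Stab A)) = Stab.conj 0 0 (x : Stab A) * Stab.conj 0 0 (y : Stab A)
    rw [Stab.conj_mul_conj, if_pos rfl])
  map_star' x := Subtype.ext (Stab.star_conj _ _ _).symm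

/-- On the Pedersen ideal of a stable algebra every quasitrace is a 2-quasitrace. -/
theorem IsQuasitrace.isTwoQuasitrace (hA : IsSimpleCStar A) {τ : pedersen (Stab A) → ℂ}
    (hτ : IsQuasitrace τ) : IsTwoQuasitrace τ := by
  refine ⟨hτ, fun y => τ (matrixHom A y), hτ.comp _, fun x => ?_⟩
  have h1 : (fun x => τ (conjHom A x)) = τ := by
    refine IsQuasitrace.eq_of_star_mul_self hA (hτ.comp _) hτ fun z => ?_
    have hm : star (Stab.shift 0 (star (z : Stab A))) ∈ pedersen (Stab A) :=
      star_mem (Stab.row_mem_pedersen _ (star_mem z.2))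
    set v : pedersen (Stab A) := ⟨_, hm⟩
    have e1 : conjHom A (star z * z) = star v * v := Subtype.ext (by
      change Stab.conj 0 0 (star (z : Stab A) * (z : Stab A)) = star (star (Stab.shift 0 (star (z : Stab A))))
        * star (Stab.shift 0 (star (z : Stab A)))
      rw [star_star, Stab.conj, ← Stab.mul_col, Stab.row_mul]
      rfl)
    have e2 : v * star v = z * star z := Subtype.ext (by
      change star (Stab.shift 0 (star (z : Stab A))) * star (star (Stab.shift 0 (star (z : Stab A))))
        = (z : Stab A) * star (z : Stab A)
      rw [star_star, Stab.star_shift_mul_shift, if_pos rfl, star_star])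
    rw [e1, hτ.trace, e2, ← hτ.trace]
  rw [← congrFun h1 x]
  refine congrArg τ (Subtype.ext ?_)
  change Stab.ofTwoByTwo (fun i j =>
    ((Matrix.single 0 0 x : Matrix (Fin 2) (Fin 2) (pedersen (Stab A))) i j : Stab A))
      = Stab.conj 0 0 (x : Stab A)
  simp [Stab.ofTwoByTwo, Stab.conj_zero]

theorem isClosed_isQuasitrace {P : Type u} [NonUnitalRing P] [StarRing P] [Module ℂ P] :
    IsClosed {τ : P → ℂ | IsQuasitrace τ} := by
  have e : {τ : P → ℂ | IsQuasitrace τ}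
      = (⋂ x, {τ | 0 ≤ τ (star x * x)}) ∩ (⋂ x, {τ | τ (star x * x) = τ (x * star x)})
        ∩ (⋂ C : NonUnitalStarSubalgebra ℂ P, ⋂ (_ : ∀ x ∈ C, ∀ y ∈ C, x * y = y * x),
          ((⋂ x ∈ C, ⋂ y ∈ C, {τ : P → ℂ | τ (x + y) = τ x + τ y})
            ∩ ⋂ c : ℂ, ⋂ x ∈ C, {τ : P → ℂ | τ (c • x) = c * τ x}))
        ∩ ⋂ a, ⋂ b, ⋂ (_ : IsSelfAdjoint a), ⋂ (_ : IsSelfAdjoint b),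
          {τ : P → ℂ | τ (a + Complex.I • b) = τ a + Complex.I * τ b} := by
    ext τ
    simp only [Set.mem_inter_iff, Set.mem_iInter, Set.mem_ofPred_eq]
    exact ⟨fun h => ⟨⟨⟨h.nonneg, h.trace⟩, h.linear⟩, h.decomp⟩,
      fun h => ⟨h.1.1.1, h.1.1.2, h.1.2, h.2⟩⟩
  rw [e]
  refine ((IsClosed.inter (isClosed_iInter fun x => ?_) (isClosed_iInter fun x => ?_)).inter
    (isClosed_iInter fun C => isClosed_iInter fun _ => IsClosed.inter
      (isClosed_biInter fun x _ => isClosed_biInter fun y _ => ?_)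
      (isClosed_iInter fun c => isClosed_biInter fun x _ => ?_))).inter
    (isClosed_iInter fun a => isClosed_iInter fun b => isClosed_iInter fun _ =>
      isClosed_iInter fun _ => ?_)
  · exact isClosed_le continuous_const (continuous_apply _)
  all_goals exact isClosed_eq (by fun_prop) (by fun_prop)

namespace DenseQT

theorem continuous_apply (x : pedersen (Stab A)) : Continuous fun τ : DenseQT A => τ.1 x :=
  (_root_.continuous_apply x).comp continuous_subtype_val

theorem continuous_rval (x : Stab A) : Continuous fun τ : DenseQT A => τ.rval x := by
  unfold rval
  split_ifs with h
  · exact Complex.continuous_re.comp (continuous_apply _)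
  · exact continuous_const

theorem ext_rval (hA : IsSimpleCStar A) {σ τ : DenseQT A}
    (h : ∀ z ∈ pedersen (Stab A), σ.rval (star z * z) = τ.rval (star z * z)) : σ = τ := by
  refine Subtype.ext (IsQuasitrace.eq_of_star_mul_self hA σ.2.1 τ.2.1 fun z => ?_)
  have h1 := h z.1 z.2
  rw [σ.rval_eq (mul_mem (star_mem z.2) z.2), τ.rval_eq (mul_mem (star_mem z.2) z.2)] at h1
  refine Complex.ext h1 ?_
  have i1 := (Complex.le_def.1 (σ.2.1.nonneg z)).2
  have i2 := (Complex.le_def.1 (τ.2.1.nonneg z)).2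
  exact i1.symm.trans i2

theorem normOn_le_one_of_mem_closure {τ : DenseQT A} (hτ : τ ∈ closure (QT A)) :
    τ.normOn ≤ 1 := by
  unfold normOn
  refine iSup_le fun a => ?_
  have hc : IsClosed {σ : DenseQT A | σ.val ⟨corner A (a.1 : A), corner_mem_pedersen a.1.2⟩ ≤ 1} :=
    isClosed_le (ENNReal.continuous_ofReal.comp
      (Complex.continuous_re.comp (continuous_apply _))) continuous_const
  refine closure_minimal (fun σ hσ => ?_) hc hτ
  exact (le_iSup (fun a : {a : pedersen A // 0 ≤ (a : A) ∧ ‖(a : A)‖ ≤ 1} =>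
    σ.val ⟨corner A (a.1 : A), corner_mem_pedersen a.1.2⟩) a).trans (le_of_eq hσ)

/-- For every element `x` of the Pedersen ideal, `|τ(x)|` is bounded on the closure of `QT(A)`. -/
theorem exists_norm_le (hA : IsSimpleCStar A) (x : pedersen (Stab A)) :
    ∃ C : ℝ, ∀ τ ∈ closure (QT A), ‖τ.1 x‖ ≤ C := by
  obtain ⟨z₁, z₂, z₃, z₄, hz⟩ := exists_quasitrace_decomp hA x
  have key : ∀ z : pedersen (Stab A), ∃ C : ℝ, ∀ τ ∈ closure (QT A), ‖τ.1 (star z * z)‖ ≤ C := by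
    intro z
    have hm : star (z : Stab A) * z ∈ pedersen (Stab A) := mul_mem (star_mem z.2) z.2
    obtain ⟨-, -, -, E, C, hE, h1, -, h3⟩ :=
      (isDominated_of_mem_pedersen hA hm).exists_factor (star_mul_self_nonneg _)
    refine ⟨C * C, fun τ hτ => ?_⟩
    have h4 : ENNReal.ofReal (τ.rval (star (z : Stab A) * z)) ≤ ENNReal.ofReal (C * C) := by
      refine (h1 τ).trans ?_
      calc (C : ℝ≥0∞) * τ.dim E ≤ C * (C * 1) :=
            mul_le_mul' le_rfl ((h3 τ).trans (mul_le_mul' le_rfl (normOn_le_one_of_mem_closure hτ)))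
        _ = _ := by
          rw [mul_one, ENNReal.ofReal_mul (NNReal.coe_nonneg C), ENNReal.ofReal_coe_nnreal]
    rw [ENNReal.ofReal_le_ofReal_iff (by positivity), τ.rval_eq hm] at h4
    have h5 := τ.2.1.nonneg z
    have h6 : ‖τ.1 (star z * z)‖ = (τ.1 (star z * z)).re :=
      congrArg Complex.re (Complex.norm_of_nonneg' h5)
    exact h6.trans_le h4
  obtain ⟨C₁, h₁⟩ := key z₁
  obtain ⟨C₂, h₂⟩ := key z₂
  obtain ⟨C₃, h₃⟩ := key z₃
  obtain ⟨C₄, h₄⟩ := key z₄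
  refine ⟨C₁ + C₂ + (C₃ + C₄), fun τ hτ => ?_⟩
  rw [hz τ.1 τ.2.1]
  refine (norm_add_le _ _).trans (add_le_add ((norm_sub_le _ _).trans
    (add_le_add (h₁ τ hτ) (h₂ τ hτ))) ?_)
  rw [norm_mul, Complex.norm_I, one_mul]
  exact (norm_sub_le _ _).trans (add_le_add (h₃ τ hτ) (h₄ τ hτ))

/-- The closure of `QT(A)` is compact: it embeds as a closed set into a product of discs. -/
theorem isCompact_closure_QT (hA : IsSimpleCStar A) : IsCompact (closure (QT A)) := by
  choose C hC using exists_norm_le hA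
  have hemb : Topology.IsClosedEmbedding (Subtype.val : DenseQT A → (pedersen (Stab A) → ℂ)) := by
    have : {τ : pedersen (Stab A) → ℂ | IsTwoQuasitrace τ} = {τ | IsQuasitrace τ} :=
      Set.ext fun τ => ⟨fun h => h.1, fun h => h.isTwoQuasitrace hA⟩
    have hc : IsClosed {τ : pedersen (Stab A) → ℂ | IsTwoQuasitrace τ} :=
      this ▸ isClosed_isQuasitrace
    exact hc.isClosedEmbedding_subtypeVal
  have hK := hemb.isCompact_preimage
    (isCompact_univ_pi fun x => isCompact_closedBall (0 : ℂ) (C x))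
  refine hK.of_isClosed_subset isClosed_closure fun τ hτ x _ => ?_
  simpa using hC x τ hτ

theorem dim_ne_top_of_mem_pedersen (hA : IsSimpleCStar A) {a : Stab A}
    (ha : a ∈ pedersen (Stab A)) (h0 : 0 ≤ a) :
    ∃ C : ℝ≥0, ∀ τ : DenseQT A, τ.dim a ≤ C * τ.normOn := by
  obtain ⟨-, -, -, E, C, hE, -, h2, h3⟩ := (isDominated_of_mem_pedersen hA ha).exists_factor h0
  exact ⟨C, fun τ => (h2 τ).trans (h3 τ)⟩

/-- The elements `x` with `d_τ(x⋆x) = 0`. -/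
def nullIdeal (τ : DenseQT A) : Submodule ℂ (Stab A) where
  carrier := {x | τ.dim (star x * x) = 0}
  add_mem' {x y} hx hy := by
    refine le_antisymm ?_ zero_le
    have h0 : 0 ≤ star x * x + star y * y :=
      add_nonneg (star_mul_self_nonneg _) (star_mul_self_nonneg _)
    refine (τ.dim_mono (star_mul_self_nonneg _) (star_add_mul_add_le x y)).trans
      ((τ.dim_smul_le _ h0).trans ((τ.dim_add_le (star_mul_self_nonneg _)
        (star_mul_self_nonneg _)).trans ?_))
    rw [show τ.dim (star x * x) = 0 from hx, show τ.dim (star y * y) = 0 from hy, add_zero]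
  zero_mem' := by
    change τ.dim (star 0 * 0) = 0
    rw [mul_zero, τ.dim_zero]
  smul_mem' c x hx := by
    refine le_antisymm ?_ zero_le
    have e : star c * c = ((‖c‖ ^ 2 : ℝ) : ℂ) := by
      rw [Complex.star_def, mul_comm, Complex.mul_conj, Complex.normSq_eq_norm_sq]
    rw [star_smul, smul_mul_smul_comm, e, Complex.coe_smul]
    exact (τ.dim_smul_le _ (star_mul_self_nonneg _)).trans (le_of_eq hx)

theorem isIdeal_nullIdeal (τ : DenseQT A) : IsIdeal τ.nullIdeal := by
  intro x hx a
  have hx' : τ.dim (star x * x) = 0 := hx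
  constructor
  · change τ.dim (star (a * x) * (a * x)) = 0
    refine le_antisymm ?_ zero_le
    rw [τ.dim_star_mul_self]
    have e : a * x * star (a * x) = star (star a) * (x * star x) * star a := by
      rw [star_mul, star_star]; noncomm_ring
    rw [e]
    refine (τ.dim_conj_le _ (mul_star_self_nonneg _)).trans ?_
    rw [← τ.dim_star_mul_self, hx']
  · change τ.dim (star (x * a) * (x * a)) = 0
    refine le_antisymm ?_ zero_le
    have e : star (x * a) * (x * a) = star a * (star x * x) * a := by
      rw [star_mul]; noncomm_ring
    rw [e]
    exact (τ.dim_conj_le _ (star_mul_self_nonneg _)).trans hx'.le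

theorem isClosed_nullIdeal (τ : DenseQT A) : IsClosed (τ.nullIdeal : Set (Stab A)) := by
  refine isClosed_of_closure_subset fun x hx => ?_
  change τ.dim (star x * x) = 0
  refine le_antisymm (τ.dim_le_of_cut (star_mul_self_nonneg _) fun ε hε => ?_) zero_le
  have hc : ContinuousAt (fun y : Stab A => ‖star x * x - star y * y‖) x := by fun_prop
  have h0 : ‖star x * x - star x * x‖ < ε := by simpa using hε
  obtain ⟨y, hy, hyN⟩ := mem_closure_iff_nhds.1 hx _ (hc.eventually (gt_mem_nhds h0))
  refine (τ.dim_cut_le_of_norm_sub_lt (star_mul_self_nonneg _) (star_mul_self_nonneg _) hy).trans ?_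
  exact le_of_eq hyN

/-- Nonzero quasitraces on the stabilization of a simple C⋆-algebra are faithful. -/
theorem dim_pos (hA : IsSimpleCStar A) {τ : DenseQT A} (hτ : τ ≠ 0) {p : Stab A} (hp : 0 ≤ p)
    (hp0 : p ≠ 0) : 0 < τ.dim p := by
  rw [pos_iff_ne_zero]
  intro h
  obtain ⟨w, hws, -, hw⟩ := exists_sqrt hp
  have hwN : w ∈ τ.nullIdeal := by
    change τ.dim (star w * w) = 0
    rw [hws.star_eq, hw, h]
  rcases (Stab.isSimpleCStar hA).2 _ τ.isIdeal_nullIdeal τ.isClosed_nullIdeal with h0 | h0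
  · rw [h0, Submodule.mem_bot] at hwN
    exact hp0 (by rw [← hw, hwN, mul_zero])
  · apply hτ
    refine ext_rval hA fun z hz => ?_
    have hm : star z * z ∈ pedersen (Stab A) := mul_mem (star_mem hz) hz
    obtain ⟨-, -, -, E, C, hE, h1, -, -⟩ :=
      (isDominated_of_mem_pedersen hA hm).exists_factor (star_mul_self_nonneg _)
    obtain ⟨v, hvs, -, hv⟩ := exists_sqrt hE
    have hvN : v ∈ τ.nullIdeal := h0 ▸ Submodule.mem_top
    have hE0 : τ.dim E = 0 := by
      rw [← hv]
      have : τ.dim (star v * v) = 0 := hvN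
      rwa [hvs.star_eq] at this
    have h2 := h1 τ
    rw [hE0, mul_zero, nonpos_iff_eq_zero, ENNReal.ofReal_eq_zero] at h2
    have h3 : (0 : DenseQT A).rval (star z * z) = 0 := by
      rw [rval_eq _ hm]; rfl
    rw [h3]
    exact le_antisymm h2 (τ.rval_star_mul_self_nonneg hz)

end DenseQT

end Domination

/-! ### Comparison of dimension and quasitrace on spectral parts -/

section Construction

section
variable {D : Type u} [NonUnitalCStarAlgebra D] [PartialOrder D] [StarOrderedRing D]

open scoped ContinuousMapZero in
theorem cfcₙ_mem_rid {a : D} (ha : IsSelfAdjoint a) (f : ℝ → ℝ) (hf : Continuous f)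
    (hf0 : f 0 = 0) : cfcₙ f a ∈ rid a := by
  let s : Set ℝ := quasispectrum ℝ a
  have : Fact ((0 : ℝ) ∈ s) := ⟨quasispectrum.zero_mem ℝ a⟩
  have : CompactSpace s := isCompact_iff_compactSpace.mp
    (NonUnitalContinuousFunctionalCalculus.isCompact_quasispectrum a)
  have key : ∀ g : ContinuousMapZero s ℝ, cfcₙHomSuperset ha (le_refl s) g ∈ rid a := by
    intro g
    induction g using ContinuousMapZero.induction_on_of_compact with
    | zero => rw [map_zero]; exact zero_mem_rid a
    | id => rw [cfcₙHomSuperset_id ha (le_refl s)]; exact self_mem_rid a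
    | star_id => rw [map_star, cfcₙHomSuperset_id ha (le_refl s), ha.star_eq]; exact self_mem_rid a
    | add g k hg hk => rw [map_add]; exact add_mem_rid hg hk
    | mul g k hg hk => rw [map_mul]; exact mul_mem_rid hg _
    | smul r g hg => rw [map_smul, ← Complex.coe_smul]; exact smul_mem_rid _ hg
    | frequently g hg =>
      exact ((isClosed_rid a).preimage (cfcₙHomSuperset_continuous ha (le_refl s)))
        |>.mem_of_frequently_of_tendsto hg tendsto_id
  have := key ⟨⟨fun x => f x, hf.comp continuous_subtype_val⟩, hf0⟩
  rw [cfcₙ_apply f a hf.continuousOn hf0 ha]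
  exact this

theorem neg_mem_rid {r x : D} (hx : x ∈ rid r) : -x ∈ rid r := by
  have := smul_mem_rid (-1) hx
  rwa [neg_one_smul] at this

theorem sub_mem_rid {r x y : D} (hx : x ∈ rid r) (hy : y ∈ rid r) : x - y ∈ rid r := by
  rw [sub_eq_add_neg]
  exact add_mem_rid hx (neg_mem_rid hy)

theorem cut_add_cut {ε δ : ℝ} (hε : 0 ≤ ε) (hδ : 0 ≤ δ) (x : D) :
    cut ε (cut δ x) = cut (ε + δ) x := by
  by_cases hx : IsSelfAdjoint x
  · unfold cut
    rw [← cfcₙ_comp' (fun t : ℝ => max (t - ε) 0) (fun t : ℝ => max (t - δ) 0) x (by fun_prop)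
      (max_eq_right (by linarith)) (by fun_prop) (max_eq_right (by linarith))]
    congr 1
    funext t
    rcases le_total t δ with ht | ht
    · rw [max_eq_right (by linarith : t - δ ≤ 0), max_eq_right (by linarith),
        max_eq_right (by linarith)]
    · rw [max_eq_left (by linarith : 0 ≤ t - δ), sub_sub, add_comm δ]
  · unfold cut
    rw [cfcₙ_apply_of_not_predicate x hx, cfcₙ_apply_of_not_predicate x hx, cfcₙ_apply_zero]

/-- `f_ε(x)` acts as a unit on functions of `x` that live on `[2ε, ∞)`. -/
theorem cfcₙ_fEps_mul_cfcₙ {ε : ℝ} (hε : 0 < ε) {G : ℝ → ℝ} (hG : Continuous G) (hG0 : G 0 = 0)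
    (h : ∀ t, G t ≠ 0 → 2 * ε ≤ t) (x : D) : cfcₙ (fEps ε) x * cfcₙ G x = cfcₙ G x := by
  rw [← cfcₙ_mul _ _ _ (fEps_continuous _).continuousOn (fEps_zero hε) hG.continuousOn hG0]
  congr 1
  funext t
  by_cases ht : G t = 0
  · rw [ht, mul_zero]
  · rw [fEps_eq_one hε (h t ht), one_mul]

theorem cfcₙ_fEps_mul_cfcₙ_fEps {ε δ : ℝ} (hε : 0 < ε) (h : 2 * ε ≤ δ) (x : D) :
    cfcₙ (fEps ε) x * cfcₙ (fEps δ) x = cfcₙ (fEps δ) x :=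
  cfcₙ_fEps_mul_cfcₙ hε (fEps_continuous δ) (fEps_zero (by linarith)) (fun t ht => by
    by_contra hc
    exact ht (fEps_eq_zero (by linarith) (by linarith))) x

theorem quasispectrum_le_norm {x : D} (hx : IsSelfAdjoint x) {t : ℝ}
    (ht : t ∈ quasispectrum ℝ x) : t ≤ ‖x‖ :=
  (le_abs_self t).trans (NonUnitalIsometricContinuousFunctionalCalculus.norm_quasispectrum_le x ht hx)

end

variable {A : Type u} [NonUnitalCStarAlgebra A] [PartialOrder A] [StarOrderedRing A]

namespace DenseQT

theorem rval_add_apply (σ τ : DenseQT A) (x : Stab A) :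
    (σ + τ).rval x = σ.rval x + τ.rval x := by
  by_cases h : x ∈ pedersen (Stab A)
  · rw [rval_eq _ h, rval_eq _ h, rval_eq _ h]
    exact Complex.add_re _ _
  · simp [rval, h]

theorem rval_smul_apply (s : ℝ≥0) (τ : DenseQT A) (x : Stab A) :
    (s • τ).rval x = s * τ.rval x := by
  by_cases h : x ∈ pedersen (Stab A)
  · rw [rval_eq _ h, rval_eq _ h]
    exact Complex.re_ofReal_mul _ _
  · simp [rval, h]

variable (τ : DenseQT A)

theorem dim_mul_self {p : Stab A} (hp : 0 ≤ p) : τ.dim (p * p) = τ.dim p := by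
  have e : p * p = cfcₙ (fun t : ℝ => t * t) p := by
    rw [cfcₙ_mul (fun t : ℝ => t) (fun t => t) p (by fun_prop) rfl (by fun_prop) rfl,
      cfcₙ_id' ℝ p]
  have e' : p = cfcₙ Real.sqrt (p * p) := by
    rw [e, ← cfcₙ_comp' Real.sqrt (fun t : ℝ => t * t) p (by fun_prop)]
    conv_lhs => rw [← cfcₙ_id' ℝ p]
    exact cfcₙ_congr fun t ht =>
      (Real.sqrt_mul_self (quasispectrum_nonneg_of_nonneg p hp t ht)).symm
  refine le_antisymm ?_ ?_
  · rw [e]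
    exact τ.dim_cfcₙ_le_dim (by fun_prop) (by simp) hp
  · conv_lhs => rw [e']
    refine τ.dim_cfcₙ_le_dim (by fun_prop) Real.sqrt_zero ?_
    have := star_mul_self_nonneg p
    rwa [(IsSelfAdjoint.of_nonneg hp).star_eq] at this

theorem dim_le_of_mem_rid {p a : Stab A} (hp : 0 ≤ p) (ha : 0 ≤ a) (h : p ∈ rid a) :
    τ.dim p ≤ τ.dim a := by
  have hps : star p = p := (IsSelfAdjoint.of_nonneg hp).star_eq
  have has : star a = a := (IsSelfAdjoint.of_nonneg ha).star_eq
  rw [← τ.dim_mul_self hp, ← τ.dim_mul_self ha]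
  have hpp : 0 ≤ p * p := by
    have := star_mul_self_nonneg p
    rwa [hps] at this
  have haa : 0 ≤ a * a := by
    have := star_mul_self_nonneg a
    rwa [has] at this
  refine τ.dim_le_of_cut hpp fun ε hε => ?_
  have hc : ContinuousAt (fun y : Stab A => ‖p * p - star y * y‖) p := by fun_prop
  have h0 : ‖p * p - star p * p‖ < ε := by rw [hps]; simpa using hε
  obtain ⟨y, hy, d, rfl⟩ := mem_closure_iff_nhds.1 h _ (hc.eventually (gt_mem_nhds h0))
  refine (τ.dim_cut_le_of_norm_sub_lt hpp (star_mul_self_nonneg _) hy).trans ?_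
  have e : star (a * d) * (a * d) = star d * (a * a) * d := by
    rw [star_mul, has]; noncomm_ring
  simp only [e]
  exact τ.dim_conj_le d haa

/-- The dimension of `(p - ε)₊` increases with `p`. -/
theorem dim_cut_le_dim_cut {p q : Stab A} (hp : 0 ≤ p) (hpq : p ≤ q) {ε : ℝ} (hε : 0 < ε) :
    τ.dim (cut ε p) ≤ τ.dim (cut ε q) := by
  have hq := hp.trans hpq
  have hps : IsSelfAdjoint p := .of_nonneg hp
  -- compress by `f = (p - ε)₊`
  set f := cut ε p with hf
  have hf0 : 0 ≤ f := cut_nonneg _ _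
  have hfs : star f = f := (IsSelfAdjoint.of_nonneg hf0).star_eq
  have hc : Continuous fun t : ℝ => max (t - ε) 0 := by fun_prop
  have hc0 : max ((0 : ℝ) - ε) 0 = 0 := max_eq_right (by linarith)
  have e1 : f * p * f = f * f * f + ε • (f * f) := by
    have hff : f * f = cfcₙ (fun t : ℝ => max (t - ε) 0 * max (t - ε) 0) p := by
      rw [hf, cut, cfcₙ_mul _ _ _ hc.continuousOn hc0 hc.continuousOn hc0]
    have h1 : f * p * f = cfcₙ (fun t : ℝ => max (t - ε) 0 * t * max (t - ε) 0) p := by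
      rw [cfcₙ_mul (fun t : ℝ => max (t - ε) 0 * t) _ p (by fun_prop) (by simp)
        hc.continuousOn hc0, cfcₙ_mul _ (fun t => t) p hc.continuousOn hc0 (by fun_prop) rfl,
        cfcₙ_id' ℝ p]
      rfl
    have h2 : f * f * f = cfcₙ (fun t : ℝ => max (t - ε) 0 * max (t - ε) 0 * max (t - ε) 0) p := by
      rw [cfcₙ_mul (fun t : ℝ => max (t - ε) 0 * max (t - ε) 0) _ p (by fun_prop) (by simp [hε.le])
        hc.continuousOn hc0, ← hff]
      rfl
    rw [h1, h2, hff, ← cfcₙ_smul ε _ p (by fun_prop) (by simp [hε.le]),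
      ← cfcₙ_add _ _ p (by fun_prop) (by simp [hε.le]) (by fun_prop) (by simp [hε.le])]
    congr 1
    funext t
    rcases le_total t ε with ht | ht
    · rw [max_eq_right (by linarith)]; simp
    · rw [max_eq_left (by linarith)]; simp only [smul_eq_mul]; ring
  have e2 : f * q * f ≤ f * cut ε q * f + ε • (f * f) := by
    have hqs : IsSelfAdjoint q := .of_nonneg hq
    set m := cfcₙ (fun t : ℝ => min t ε) q with hm
    have hqm : q = cut ε q + m := by
      rw [hm, cut, ← cfcₙ_add _ _ q hc.continuousOn hc0 (by fun_prop) (by simp [hε.le])]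
      conv_lhs => rw [← cfcₙ_id' ℝ q]
      congr 1
      funext t
      rcases le_total t ε with ht | ht
      · rw [max_eq_right (by linarith), min_eq_left ht, zero_add]
      · rw [max_eq_left (by linarith), min_eq_right ht, sub_add_cancel]
    have hms : IsSelfAdjoint m := cfcₙ_predicate _ q
    have hmn : ‖m‖ ≤ ε := by
      refine norm_cfcₙ_le fun t ht => ?_
      have ht0 := quasispectrum_nonneg_of_nonneg q hq t ht
      rw [Real.norm_of_nonneg (le_min ht0 hε.le)]
      exact min_le_right _ _
    have h1 : f * m * f ≤ ε • (f * f) := by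
      have := CStarAlgebra.star_left_conjugate_le_norm_smul (a := f) (b := m) hms
      rw [hfs] at this
      refine this.trans (smul_le_smul_of_nonneg_right hmn ?_)
      have := star_mul_self_nonneg f
      rwa [hfs] at this
    conv_lhs => rw [hqm]
    rw [mul_add, add_mul]
    exact add_le_add le_rfl h1
  have e3 : f * f * f ≤ f * cut ε q * f := by
    have h1 : f * p * f ≤ f * q * f := by
      have := star_left_conjugate_le_conjugate hpq f
      rwa [hfs] at this
    rw [e1] at h1
    exact le_of_add_le_add_right (h1.trans e2)
  have e4 : 0 ≤ f * f * f := by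
    have := star_left_conjugate_nonneg hf0 f
    rwa [hfs] at this
  have e5 : τ.dim f ≤ τ.dim (f * f * f) := by
    have h3 : f * f * f = cfcₙ (fun t : ℝ => t * t * t) f := by
      rw [cfcₙ_mul (fun t : ℝ => t * t) (fun t => t) f (by fun_prop) (by simp) (by fun_prop) rfl,
        cfcₙ_mul (fun t : ℝ => t) (fun t => t) f (by fun_prop) rfl (by fun_prop) rfl, cfcₙ_id' ℝ f]
    have hcr : Continuous fun t : ℝ => |t| ^ ((1 : ℝ) / 3) :=
      continuous_abs.rpow_const fun _ => Or.inr (by norm_num)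
    have h4 : f = cfcₙ (fun t : ℝ => |t| ^ ((1 : ℝ) / 3)) (f * f * f) := by
      rw [h3, ← cfcₙ_comp' (fun t : ℝ => |t| ^ ((1 : ℝ) / 3)) (fun t : ℝ => t * t * t) f
        hcr.continuousOn (by norm_num) (by fun_prop) (by simp)]
      conv_lhs => rw [← cfcₙ_id' ℝ f]
      refine cfcₙ_congr fun t ht => ?_
      have ht0 := quasispectrum_nonneg_of_nonneg f hf0 t ht
      rw [abs_of_nonneg (by positivity), show t * t * t = t ^ (3 : ℝ) by norm_cast; ring,
        ← Real.rpow_mul ht0]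
      norm_num
    conv_lhs => rw [h4]
    exact τ.dim_cfcₙ_le_dim hcr (by norm_num) e4
  refine e5.trans ((τ.dim_mono e4 e3).trans ?_)
  have := τ.dim_conj_le f (cut_nonneg ε q)
  rwa [hfs] at this

theorem rval_fEps_le_dim_cut {x : Stab A} (hx : 0 ≤ x) {κ : ℝ} (hκ : 0 < κ) :
    ENNReal.ofReal (τ.rval (cfcₙ (fEps (2 * κ)) x)) ≤ τ.dim (cut κ x) := by
  have hF : IsCutoff fun s => fEps (2 * κ) (s + κ) := by
    have := fEps_continuous (2 * κ)
    exact ⟨by fun_prop, κ, hκ, fun t ht => fEps_eq_zero (by linarith) (by linarith)⟩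
  have e : cfcₙ (fEps (2 * κ)) x = cfcₙ (fun s => fEps (2 * κ) (s + κ)) (cut κ x) := by
    unfold cut
    rw [← cfcₙ_comp' (fun s => fEps (2 * κ) (s + κ)) (fun t : ℝ => max (t - κ) 0) x
      hF.continuous.continuousOn hF.map_zero (by fun_prop) (max_eq_right (by linarith))]
    congr 1
    funext t
    rcases le_total t κ with ht | ht
    · rw [max_eq_right (by linarith), fEps_eq_zero (by linarith) (by linarith),
        fEps_eq_zero (by linarith) (by linarith)]
    · rw [max_eq_left (by linarith), sub_add_cancel]
  rw [e]
  exact τ.rval_le_dim hF (fun t _ => fEps_le_one _ _) (cut_nonneg _ _)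

theorem dim_cut_le_rval_fEps {x : Stab A} (hx : 0 ≤ x) {κ : ℝ} (hκ : 0 < κ) :
    τ.dim (cut (2 * κ) x) ≤ ENNReal.ofReal (τ.rval (cfcₙ (fEps κ) x)) :=
  τ.dim_cfcₙ_le (G := fun t : ℝ => max (t - 2 * κ) 0) (.fEps hκ) (fun t _ => fEps_nonneg _ _)
    (by fun_prop) (max_eq_right (by linarith)) (fun t _ h => (fEps_eq_one hκ (by
      by_contra hc
      rw [max_eq_right (by linarith)] at h
      exact lt_irrefl _ h)).ge) hx

theorem rval_fEps_nonneg {x : Stab A} (hx : 0 ≤ x) {κ : ℝ} (hκ : 0 < κ) :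
    0 ≤ τ.rval (cfcₙ (fEps κ) x) :=
  τ.rval_cfcₙ_nonneg (.fEps hκ) hx fun _ _ => fEps_nonneg _ _

end DenseQT

end Construction

section Stages

variable {A : Type u} [NonUnitalCStarAlgebra A] [PartialOrder A] [StarOrderedRing A]

namespace DenseQT

/-- `d_τ(x) ≤ d_τ((1-U)x(1-U)) + d_τ(U²)`. -/
theorem dim_le_add_dim_mul_self (τ : DenseQT A) {x U : Stab A} (hx : 0 ≤ x)
    (hU : IsSelfAdjoint U) :
    τ.dim x ≤ τ.dim (x - U * x - x * U + U * x * U) + τ.dim (U * U) := by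
  obtain ⟨v, hvs, -, hv⟩ := exists_sqrt hx
  have e1 : x = star (v - v * U + v * U) * (v - v * U + v * U) := by
    rw [sub_add_cancel, hvs.star_eq, hv]
  have e2 : star (v - v * U) * (v - v * U) = x - U * x - x * U + U * x * U := by
    rw [star_sub, star_mul, hvs.star_eq, hU.star_eq, ← hv]; noncomm_ring
  have hUU : 0 ≤ U * U := by
    have := star_mul_self_nonneg U
    rwa [hU.star_eq] at this
  have e3 : τ.dim (star (v * U) * (v * U)) ≤ τ.dim (U * U) := by
    rw [τ.dim_star_mul_self]
    have e : v * U * star (v * U) = star v * (U * U) * v := by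
      rw [star_mul, hvs.star_eq, hU.star_eq]; noncomm_ring
    rw [e]
    exact τ.dim_conj_le v hUU
  conv_lhs => rw [e1]
  refine (τ.dim_mono (star_mul_self_nonneg _) (star_add_mul_add_le _ _)).trans
    ((τ.dim_smul_le _ (add_nonneg (star_mul_self_nonneg _) (star_mul_self_nonneg _))).trans
    ((τ.dim_add_le (star_mul_self_nonneg _) (star_mul_self_nonneg _)).trans ?_))
  rw [e2]
  exact add_le_add le_rfl e3

set_option maxHeartbeats 400000 in
/-- If `b ≲ x`, then a copy of the spectral part of `b` above `κ` lives in the right ideal of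
`x`. -/
theorem exists_copy {b x : Stab A} (hb : 0 ≤ b) (hx : 0 ≤ x) (h : CuntzLE b x) {κ : ℝ}
    (hκ : 0 < κ) : ∃ e, 0 ≤ e ∧ e ∈ rid x ∧ (∀ τ : DenseQT A, τ.dim e ≤ τ.dim b) ∧
      ∀ τ : DenseQT A, ENNReal.ofReal (τ.rval (cfcₙ (fEps κ) b)) ≤ τ.dim (cut (1 / 2) e) := by
  obtain ⟨y, hy⟩ := h
  obtain ⟨k, hk⟩ := (hy.eventually (gt_mem_nhds (half_pos hκ))).exists
  obtain ⟨g, hgs, hg⟩ := exists_cut_le_conj hb (star_left_conjugate_nonneg hx (y k)) hk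
  obtain ⟨w, hws, hw0, hw⟩ := exists_sqrt hx
  have hle : cut (κ / 2) b ≤ star (w * (y k * g)) * (w * (y k * g)) := by
    refine hg.trans (le_of_eq ?_)
    rw [star_mul, star_mul, hws.star_eq, hgs.star_eq, ← hw]; noncomm_ring
  obtain ⟨z, hz, hzz⟩ := exists_eq_star_mul_self_of_le (cut_nonneg _ _) hle
  have hwx : w ∈ rid x := by
    have := self_mem_rid_mul_self hw0
    rwa [hw] at this
  have hzx : z ∈ rid x := rid_subset (mul_mem_rid hwx _) hz
  -- the ramp `ρ` is `1` where `f_κ(b)` lives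
  let ρ : ℝ → ℝ := fun t => min 1 (2 / κ * max t 0)
  have hρ : Continuous ρ := by fun_prop
  have hρ0 : ρ 0 = 0 := by simp [ρ]
  have hzs : 0 ≤ z * star z := mul_star_self_nonneg z
  refine ⟨cfcₙ ρ (z * star z), cfcₙ_nonneg fun t _ => le_min zero_le_one (by positivity),
    rid_subset (mul_mem_rid hzx _) (cfcₙ_mem_rid (.mul_star_self z) ρ hρ hρ0), fun τ => ?_,
    fun τ => ?_⟩
  · refine (τ.dim_cfcₙ_le_dim hρ hρ0 hzs).trans ?_
    rw [← τ.dim_star_mul_self, hzz]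
    exact τ.dim_cut_le _ (by positivity) hb
  · let H : ℝ → ℝ := fun s => fEps κ (s + κ / 2)
    have hH : IsCutoff H := by
      have := fEps_continuous κ
      exact ⟨by fun_prop, κ / 2, by positivity, fun t ht => fEps_eq_zero hκ (by linarith)⟩
    have e1 : cfcₙ (fEps κ) b = cfcₙ H (star z * z) := by
      rw [hzz, cut, ← cfcₙ_comp' H (fun t : ℝ => max (t - κ / 2) 0) b
        hH.continuous.continuousOn hH.map_zero (by fun_prop) (max_eq_right (by linarith))
        (IsSelfAdjoint.of_nonneg hb)]
      congr 1
      funext t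
      simp only [H]
      rcases le_total t (κ / 2) with ht | ht
      · rw [max_eq_right (by linarith), fEps_eq_zero hκ (by linarith),
          fEps_eq_zero hκ (by linarith)]
      · rw [max_eq_left (by linarith), sub_add_cancel]
    let G : ℝ → ℝ := fun s => fEps (1 / 4) (max (ρ s - 1 / 2) 0)
    have hGc : IsCutoff G := by
      refine (IsCutoff.fEps (ε := 1 / 4) (by norm_num)).comp_right
        (h := fun s => max (ρ s - 1 / 2) 0) (by fun_prop) fun κ' hκ' => ⟨κ / 4, by positivity, fun t ht => ?_⟩
      have : ρ t ≤ 1 / 2 := by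
        refine (min_le_right _ _).trans ?_
        have h1 : max t 0 ≤ κ / 4 := max_le ht (by positivity)
        calc 2 / κ * max t 0 ≤ 2 / κ * (κ / 4) := by gcongr
          _ = 1 / 2 := by field_simp; norm_num
      rw [max_eq_right (by linarith)]
      exact hκ'.le
    have e2 : cfcₙ G (z * star z) = cfcₙ (fEps (1 / 4)) (cut (1 / 2) (cfcₙ ρ (z * star z))) := by
      have hm : Continuous fun t : ℝ => max (t - 1 / 2) 0 := by fun_prop
      rw [cut, ← cfcₙ_comp' (fun t : ℝ => max (t - 1 / 2) 0) ρ (z * star z) hm.continuousOn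
        (by norm_num) hρ.continuousOn hρ0 (.mul_star_self z),
        ← cfcₙ_comp' (fEps (1 / 4)) (fun t => max (ρ t - 1 / 2) 0) (z * star z)
          (fEps_continuous _).continuousOn (fEps_zero (by norm_num)) (by fun_prop)
          (by simp [hρ0]) (.mul_star_self z)]
    rw [e1, τ.rval_cfcₙ_star_mul_self hH (fun t => fEps_nonneg _ _)]
    refine le_trans (ENNReal.ofReal_le_ofReal (τ.rval_cfcₙ_mono hH hGc hzs fun t _ => ?_))
      ((congrArg (fun x => ENNReal.ofReal (τ.rval x)) e2).le.trans
        (τ.rval_le_dim (.fEps (by norm_num)) (fun t _ => fEps_le_one _ _) (cut_nonneg _ _)))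
    simp only [H, G]
    rcases le_total t (κ / 2) with h' | h'
    · rw [fEps_eq_zero hκ (by linarith)]; exact fEps_nonneg _ _
    · have h1 : ρ t = 1 := by
        refine min_eq_left ?_
        rw [max_eq_left (by linarith)]
        calc (1 : ℝ) = 2 / κ * (κ / 2) := by field_simp
          _ ≤ _ := by gcongr
      rw [h1, fEps_eq_one (ε := 1 / 4) (t := max (1 - 1 / 2) 0) (by norm_num) (by norm_num)]
      exact fEps_le_one _ _

/-- Dini's theorem: if `d_τ(b)` is continuous in `τ`, then `τ(f_κ(b))` approximates it uniformly on
the closure of `QT(A)` for small `κ`. -/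
theorem exists_le_rval_fEps (hA : IsSimpleCStar A) {b : Stab A} (hb : 0 ≤ b) {g : DenseQT A → ℝ}
    (hg : Continuous g) (h : ∀ τ : DenseQT A, τ.dim b = ENNReal.ofReal (g τ)) {δ : ℝ}
    (hδ : 0 < δ) : ∃ κ > 0, ∀ τ ∈ closure (QT A), g τ ≤ τ.rval (cfcₙ (fEps κ) b) + δ := by
  let U : ℕ → Set (DenseQT A) := fun n =>
    {τ | g τ < τ.rval (cfcₙ (fEps (1 / ((n : ℝ) + 1))) b) + δ}
  have hU : ∀ n, IsOpen (U n) := fun n =>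
    isOpen_lt hg ((continuous_rval _).add continuous_const)
  have hpos : ∀ n : ℕ, 0 < 1 / ((n : ℝ) + 1) := fun n => Nat.one_div_pos_of_nat
  have hmono : Monotone U := by
    intro m n hmn τ hτ
    have hτ' : g τ < τ.rval (cfcₙ (fEps (1 / ((m : ℝ) + 1))) b) + δ := hτ
    refine hτ'.trans_le (add_le_add (τ.rval_fEps_mono (hpos n) ?_ hb) le_rfl)
    exact Nat.one_div_le_one_div hmn
  have hcov : closure (QT A) ⊆ ⋃ n, U n := by
    intro τ _
    rw [Set.mem_iUnion]
    rcases le_or_gt (g τ) 0 with h0 | h0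
    · exact ⟨0, by
        have := τ.rval_fEps_nonneg hb (hpos 0)
        change g τ < _
        linarith⟩
    · have h1 : ENNReal.ofReal (g τ - δ) < τ.dim b := by
        rw [h τ]
        exact (ENNReal.ofReal_lt_ofReal_iff h0).2 (by linarith)
      rw [dim_eq, lt_iSup_iff] at h1
      obtain ⟨n, hn⟩ := h1
      refine ⟨n, ?_⟩
      have := (ENNReal.ofReal_lt_ofReal_iff').1 hn
      change g τ < _
      linarith [this.1]
  obtain ⟨n, hn⟩ := (isCompact_closure_QT hA).elim_directed_cover U hU hcov
    (Monotone.directed_le hmono)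
  exact ⟨_, hpos n, fun τ hτ => (show g τ < _ from hn hτ).le⟩

end DenseQT

/-! ### Stages of increasing rank -/

/-- `τ ↦ (1 - 2^{-k}) τ(f_{2η/2^k}(a))`; these affine functions increase to `d_τ(a)`. -/
def lowerRank (a : Stab A) (η : ℝ) (k : ℕ) (τ : DenseQT A) : ℝ :=
  (1 - (1 / 2) ^ k) * τ.rval (cfcₙ (fEps (2 * (η * (1 / 2) ^ k))) a)

theorem half_pow_le_one (k : ℕ) : (1 / 2 : ℝ) ^ k ≤ 1 := pow_le_one₀ (by norm_num) (by norm_num)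

theorem lowerRank_nonneg {a : Stab A} (ha : 0 ≤ a) {η : ℝ} (hη : 0 < η) (k : ℕ) (τ : DenseQT A) :
    0 ≤ lowerRank a η k τ :=
  mul_nonneg (by linarith [half_pow_le_one k]) (τ.rval_fEps_nonneg ha (by positivity))

theorem isAff_lowerRank_sub (a : Stab A) (η : ℝ) (k : ℕ) :
    IsAff fun τ : DenseQT A => lowerRank a η (k + 1) τ - lowerRank a η k τ where
  continuous := (continuous_const.mul (DenseQT.continuous_rval _)).sub
    (continuous_const.mul (DenseQT.continuous_rval _))
  map_smul s τ := by
    simp only [lowerRank, DenseQT.rval_smul_apply]; ring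
  map_add σ τ := by
    simp only [lowerRank, DenseQT.rval_add_apply]; ring

theorem lowerRank_lt {a : Stab A} (hA : IsSimpleCStar A) (ha : 0 ≤ a) {η : ℝ} (hη : 0 < η)
    (hne : ∀ ε, 0 < ε → ε ≤ 4 * η → cfcₙ (fEps ε) a ≠ 0) (k : ℕ) {τ : DenseQT A} (hτ : τ ≠ 0) :
    0 < lowerRank a η (k + 1) τ - lowerRank a η k τ := by
  have hq : (0 : ℝ) < (1 / 2) ^ k := by positivity
  have hq1 := half_pow_le_one k
  have h1 : τ.rval (cfcₙ (fEps (2 * (η * (1 / 2) ^ k))) a)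
      ≤ τ.rval (cfcₙ (fEps (2 * (η * (1 / 2) ^ (k + 1)))) a) := by
    refine τ.rval_fEps_mono (by positivity) ?_ ha
    rw [pow_succ]
    nlinarith [mul_pos hη hq]
  have h2 : 0 < τ.rval (cfcₙ (fEps (2 * (η * (1 / 2) ^ (k + 1)))) a) := by
    have hpos : 0 < 2 * (η * (1 / 2) ^ (k + 1)) := by positivity
    have h3 := τ.dim_pos hA hτ (cfcₙ_fEps_nonneg (2 * (2 * (η * (1 / 2) ^ (k + 1)))) a)
      (hne _ (by positivity) (by rw [pow_succ]; nlinarith))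
    have h4 : τ.dim (cfcₙ (fEps (2 * (2 * (η * (1 / 2) ^ (k + 1))))) a)
        ≤ ENNReal.ofReal (τ.rval (cfcₙ (fEps (2 * (η * (1 / 2) ^ (k + 1)))) a)) :=
      τ.dim_cfcₙ_le (.fEps hpos) (fun t _ => fEps_nonneg _ _) (fEps_continuous _)
        (fEps_zero (by positivity)) (fun t _ h => (fEps_eq_one hpos (by
          by_contra hc
          rw [fEps_eq_zero (by positivity) (by linarith)] at h
          exact lt_irrefl _ h)).ge) ha
    exact ENNReal.ofReal_pos.1 (h3.trans_le h4)
  unfold lowerRank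
  have h3 : (1 - (1 / 2 : ℝ) ^ k) * τ.rval (cfcₙ (fEps (2 * (η * (1 / 2) ^ k))) a)
      ≤ (1 - (1 / 2) ^ k) * τ.rval (cfcₙ (fEps (2 * (η * (1 / 2) ^ (k + 1)))) a) :=
    mul_le_mul_of_nonneg_left h1 (by linarith)
  have h4 : (0 : ℝ) < (1 / 2) ^ k - (1 / 2) ^ (k + 1) := by rw [pow_succ]; linarith
  nlinarith [mul_pos h4 h2]

theorem lowerRank_lt_dim (hA : IsSimpleCStar A) {a : Stab A} (ha : 0 ≤ a) {η : ℝ} (hη : 0 < η)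
    (hne : ∀ ε, 0 < ε → ε ≤ 4 * η → cfcₙ (fEps ε) a ≠ 0) (k : ℕ) {τ : DenseQT A} (hτ : τ ≠ 0) :
    ENNReal.ofReal (lowerRank a η k τ) < τ.dim (cfcₙ (fEps (η * (1 / 2) ^ k)) a) := by
  have hpos : 0 < η * (1 / 2) ^ k := by positivity
  have hq : (0 : ℝ) < (1 / 2) ^ k := by positivity
  have hx := cfcₙ_fEps_nonneg (η * (1 / 2) ^ k) a
  have h0 := τ.dim_pos hA hτ hx (hne _ hpos (by nlinarith [half_pow_le_one k]))
  have hcomp : IsCutoff fun t => fEps (1 / 2) (fEps (η * (1 / 2) ^ k) t) :=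
    (IsCutoff.fEps hpos).comp_left (h := fEps (1 / 2)) (fEps_continuous _) (fEps_zero (by norm_num))
  have h1 : ENNReal.ofReal (τ.rval (cfcₙ (fEps (2 * (η * (1 / 2) ^ k))) a))
      ≤ τ.dim (cfcₙ (fEps (η * (1 / 2) ^ k)) a) := by
    refine le_trans (ENNReal.ofReal_le_ofReal (τ.rval_cfcₙ_mono (.fEps (by positivity)) hcomp ha
      fun t _ => ?_)) (le_trans (le_of_eq ?_) (τ.rval_le_dim (F := fEps (1 / 2))
        (.fEps (by norm_num)) (fun t _ => fEps_le_one _ _) hx))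
    · rcases le_total t (2 * (η * (1 / 2) ^ k)) with ht | ht
      · rw [fEps_eq_zero (by positivity) ht]; exact fEps_nonneg _ _
      · rw [fEps_eq_one hpos ht, fEps_eq_one (ε := 1 / 2) (t := 1) (by norm_num) (by norm_num)]
        exact fEps_le_one _ _
    · rw [← cfcₙ_comp' (fEps (1 / 2)) (fEps (η * (1 / 2) ^ k)) a (fEps_continuous _).continuousOn
        (fEps_zero (by norm_num)) (fEps_continuous _).continuousOn (fEps_zero hpos)]
  rcases (τ.rval_fEps_nonneg ha (show 0 < 2 * (η * (1 / 2) ^ k) by positivity)).eq_or_lt with h | h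
  · rw [lowerRank, ← h, mul_zero, ENNReal.ofReal_zero]
    exact h0
  · refine lt_of_lt_of_le ?_ h1
    rw [ENNReal.ofReal_lt_ofReal_iff h, lowerRank]
    nlinarith

/-- The `k`-th stage of the construction: a positive element `s` in `her a` whose rank is at most
`lowerRank a η k`, and such that, up to `δ`, this is also the rank of the spectral part of `s`
above `2^{-k-1} + 1/4`. -/
structure IsStage (a : Stab A) (η δ : ℝ) (k : ℕ) (s : Stab A) : Prop where
  nonneg : 0 ≤ s
  unit_mul : cfcₙ (fEps (η * (1 / 2) ^ k / 2)) a * s = s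
  dim_le : ∀ τ : DenseQT A, τ.dim s ≤ ENNReal.ofReal (lowerRank a η k τ)
  le_dim : ∀ τ ∈ closure (QT A), ENNReal.ofReal (lowerRank a η k τ)
    ≤ τ.dim (cut ((1 / 2) ^ (k + 1) + 1 / 4) s) + ENNReal.ofReal (δ * (1 - (1 / 2) ^ k))

theorem isStage_zero (a : Stab A) (η δ : ℝ) : IsStage a η δ 0 0 where
  nonneg := le_rfl
  unit_mul := mul_zero _
  dim_le τ := by rw [τ.dim_zero]; exact zero_le
  le_dim τ _ := by simp [lowerRank]

/-- The spectral part of `s` above `2^{-k-2}` is enlarged by an element `e` orthogonal to it, which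
hereditary surjectivity provides, of rank `lowerRank a η (k + 1) - lowerRank a η k`. -/
theorem IsStage.exists_next (hA : IsSimpleCStar A) (hΓ : HereditarySurjective A) {a : Stab A}
    (ha : 0 ≤ a) {η δ : ℝ} (hη : 0 < η) (hδ : 0 < δ)
    (hne : ∀ ε, 0 < ε → ε ≤ 4 * η → cfcₙ (fEps ε) a ≠ 0) {k : ℕ} {s : Stab A}
    (hs : IsStage a η δ k s) :
    ∃ e, 0 ≤ e ∧ cut ((1 / 2) ^ (k + 2)) s * e = 0 ∧
      IsStage a η δ (k + 1) (cut ((1 / 2) ^ (k + 2)) s + e) := by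
  set c : ℝ := (1 / 2) ^ (k + 2) with hc
  have hcpos : 0 < c := by positivity
  set η' := η * (1 / 2) ^ (k + 1) with hη'
  have hη'pos : 0 < η' := by positivity
  have hss : IsSelfAdjoint s := .of_nonneg hs.nonneg
  set x := cfcₙ (fEps η') a with hx
  have hx0 : 0 ≤ x := cfcₙ_fEps_nonneg _ _
  set E := cfcₙ (fEps (η' / 2)) a with hE
  have hEx : E * x = x := cfcₙ_fEps_mul_cfcₙ_fEps (by positivity) (by linarith) a
  have hEs : E * s = s := by
    have h1 : E * cfcₙ (fEps (η * (1 / 2) ^ k / 2)) a = cfcₙ (fEps (η * (1 / 2) ^ k / 2)) a :=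
      cfcₙ_fEps_mul_cfcₙ_fEps (by positivity) (by rw [hη', pow_succ]; linarith) a
    rw [← hs.unit_mul, ← mul_assoc, h1]
  let u : ℝ → ℝ := fun t => min 1 (1 / c * max t 0)
  have hu : Continuous u := by fun_prop
  have hu0 : u 0 = 0 := by simp [u]
  set U := cfcₙ u s with hU
  have hUs : IsSelfAdjoint U := cfcₙ_predicate _ s
  have hEU : E * U = U := mul_eq_of_mem_rid hEs (cfcₙ_mem_rid hss u hu hu0)
  set x' := x - U * x - x * U + U * x * U with hx'
  have hx'0 : 0 ≤ x' := by
    obtain ⟨v, hvs, -, hv⟩ := exists_sqrt hx0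
    have : x' = star (v - v * U) * (v - v * U) := by
      rw [star_sub, star_mul, hvs.star_eq, hUs.star_eq, hx', ← hv]; noncomm_ring
    rw [this]
    exact star_mul_self_nonneg _
  have hEx' : E * x' = x' := by
    rw [hx']
    simp only [mul_add, mul_sub, ← mul_assoc, hEx, hEU]
  have hcutU : cut c s * U = cut c s := by
    rw [cut, hU, ← cfcₙ_mul (fun t : ℝ => max (t - c) 0) u s (by fun_prop)
      (max_eq_right (by linarith)) hu.continuousOn hu0]
    congr 1
    funext t
    rcases le_total t c with ht | ht
    · rw [max_eq_right (by linarith), zero_mul]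
    · have : u t = 1 := by
        refine min_eq_left ?_
        rw [max_eq_left (by linarith)]
        calc (1 : ℝ) = 1 / c * c := by field_simp
          _ ≤ _ := by gcongr
      rw [this, mul_one]
  have hcutx' : cut c s * x' = 0 := by
    rw [hx']
    simp only [mul_add, mul_sub, ← mul_assoc, hcutU]
    abel
  have hdimU : ∀ τ : DenseQT A, τ.dim (U * U) ≤ ENNReal.ofReal (lowerRank a η k τ) := fun τ => by
    refine le_trans ?_ (hs.dim_le τ)
    rw [hU, ← cfcₙ_mul u u s hu.continuousOn hu0 hu.continuousOn hu0]
    exact τ.dim_cfcₙ_le_dim (by fun_prop) (by simp [hu0]) hs.nonneg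
  set g : DenseQT A → ℝ := fun τ => lowerRank a η (k + 1) τ - lowerRank a η k τ with hg
  have hgaff : IsAff g := isAff_lowerRank_sub a η k
  have hgpos : ∀ τ : DenseQT A, τ ≠ 0 → 0 < g τ := fun τ hτ => lowerRank_lt hA ha hη hne k hτ
  have hF : ∀ (j : ℕ) (τ : DenseQT A), 0 ≤ lowerRank a η j τ :=
    fun j τ => lowerRank_nonneg ha hη j τ
  have hlt : ∀ τ : DenseQT A, τ ≠ 0 → ENNReal.ofReal (g τ) < τ.dim x' := by
    intro τ hτ
    by_contra! hcon
    have h1 := lowerRank_lt_dim hA ha hη hne (k + 1) hτ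
    have h2 := (τ.dim_le_add_dim_mul_self hx0 hUs).trans (add_le_add hcon (hdimU τ))
    rw [← ENNReal.ofReal_add (hgpos τ hτ).le (hF k τ), hg] at h2
    simp only [sub_add_cancel] at h2
    exact absurd (h1.trans_le h2) (lt_irrefl _)
  obtain ⟨b, hb, hbx, hdb⟩ := hΓ x' hx'0 (fun τ => ENNReal.ofReal (g τ))
    ⟨fun _ => g, fun _ => ⟨hgaff, Or.inl hgpos⟩, fun _ _ => le_rfl, fun _ => tendsto_const_nhds⟩ hlt
  obtain ⟨κ, hκ, hκb⟩ := DenseQT.exists_le_rval_fEps hA hb hgaff.continuous hdb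
    (δ := δ * (1 / 2) ^ (k + 1)) (by positivity)
  obtain ⟨e, he0, hex', hedim, hecut⟩ := DenseQT.exists_copy hb hx'0 hbx hκ
  have horth : cut c s * e = 0 := mul_eq_zero_of_mem_rid hcutx' hex'
  have hcut0 : 0 ≤ cut c s := cut_nonneg _ _
  refine ⟨e, he0, horth, add_nonneg hcut0 he0, ?_, fun τ => ?_, fun τ hτ => ?_⟩
  · rw [mul_add]
    congr 1
    · exact mul_eq_of_mem_rid hEs
        (cfcₙ_mem_rid hss _ (by fun_prop) (max_eq_right (by linarith)))
    · exact mul_eq_of_mem_rid hEx' hex'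
  · rw [τ.dim_add_of_mul_eq_zero hcut0 he0 horth]
    have h1 : τ.dim (cut c s) ≤ ENNReal.ofReal (lowerRank a η k τ) :=
      (τ.dim_cut_le c hcpos.le hs.nonneg).trans (hs.dim_le τ)
    have h2 : τ.dim e ≤ ENNReal.ofReal (g τ) := (hedim τ).trans (hdb τ).le
    rcases le_or_gt 0 (g τ) with h0 | h0
    · calc τ.dim (cut c s) + τ.dim e ≤ _ := add_le_add h1 h2
        _ = ENNReal.ofReal (lowerRank a η (k + 1) τ) := by
          rw [← ENNReal.ofReal_add (hF k τ) h0]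
          simp only [hg]
          congr 1
          ring
    · have hτ : τ = 0 := by
        by_contra hτ
        exact absurd (hgpos τ hτ) (not_lt.2 h0.le)
      have hz : ∀ j, lowerRank a η j τ = 0 := fun j => by
        subst hτ
        have : ∀ y : Stab A, (0 : DenseQT A).rval y = 0 := fun y => by
          unfold DenseQT.rval
          split_ifs
          · rfl
          · rfl
        rw [lowerRank, this, mul_zero]
      simp only [hg, hz, sub_zero, lt_irrefl] at h0
  · set r : ℝ := (1 / 2) ^ (k + 1 + 1) with hr
    have hrc : r = c := rfl
    have hr4 : r ≤ 1 / 4 := by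
      rw [hr, pow_succ, pow_succ]
      linarith [half_pow_le_one k]
    have hrpos : 0 < r := by positivity
    have hcutc : Continuous fun t : ℝ => max (t - (r + 1 / 4)) 0 := by fun_prop
    have hcutc0 : max (0 - (r + 1 / 4)) 0 = 0 := max_eq_right (by linarith)
    have e1 : cut (r + 1 / 4) (cut c s + e) = cut (r + 1 / 4) (cut c s) + cut (r + 1 / 4) e :=
      cfcₙ_add_of_mul_eq_zero hcut0 he0 horth _ hcutc hcutc0
    have horth2 : cut (r + 1 / 4) (cut c s) * cut (r + 1 / 4) e = 0 :=
      cfcₙ_mul_eq_zero (.of_nonneg hcut0)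
        (mul_cfcₙ_eq_zero (.of_nonneg he0) horth _ hcutc hcutc0) _ hcutc hcutc0
    rw [e1, τ.dim_add_of_mul_eq_zero (cut_nonneg _ _) (cut_nonneg _ _) horth2,
      cut_add_cut (by linarith) hcpos.le]
    have e2 : r + 1 / 4 + c = (1 / 2) ^ (k + 1) + 1 / 4 := by
      rw [hr, hc, pow_succ, pow_succ]; ring
    rw [e2]
    have h1 := hs.le_dim τ hτ
    have h2 : ENNReal.ofReal (g τ) ≤ τ.dim (cut (r + 1 / 4) e)
        + ENNReal.ofReal (δ * (1 / 2) ^ (k + 1)) := by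
      calc ENNReal.ofReal (g τ)
          ≤ ENNReal.ofReal (τ.rval (cfcₙ (fEps κ) b) + δ * (1 / 2) ^ (k + 1)) :=
            ENNReal.ofReal_le_ofReal (hκb τ hτ)
        _ ≤ ENNReal.ofReal (τ.rval (cfcₙ (fEps κ) b)) + ENNReal.ofReal (δ * (1 / 2) ^ (k + 1)) :=
            ENNReal.ofReal_add_le
        _ ≤ _ := by
          refine add_le_add ((hecut τ).trans ?_) le_rfl
          have h3 : cut (1 / 2) e = cut (1 / 4 - r) (cut (r + 1 / 4) e) := by
            rw [cut_add_cut (by linarith) (by linarith)]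
            congr 1
            ring
          rw [h3]
          exact τ.dim_cut_le _ (by linarith) (cut_nonneg _ _)
    calc ENNReal.ofReal (lowerRank a η (k + 1) τ)
        = ENNReal.ofReal (lowerRank a η k τ + g τ) := by
          congr 1
          simp only [hg]
          ring
      _ ≤ ENNReal.ofReal (lowerRank a η k τ) + ENNReal.ofReal (g τ) := ENNReal.ofReal_add_le
      _ ≤ _ := add_le_add h1 h2
      _ = τ.dim (cut ((1 / 2) ^ (k + 1) + 1 / 4) s) + τ.dim (cut (r + 1 / 4) e)
          + (ENNReal.ofReal (δ * (1 - (1 / 2) ^ k)) + ENNReal.ofReal (δ * (1 / 2) ^ (k + 1))) := by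
          abel
      _ = _ := by
          rw [← ENNReal.ofReal_add (mul_nonneg hδ.le (by linarith [half_pow_le_one k]))
            (by positivity)]
          congr 2
          rw [pow_succ]
          ring

end Stages

section SmallOscillation

variable {A : Type u} [NonUnitalCStarAlgebra A] [PartialOrder A] [StarOrderedRing A]

/-! ### Approximants with small oscillation -/

/-- The ramp that is `0` up to `r_k = 2^{-k-1}` and `1` from `r_k + 1/4` on. -/
def stageRamp (k : ℕ) (t : ℝ) : ℝ := min 1 (4 * max (t - (1 / 2) ^ (k + 1)) 0)

theorem stageRamp_continuous (k : ℕ) : Continuous (stageRamp k) := by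
  unfold stageRamp; fun_prop

theorem stageRamp_zero (k : ℕ) : stageRamp k 0 = 0 := by simp [stageRamp]

theorem stageRamp_nonneg (k : ℕ) (t : ℝ) : 0 ≤ stageRamp k t := le_min zero_le_one (by positivity)

theorem stageRamp_le_one (k : ℕ) (t : ℝ) : stageRamp k t ≤ 1 := min_le_left _ _

theorem stageRamp_eq_one {k : ℕ} {t : ℝ} (h : (1 / 2) ^ (k + 1) + 1 / 4 ≤ t) :
    stageRamp k t = 1 := by
  refine min_eq_left ?_
  rw [max_eq_left (by linarith)]
  linarith

theorem stageRamp_succ (k : ℕ) (t : ℝ) :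
    stageRamp (k + 1) (max (t - (1 / 2) ^ (k + 2)) 0) = stageRamp k t := by
  have e : (1 / 2 : ℝ) ^ (k + 1) = (1 / 2) ^ (k + 2) + (1 / 2) ^ (k + 2) := by
    rw [pow_succ _ (k + 1)]; ring
  have hpos : (0 : ℝ) < (1 / 2) ^ (k + 2) := by positivity
  unfold stageRamp
  rw [e]
  rcases le_total t ((1 / 2) ^ (k + 2)) with ht | ht
  · rw [max_eq_right (by linarith : t - (1 / 2) ^ (k + 2) ≤ 0), max_eq_right (by linarith),
      max_eq_right (by linarith)]
  · rw [max_eq_left (by linarith : 0 ≤ t - (1 / 2) ^ (k + 2)), sub_sub]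

theorem sqrt_mul_sqrt_cfcₙ {a : Stab A} (ha : 0 ≤ a) :
    cfcₙ Real.sqrt a * cfcₙ Real.sqrt a = a := by
  rw [← cfcₙ_mul _ _ _ (by fun_prop) Real.sqrt_zero (by fun_prop) Real.sqrt_zero]
  conv_rhs => rw [← cfcₙ_id' ℝ a]
  exact cfcₙ_congr fun t ht => Real.mul_self_sqrt (quasispectrum_nonneg_of_nonneg a ha t ht)

/-- The approximant `a^{1/2} y a^{1/2}` of `a` given by the stage `s`, where `y` is
`stageRamp k (s)`. -/
def approximant (a : Stab A) (k : ℕ) (s : Stab A) : Stab A :=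
  cfcₙ Real.sqrt a * cfcₙ (stageRamp k) s * cfcₙ Real.sqrt a

theorem approximant_nonneg (a : Stab A) (k : ℕ) (s : Stab A) : 0 ≤ approximant a k s := by
  have h : IsSelfAdjoint (cfcₙ Real.sqrt a) := cfcₙ_predicate _ a
  have := star_left_conjugate_nonneg (cfcₙ_nonneg fun t _ => stageRamp_nonneg k t :
    0 ≤ cfcₙ (stageRamp k) s) (cfcₙ Real.sqrt a)
  rwa [h.star_eq] at this

namespace IsStage

variable {a : Stab A} {η δ : ℝ} {k : ℕ} {s : Stab A}

/-- With `q = 1 - (1-y)^{1/2}` and `z = a^{1/2}(1-q)`, the element `zz⋆` is `a - a^{1/2} y a^{1/2}`,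
while `z⋆z ∈ her a` is orthogonal to the part of `s` where `y = 1`. -/
theorem dim_sub_approximant_add_le (hs : IsStage a η δ k s) (ha : 0 ≤ a) (hη : 0 < η)
    (hδ : 0 < δ) :
    0 ≤ a - approximant a k s ∧ ∀ τ ∈ closure (QT A),
      τ.dim (a - approximant a k s) + ENNReal.ofReal (lowerRank a η k τ)
        ≤ τ.dim a + ENNReal.ofReal δ := by
  have has : IsSelfAdjoint a := .of_nonneg ha
  have hss : IsSelfAdjoint s := .of_nonneg hs.nonneg
  set v := cfcₙ Real.sqrt a with hv
  have hvs : star v = v := (cfcₙ_predicate _ a : IsSelfAdjoint v).star_eq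
  have hvv : v * v = a := sqrt_mul_sqrt_cfcₙ ha
  set y := cfcₙ (stageRamp k) s with hy
  let Q : ℝ → ℝ := fun t => 1 - Real.sqrt (1 - stageRamp k t)
  have hrc := stageRamp_continuous k
  have hQ : Continuous Q := by fun_prop
  have hQ0 : Q 0 = 0 := by simp [Q, stageRamp_zero]
  set q := cfcₙ Q s with hq
  have hqs : star q = q := (cfcₙ_predicate _ s : IsSelfAdjoint q).star_eq
  have hqy : q + q - q * q = y := by
    rw [hq, ← cfcₙ_mul _ _ _ hQ.continuousOn hQ0 hQ.continuousOn hQ0,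
      ← cfcₙ_add _ _ _ hQ.continuousOn hQ0 hQ.continuousOn hQ0,
      ← cfcₙ_sub _ _ _ (by fun_prop) (by simp [hQ0]) (by fun_prop) (by simp [hQ0])]
    congr 1
    funext t
    have := Real.mul_self_sqrt (sub_nonneg.2 (stageRamp_le_one k t))
    simp only [Q]
    linarith
  set z := v - v * q with hz
  have e1 : z * star z = a - approximant a k s := by
    rw [approximant, ← hv, ← hy, ← hqy, hz, star_sub, star_mul, hvs, hqs]
    conv_rhs => rw [← hvv]
    noncomm_ring
  have e2 : star z * z = a - q * a - a * q + q * a * q := by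
    rw [hz, star_sub, star_mul, hvs, hqs, ← hvv]; noncomm_ring
  set m := cut ((1 / 2) ^ (k + 1) + 1 / 4) s with hm
  have hmc : Continuous fun t : ℝ => max (t - ((1 / 2) ^ (k + 1) + 1 / 4)) 0 := by fun_prop
  have hmc0 : max ((0 : ℝ) - ((1 / 2) ^ (k + 1) + 1 / 4)) 0 = 0 :=
    max_eq_right (by have : (0 : ℝ) < (1 / 2) ^ (k + 1) := by positivity
                     linarith)
  have hm0 : 0 ≤ m := cut_nonneg _ _
  have hqm : q * m = m := by
    rw [hq, hm, cut, ← cfcₙ_mul _ _ _ hQ.continuousOn hQ0 hmc.continuousOn hmc0]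
    congr 1
    funext t
    rcases le_total t ((1 / 2) ^ (k + 1) + 1 / 4) with ht | ht
    · rw [max_eq_right (by linarith), mul_zero]
    · simp only [Q]
      rw [stageRamp_eq_one ht, sub_self, Real.sqrt_zero, sub_zero, one_mul]
  have horth : star z * z * m = 0 := by
    have : z * m = 0 := by rw [hz, sub_mul, mul_assoc, hqm, sub_self]
    rw [mul_assoc, this, mul_zero]
  have hsa : s ∈ rid a := by
    rw [← hs.unit_mul]
    exact mul_mem_rid (cfcₙ_mem_rid has _ (fEps_continuous _) (fEps_zero (by positivity))) _
  have hqa : q ∈ rid a := rid_subset hsa (cfcₙ_mem_rid hss Q hQ hQ0)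
  have hma : m ∈ rid a := rid_subset hsa (cfcₙ_mem_rid hss _ hmc hmc0)
  have hza : star z * z ∈ rid a := by
    rw [e2]
    exact add_mem_rid (sub_mem_rid (sub_mem_rid (self_mem_rid a) (mul_mem_rid hqa _))
      (mul_mem_rid_self _ _)) (by rw [mul_assoc]; exact mul_mem_rid hqa _)
  rw [← e1]
  refine ⟨mul_star_self_nonneg z, fun τ hτ => ?_⟩
  rw [← τ.dim_star_mul_self]
  calc τ.dim (star z * z) + ENNReal.ofReal (lowerRank a η k τ)
      ≤ τ.dim (star z * z) + (τ.dim m + ENNReal.ofReal (δ * (1 - (1 / 2) ^ k))) :=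
        add_le_add le_rfl (hs.le_dim τ hτ)
    _ = τ.dim (star z * z + m) + ENNReal.ofReal (δ * (1 - (1 / 2) ^ k)) := by
        rw [τ.dim_add_of_mul_eq_zero (star_mul_self_nonneg _) hm0 horth, add_assoc]
    _ ≤ τ.dim a + ENNReal.ofReal δ := by
        refine add_le_add (τ.dim_le_of_mem_rid (add_nonneg (star_mul_self_nonneg _) hm0) ha
          (add_mem_rid hza hma)) (ENNReal.ofReal_le_ofReal ?_)
        have : (0 : ℝ) < (1 / 2) ^ k := by positivity
        nlinarith

theorem approximant_mem_her (hs : IsStage a η δ k s) (ha : 0 ≤ a) (hη : 0 < η) :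
    approximant a k s ∈ her a := by
  have hss : IsSelfAdjoint s := .of_nonneg hs.nonneg
  set κ := η * (1 / 2) ^ k / 2 with hκ
  have hκpos : 0 < κ := by positivity
  set E := cfcₙ (fEps κ) a with hE
  have hEs : IsSelfAdjoint E := cfcₙ_predicate _ a
  have hfc := fEps_continuous κ
  have hf0 := fEps_zero hκpos
  set y := cfcₙ (stageRamp k) s with hy
  have hys : IsSelfAdjoint y := cfcₙ_predicate _ s
  have hEy : E * y = y := mul_eq_of_mem_rid hs.unit_mul
    (cfcₙ_mem_rid hss _ (stageRamp_continuous k) (stageRamp_zero k))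
  have hyE : y * E = y := by
    have := congrArg star hEy
    rwa [star_mul, hEs.star_eq, hys.star_eq] at this
  let h : ℝ → ℝ := fun t => fEps κ t * Real.sqrt t / max t κ
  have hh : Continuous h := by
    refine (hfc.mul Real.continuous_sqrt).div (by fun_prop) fun t => ?_
    exact (lt_max_of_lt_right hκpos).ne'
  have hh0 : h 0 = 0 := by simp [h]
  have hth : ∀ t, t * h t = fEps κ t * Real.sqrt t := by
    intro t
    rcases le_total t κ with ht | ht
    · simp [h, fEps_eq_zero hκpos ht]
    · simp only [h]
      rw [max_eq_left ht, mul_div_cancel₀ _ (hκpos.trans_le ht).ne']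
  have e1 : cfcₙ Real.sqrt a * E = a * cfcₙ h a := by
    rw [hE, ← cfcₙ_mul _ _ _ (by fun_prop) Real.sqrt_zero hfc.continuousOn hf0]
    conv_rhs => enter [1]; rw [← cfcₙ_id' ℝ a]
    rw [← cfcₙ_mul _ _ _ (by fun_prop) rfl hh.continuousOn hh0]
    congr 1
    funext t
    rw [hth, mul_comm]
  have e2 : E * cfcₙ Real.sqrt a = cfcₙ h a * a := by
    rw [hE, ← cfcₙ_mul _ _ _ hfc.continuousOn hf0 (by fun_prop) Real.sqrt_zero]
    conv_rhs => enter [2]; rw [← cfcₙ_id' ℝ a]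
    rw [← cfcₙ_mul _ _ _ hh.continuousOn hh0 (by fun_prop) rfl]
    congr 1
    funext t
    rw [mul_comm (h t), hth]
  refine subset_closure ⟨cfcₙ h a * y * cfcₙ h a, ?_⟩
  change a * (cfcₙ h a * y * cfcₙ h a) * a = cfcₙ Real.sqrt a * y * cfcₙ Real.sqrt a
  calc a * (cfcₙ h a * y * cfcₙ h a) * a = a * cfcₙ h a * y * (cfcₙ h a * a) := by noncomm_ring
    _ = cfcₙ Real.sqrt a * (E * y * E) * cfcₙ Real.sqrt a := by
        rw [← e1, ← e2]; noncomm_ring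
    _ = _ := by rw [hEy, hyE]

/-- The approximant is equivalent to `y^{1/2} a y^{1/2}`, which lies between multiples of `y`. -/
theorem approximant_dim_bounds (hs : IsStage a η δ k s) (ha : 0 ≤ a) (hη : 0 < η) (hδ : 0 < δ) :
    (∀ τ : DenseQT A, τ.dim (approximant a k s) ≤ ENNReal.ofReal (lowerRank a η k τ)) ∧
      ∃ ν > 0, ∀ τ ∈ closure (QT A), ENNReal.ofReal (lowerRank a η k τ)
        ≤ ENNReal.ofReal (τ.rval (cfcₙ (fEps ν) (approximant a k s))) + ENNReal.ofReal δ := by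
  have has : IsSelfAdjoint a := .of_nonneg ha
  have hss : IsSelfAdjoint s := .of_nonneg hs.nonneg
  set v := cfcₙ Real.sqrt a with hv
  have hvs : star v = v := (cfcₙ_predicate _ a : IsSelfAdjoint v).star_eq
  have hvv : v * v = a := sqrt_mul_sqrt_cfcₙ ha
  set y := cfcₙ (stageRamp k) s with hy
  have hrc := stageRamp_continuous k
  have hr0 := stageRamp_zero k
  have hy0 : 0 ≤ y := cfcₙ_nonneg fun t _ => stageRamp_nonneg k t
  have hys : y ∈ rid s := cfcₙ_mem_rid hss _ hrc hr0
  obtain ⟨u, hus, hu0, hu⟩ := exists_sqrt hy0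
  have hur : u ∈ rid s := by
    have := self_mem_rid_mul_self hu0
    rw [hu] at this
    exact rid_subset hys this
  have e1 : star (u * v) * (u * v) = approximant a k s := by
    rw [star_mul, hvs, hus.star_eq, approximant, ← hv, ← hy, ← hu]; noncomm_ring
  have e2 : u * v * star (u * v) = u * a * u := by
    rw [star_mul, hvs, hus.star_eq, ← hvv]; noncomm_ring
  have hc0 : 0 ≤ u * a * u := by rw [← e2]; exact mul_star_self_nonneg _
  refine ⟨fun τ => ?_, ?_⟩
  · rw [← e1, τ.dim_star_mul_self, e2]
    have h1 : u * a * u ≤ ‖a‖ • y := by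
      have := CStarAlgebra.star_left_conjugate_le_norm_smul (a := u) (b := a) has
      rwa [hus.star_eq, hu] at this
    calc τ.dim (u * a * u) ≤ τ.dim (‖a‖ • y) := τ.dim_mono hc0 h1
      _ ≤ τ.dim y := τ.dim_smul_le _ hy0
      _ ≤ τ.dim s := τ.dim_cfcₙ_le_dim hrc hr0 hs.nonneg
      _ ≤ _ := hs.dim_le τ
  · set κ := η * (1 / 2) ^ k / 2 with hκ
    have hκpos : 0 < κ := by positivity
    set E := cfcₙ (fEps κ) a with hE
    have hEu : E * u = u := mul_eq_of_mem_rid hs.unit_mul hur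
    have hEa : κ • E ≤ a := by
      rw [hE, ← cfcₙ_smul κ _ a (fEps_continuous κ).continuousOn (fEps_zero hκpos)]
      conv_rhs => rw [← cfcₙ_id' ℝ a]
      have hfc := fEps_continuous κ
      refine cfcₙ_mono (fun t ht => ?_) (by fun_prop) (by fun_prop)
        (by simp [fEps_zero hκpos]) rfl
      have ht0 := quasispectrum_nonneg_of_nonneg a ha t ht
      rcases le_total t κ with h' | h'
      · rw [fEps_eq_zero hκpos h', smul_zero]; exact ht0
      · rw [smul_eq_mul]
        nlinarith [fEps_le_one κ t]
    have hle : κ • y ≤ u * a * u := by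
      have := star_left_conjugate_le_conjugate hEa u
      rw [hus.star_eq, mul_smul_comm, smul_mul_assoc, mul_assoc u E, hEu, hu] at this
      exact this
    have hκy : 0 ≤ κ • y := smul_nonneg hκpos.le hy0
    refine ⟨κ / 4, by positivity, fun τ hτ => ?_⟩
    have h1 : τ.dim (cut ((1 / 2) ^ (k + 1) + 1 / 4) s) ≤ τ.dim (cut (κ / 2) (κ • y)) := by
      let G : ℝ → ℝ := fun t => max (κ * stageRamp k t - κ / 2) 0
      have hG : Continuous G := by fun_prop
      have hG0 : G 0 = 0 := max_eq_right (by rw [hr0]; linarith)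
      have e3 : cut (κ / 2) (κ • y) = cfcₙ G s := by
        rw [cut, hy, ← cfcₙ_smul κ _ s hrc.continuousOn hr0,
          ← cfcₙ_comp' (fun t : ℝ => max (t - κ / 2) 0) (fun t => κ • stageRamp k t) s
            (by fun_prop) (max_eq_right (by linarith)) (by fun_prop) (by simp [hr0])]
        rfl
      have hGs : 0 ≤ cfcₙ G s := cfcₙ_nonneg fun _ _ => le_max_right _ _
      have h2 : cut ((1 / 2) ^ (k + 1) + 1 / 4) s ≤ (2 * ‖s‖ / κ) • cfcₙ G s := by
        rw [cut, ← cfcₙ_smul (2 * ‖s‖ / κ) G s hG.continuousOn hG0]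
        refine cfcₙ_mono (fun t ht => ?_) (by fun_prop) (by fun_prop)
          (max_eq_right (by have : (0 : ℝ) < (1 / 2) ^ (k + 1) := by positivity
                            linarith)) (by simp [hG0])
        rcases le_total t ((1 / 2) ^ (k + 1) + 1 / 4) with h' | h'
        · rw [max_eq_right (by linarith)]
          have : 0 ≤ G t := le_max_right _ _
          rw [smul_eq_mul]
          positivity
        · have e4 : G t = κ / 2 := by
            simp only [G]
            rw [stageRamp_eq_one h', max_eq_left (by linarith)]
            ring
          have h5 := quasispectrum_le_norm hss ht
          have hp : (0 : ℝ) < (1 / 2) ^ (k + 1) := by positivity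
          rw [e4, smul_eq_mul, max_eq_left (by linarith),
            show 2 * ‖s‖ / κ * (κ / 2) = ‖s‖ by field_simp]
          linarith
      rw [e3]
      exact (τ.dim_mono (cut_nonneg _ _) h2).trans (τ.dim_smul_le _ hGs)
    have h2 : τ.dim (cut (κ / 2) (κ • y))
        ≤ ENNReal.ofReal (τ.rval (cfcₙ (fEps (κ / 4)) (approximant a k s))) := by
      rw [← e1, τ.rval_cfcₙ_star_mul_self (.fEps (by positivity)) (fun t => fEps_nonneg _ _), e2]
      refine (τ.dim_cut_le_dim_cut hκy hle (by positivity)).trans ?_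
      have := τ.dim_cut_le_rval_fEps hc0 (κ := κ / 4) (by positivity)
      rwa [show 2 * (κ / 4) = κ / 2 by ring] at this
    refine (hs.le_dim τ hτ).trans (add_le_add (h1.trans h2) (ENNReal.ofReal_le_ofReal ?_))
    have : (0 : ℝ) < (1 / 2) ^ k := by positivity
    nlinarith

end IsStage

theorem approximant_mono_step (a : Stab A) (k : ℕ) {s e : Stab A} (he : 0 ≤ e)
    (horth : cut ((1 / 2) ^ (k + 2)) s * e = 0) (hs : 0 ≤ s) :
    approximant a k s ≤ approximant a (k + 1) (cut ((1 / 2) ^ (k + 2)) s + e) := by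
  have hss : IsSelfAdjoint s := .of_nonneg hs
  have hpos : (0 : ℝ) < (1 / 2) ^ (k + 2) := by positivity
  have hle : cfcₙ (stageRamp k) s ≤ cfcₙ (stageRamp (k + 1)) (cut ((1 / 2) ^ (k + 2)) s + e) := by
    rw [cfcₙ_add_of_mul_eq_zero (cut_nonneg _ _) he horth _ (stageRamp_continuous _)
      (stageRamp_zero _), cut, ← cfcₙ_comp' (stageRamp (k + 1)) (fun t : ℝ => max (t - (1 / 2) ^ (k + 2)) 0) s
      (stageRamp_continuous _).continuousOn (stageRamp_zero _) (by fun_prop)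
      (max_eq_right (by linarith))]
    have : (fun t => stageRamp (k + 1) (max (t - (1 / 2) ^ (k + 2)) 0)) = stageRamp k :=
      funext (stageRamp_succ k)
    rw [this]
    exact le_add_of_nonneg_right (cfcₙ_nonneg fun t _ => stageRamp_nonneg _ t)
  have h : IsSelfAdjoint (cfcₙ Real.sqrt a) := cfcₙ_predicate _ a
  have := star_left_conjugate_le_conjugate hle (cfcₙ Real.sqrt a)
  rwa [h.star_eq] at this

theorem exists_stages (hA : IsSimpleCStar A) (hΓ : HereditarySurjective A) {a : Stab A}
    (ha : 0 ≤ a) {η δ : ℝ} (hη : 0 < η) (hδ : 0 < δ)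
    (hne : ∀ ε, 0 < ε → ε ≤ 4 * η → cfcₙ (fEps ε) a ≠ 0) :
    ∃ s : ℕ → Stab A, (∀ k, IsStage a η δ k (s k)) ∧
      Monotone fun k => approximant a k (s k) := by
  have step : ∀ (k : ℕ) (s : {s : Stab A // IsStage a η δ k s}),
      ∃ s' : {s : Stab A // IsStage a η δ (k + 1) s},
        approximant a k s.1 ≤ approximant a (k + 1) s'.1 := by
    rintro k ⟨s, hs⟩
    obtain ⟨e, he, horth, hs'⟩ := hs.exists_next hA hΓ ha hη hδ hne
    exact ⟨⟨_, hs'⟩, approximant_mono_step a k he horth hs.nonneg⟩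
  choose next hnext using step
  let seq : (k : ℕ) → {s : Stab A // IsStage a η δ k s} := fun k =>
    Nat.rec ⟨0, isStage_zero a η δ⟩ (fun k s => next k s) k
  exact ⟨fun k => (seq k).1, fun k => (seq k).2,
    monotone_nat_of_le_succ fun k => hnext k (seq k)⟩

/-- `τ(f_ε(a))` exhausts `d_τ(a)` along the sequence `lowerRank a η k`. -/
theorem exists_lt_lowerRank {a : Stab A} (ha : 0 ≤ a) {η : ℝ} (hη : 0 < η) (τ : DenseQT A)
    {δ : ℝ} (hδ : 0 < δ) (hfin : τ.dim a ≠ ⊤) :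
    ∃ k, τ.dim a < ENNReal.ofReal (lowerRank a η k τ) + ENNReal.ofReal δ := by
  have hδ' : ENNReal.ofReal (δ / 2) ≠ 0 := by simpa using hδ
  obtain ⟨n, hn⟩ : ∃ n : ℕ, τ.dim a ≤ ENNReal.ofReal
      (τ.rval (cfcₙ (fEps (1 / ((n : ℝ) + 1))) a)) + ENNReal.ofReal (δ / 2) := by
    by_contra! hcon
    have h1 : τ.dim a + ENNReal.ofReal (δ / 2) ≤ τ.dim a := by
      conv_lhs => rw [DenseQT.dim_eq, ENNReal.iSup_add]
      exact iSup_le fun n => (hcon n).le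
    exact absurd (ENNReal.lt_add_right hfin hδ') (not_lt.2 h1)
  set ε := 1 / ((n : ℝ) + 1)
  have hε : 0 < ε := Nat.one_div_pos_of_nat
  set R := τ.rval (cfcₙ (fEps ε) a)
  have hR : 0 ≤ R := τ.rval_fEps_nonneg ha hε
  have hlim : Tendsto (fun k : ℕ => (1 / 2 : ℝ) ^ k) atTop (𝓝 0) :=
    tendsto_pow_atTop_nhds_zero_of_lt_one (by norm_num) (by norm_num)
  have h1 := hlim.eventually (gt_mem_nhds (show 0 < ε / (2 * η) by positivity))
  have h2 := hlim.eventually (gt_mem_nhds (show 0 < δ / 2 / (R + 1) by positivity))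
  obtain ⟨k, hk1, hk2⟩ := (h1.and h2).exists
  rw [lt_div_iff₀ (by positivity)] at hk1 hk2
  refine ⟨k, ?_⟩
  have h3 : R ≤ τ.rval (cfcₙ (fEps (2 * (η * (1 / 2) ^ k))) a) :=
    τ.rval_fEps_mono (by positivity) (by linarith) ha
  have hp : (0 : ℝ) < (1 / 2) ^ k := by positivity
  have h4 : R + δ / 2 < lowerRank a η k τ + δ := by
    have : (1 - (1 / 2) ^ k) * R ≤ lowerRank a η k τ :=
      mul_le_mul_of_nonneg_left h3 (by linarith [half_pow_le_one k])
    nlinarith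
  rw [← ENNReal.ofReal_add hR (by positivity)] at hn
  rw [← ENNReal.ofReal_add (lowerRank_nonneg ha hη k τ) hδ.le]
  exact hn.trans_lt ((ENNReal.ofReal_lt_ofReal_iff (by
    have := lowerRank_nonneg ha hη k τ
    positivity)).2 h4)

/-- The values `τ(w²)` are small if the spectral part of `w` above `κ` has small rank. -/
theorem DenseQT.ext_mul_self_le (τ : DenseQT A) {w : Stab A} (hw : 0 ≤ w) {M κ d C : ℝ}
    (hM : ‖w‖ ≤ M) (hκ : 0 < κ) (hd : 0 ≤ d) (hC : 0 ≤ C)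
    (h1 : τ.dim (cut κ w) ≤ ENNReal.ofReal d) (h2 : τ.dim w ≤ ENNReal.ofReal C) :
    τ.ext (w * w) ≤ ENNReal.ofReal (M ^ 2 * d + (4 * κ) ^ 2 * C) := by
  have hM0 : 0 ≤ M := (norm_nonneg _).trans hM
  have hws : IsSelfAdjoint w := .of_nonneg hw
  unfold ext
  refine iSup_le fun ⟨ε, hε⟩ => ?_
  rw [val_eq]
  refine ENNReal.ofReal_le_ofReal ?_
  change τ.rval (cfcₙ (fun t : ℝ => max (t - ε) 0) (w * w)) ≤ _
  -- on `[0, M]` the function `(t² - ε)₊` is at most `M² f_{2κ} + 16κ² f_λ` with `2λ = √ε`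
  have e1 : cfcₙ (fun t : ℝ => max (t - ε) 0) (w * w) = cfcₙ (fun t => max (max t 0 * max t 0 - ε) 0) w := by
    have e : w * w = cfcₙ (fun t : ℝ => t * t) w := by
      rw [cfcₙ_mul (fun t : ℝ => t) (fun t => t) w (by fun_prop) rfl (by fun_prop) rfl,
        cfcₙ_id' ℝ w]
    rw [e, ← cfcₙ_comp' (fun t : ℝ => max (t - ε) 0) (fun t : ℝ => t * t) w (by fun_prop)
      (max_eq_right (by linarith)) (by fun_prop) (by simp)]
    refine cfcₙ_congr fun t ht => ?_
    have ht0 := quasispectrum_nonneg_of_nonneg w hw t ht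
    rw [max_eq_left ht0]
  have e2 : cfcₙ (fun t : ℝ => max (max t 0 * max t 0 - ε) 0) w
      = cfcₙ (fun t => max (min (max t 0) M * min (max t 0) M - ε) 0) w := by
    refine cfcₙ_congr fun t ht => ?_
    have ht0 := quasispectrum_nonneg_of_nonneg w hw t ht
    have htM := (quasispectrum_le_norm hws ht).trans hM
    rw [max_eq_left ht0, min_eq_left htM]
  have hsq : 0 < Real.sqrt ε := Real.sqrt_pos.2 hε
  set lam := Real.sqrt ε / 2 with hlam
  have hlampos : 0 < lam := by positivity
  have hlam2 : (2 * lam) * (2 * lam) = ε := by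
    rw [hlam, show 2 * (Real.sqrt ε / 2) = Real.sqrt ε by ring, Real.mul_self_sqrt hε.le]
  have hg : IsCutoff fun t : ℝ => max (min (max t 0) M * min (max t 0) M - ε) 0 := by
    refine ⟨by fun_prop, lam, hlampos, fun t ht => max_eq_right ?_⟩
    have h3 : min (max t 0) M ≤ lam := (min_le_left _ _).trans (max_le ht hlampos.le)
    have h4 : 0 ≤ min (max t 0) M := le_min (le_max_right _ _) hM0
    nlinarith
  have hF1 : IsCutoff fun t => M ^ 2 * fEps (2 * κ) t := (IsCutoff.fEps (by positivity)).const_mul _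
  have hF2 : IsCutoff fun t => (4 * κ) ^ 2 * fEps lam t := (IsCutoff.fEps hlampos).const_mul _
  rw [e1, e2]
  refine (τ.rval_cfcₙ_mono hg (hF1.add hF2) hw fun t ht => ?_).trans ?_
  · rw [max_eq_left ht]
    have h3 : 0 ≤ min t M := le_min ht hM0
    have h4 : min t M ≤ M := min_le_right _ _
    have h5 : min t M ≤ t := min_le_left _ _
    have n1 : 0 ≤ M ^ 2 * fEps (2 * κ) t := mul_nonneg (sq_nonneg _) (fEps_nonneg _ _)
    have n2 : 0 ≤ (4 * κ) ^ 2 * fEps lam t := mul_nonneg (sq_nonneg _) (fEps_nonneg _ _)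
    refine max_le ?_ (by positivity)
    rcases le_total t (2 * lam) with h' | h'
    · nlinarith
    · rw [fEps_eq_one hlampos h'] at n2 ⊢
      rcases le_total t (4 * κ) with h6 | h6
      · nlinarith
      · rw [fEps_eq_one (by positivity) (by linarith)] at n1 ⊢
        nlinarith
  · rw [τ.rval_cfcₙ_add hF1 hF2, τ.rval_cfcₙ_const_mul (.fEps (by positivity)),
      τ.rval_cfcₙ_const_mul (.fEps hlampos)]
    have h3 : τ.rval (cfcₙ (fEps (2 * κ)) w) ≤ d :=
      (ENNReal.ofReal_le_ofReal_iff hd).1 ((τ.rval_fEps_le_dim_cut hw hκ).trans h1)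
    have h4 : τ.rval (cfcₙ (fEps lam) w) ≤ C :=
      (ENNReal.ofReal_le_ofReal_iff hC).1
        ((τ.rval_le_dim (.fEps hlampos) (fun t _ => fEps_le_one _ _) hw).trans h2)
    gcongr

/-- Hereditary surjectivity gives tracial approximate oscillation zero for all positive elements of
the Pedersen ideal. -/
theorem allElementsTAOZ (hA : IsSimpleCStar A) (hΓ : HereditarySurjective A) :
    AllElementsTAOZ A := by
  intro a haP ha ε hε
  rcases eq_or_ne a 0 with rfl | ha0
  · refine ⟨0, subset_closure ⟨0, by simp⟩, le_rfl, ?_, le_rfl, ?_⟩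
    · have : twoNorm (0 - 0 : Stab A) ≤ 0 := by
        refine iSup₂_le fun τ _ => ?_
        have h := τ.ext_mul_self_le (w := 0) le_rfl (M := 0) (κ := 1) (d := 0) (C := 0)
          (by simp) one_pos le_rfl le_rfl (by simp [cut, cfcₙ_apply_zero, τ.dim_zero])
          (by simp [τ.dim_zero])
        rw [sub_self, star_zero]
        simp only [mul_zero, ne_eq, OfNat.ofNat_ne_zero, not_false_eq_true, zero_pow,
          add_zero, ENNReal.ofReal_zero, nonpos_iff_eq_zero] at h
        rw [mul_zero, h]
        simp
      exact this.trans_lt (by simpa using hε)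
    · refine lt_of_le_of_lt (iInf_le _ 0) (lt_of_le_of_lt (b := 0) ?_ (by simpa using hε))
      refine iSup₂_le fun τ _ => ?_
      rw [τ.dim_zero, zero_tsub]
  obtain ⟨ε₀, hε₀, hne⟩ := exists_cfcₙ_fEps_ne_zero ha ha0
  obtain ⟨C, hC⟩ := DenseQT.dim_ne_top_of_mem_pedersen hA haP ha
  have hCS : ∀ τ ∈ closure (QT A), τ.dim a ≤ ENNReal.ofReal C := fun τ hτ => by
    rw [ENNReal.ofReal_coe_nnreal]
    refine (hC τ).trans ?_
    calc (C : ℝ≥0∞) * τ.normOn ≤ C * 1 :=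
          mul_le_mul' le_rfl (DenseQT.normOn_le_one_of_mem_closure hτ)
      _ = C := mul_one _
  set M := ‖a‖ with hM
  have hM0 : 0 ≤ M := norm_nonneg _
  obtain ⟨δ, hδ, hδε, hδM⟩ : ∃ δ > 0, δ < ε ∧ M ^ 2 * (2 * δ) ≤ ε ^ 2 / 8 := by
    refine ⟨min (ε / 2) (ε ^ 2 / 16 / (M ^ 2 + 1)), by positivity,
      (min_le_left _ _).trans_lt (by linarith), ?_⟩
    have h1 : min (ε / 2) (ε ^ 2 / 16 / (M ^ 2 + 1)) * (M ^ 2 + 1) ≤ ε ^ 2 / 16 := by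
      rw [← le_div_iff₀ (by positivity)]
      exact min_le_right _ _
    have h2 : 0 ≤ min (ε / 2) (ε ^ 2 / 16 / (M ^ 2 + 1)) := by positivity
    nlinarith
  obtain ⟨κ, hκ, hκC⟩ : ∃ κ > 0, (4 * κ) ^ 2 * (C : ℝ) ≤ ε ^ 2 / 8 := by
    have hC0 : (0 : ℝ) ≤ C := C.2
    have hlim : Tendsto (fun κ : ℝ => (4 * κ) ^ 2 * (C : ℝ)) (𝓝[>] 0) (𝓝 0) := by
      have : Continuous fun κ : ℝ => (4 * κ) ^ 2 * (C : ℝ) := by fun_prop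
      have := this.tendsto 0
      simp only [mul_zero, ne_eq, OfNat.ofNat_ne_zero, not_false_eq_true, zero_pow,
        zero_mul] at this
      exact this.mono_left nhdsWithin_le_nhds
    obtain ⟨κ, h1, h2⟩ := ((hlim.eventually (gt_mem_nhds (show 0 < ε ^ 2 / 8 by positivity))).and
      self_mem_nhdsWithin).exists
    exact ⟨κ, h2, h1.le⟩
  have hη : 0 < ε₀ / 4 := by positivity
  obtain ⟨s, hs, hmono⟩ := exists_stages hA hΓ ha hη hδ
    (fun ε' h1 h2 => hne ε' h1 (by linarith))
  set η := ε₀ / 4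
  let w : ℕ → Stab A := fun k => a - approximant a k (s k)
  have hw0 : ∀ k, 0 ≤ w k := fun k => ((hs k).dim_sub_approximant_add_le ha hη hδ).1
  have hwmono : ∀ j k, j ≤ k → w k ≤ w j := fun j k hjk => sub_le_sub_left (hmono hjk) a
  -- compactness yields a stage `k` for which `w k` has small rank above `κ` everywhere
  let V : ℕ → Set (DenseQT A) := fun j => {τ | τ.rval (cfcₙ (fEps (κ / 2)) (w j)) < 2 * δ}
  have hV : ∀ j, IsOpen (V j) := fun j => isOpen_lt (DenseQT.continuous_rval _) continuous_const
  have hcov : closure (QT A) ⊆ ⋃ k, ⋃ j ≤ k, V j := by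
    intro τ hτ
    have hfin : τ.dim a ≠ ⊤ := ((hCS τ hτ).trans_lt ENNReal.ofReal_lt_top).ne
    obtain ⟨j, hj⟩ := exists_lt_lowerRank ha hη τ hδ hfin
    simp only [Set.mem_iUnion]
    refine ⟨j, j, le_rfl, ?_⟩
    have h1 := ((hs j).dim_sub_approximant_add_le ha hη hδ).2 τ hτ
    have h2 : τ.dim (w j) < ENNReal.ofReal (2 * δ) := by
      have h3 := h1.trans_lt (ENNReal.add_lt_add_right ENNReal.ofReal_ne_top hj)
      rw [add_assoc, ← ENNReal.ofReal_add hδ.le hδ.le, ← two_mul, add_comm] at h3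
      exact (ENNReal.add_lt_add_iff_left ENNReal.ofReal_ne_top).1 h3
    have h3 := (τ.rval_le_dim (.fEps (show 0 < κ / 2 by positivity)) (fun t _ => fEps_le_one _ _)
      (hw0 j)).trans_lt h2
    exact (ENNReal.ofReal_lt_ofReal_iff (by positivity)).1 h3
  obtain ⟨k, hk⟩ := (DenseQT.isCompact_closure_QT hA).elim_directed_cover
    (fun k => ⋃ j ≤ k, V j) (fun k => isOpen_biUnion fun j _ => hV j) hcov
    (Monotone.directed_le fun m n hmn =>
      Set.biUnion_subset_biUnion_left fun j (hj : j ≤ m) => hj.trans hmn)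
  have hsmall : ∀ τ ∈ closure (QT A), τ.dim (cut κ (w k)) ≤ ENNReal.ofReal (2 * δ) := by
    intro τ hτ
    obtain ⟨j, hjk, hj⟩ : ∃ j ≤ k, τ ∈ V j := by simpa using hk hτ
    refine (τ.dim_cut_le_dim_cut (hw0 k) (hwmono j k hjk) hκ).trans ?_
    have h1 := τ.dim_cut_le_rval_fEps (hw0 j) (κ := κ / 2) (by positivity)
    rw [show 2 * (κ / 2) = κ by ring] at h1
    exact h1.trans (ENNReal.ofReal_le_ofReal (le_of_lt hj))
  have hc0 := approximant_nonneg a k (s k)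
  have hca : approximant a k (s k) ≤ a := sub_nonneg.1 (hw0 k)
  have hwa : w k ≤ a := sub_le_self _ hc0
  refine ⟨approximant a k (s k), (hs k).approximant_mem_her ha hη, hc0, ?_,
    CStarAlgebra.norm_le_norm_of_nonneg_of_le hc0 hca, ?_⟩
  · refine lt_of_le_of_lt (b := ENNReal.ofReal (ε / 2)) (iSup₂_le fun τ hτ => ?_)
      ((ENNReal.ofReal_lt_ofReal_iff hε).2 (by linarith))
    have h1 := τ.ext_mul_self_le (hw0 k) (M := M) (κ := κ) (d := 2 * δ) (C := C)
      (CStarAlgebra.norm_le_norm_of_nonneg_of_le (hw0 k) hwa) hκ (by positivity) C.2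
      (hsmall τ hτ) ((τ.dim_mono (hw0 k) hwa).trans (hCS τ hτ))
    have h2 : τ.ext (star (a - approximant a k (s k)) * (a - approximant a k (s k)))
        ≤ ENNReal.ofReal ((ε / 2) ^ 2) := by
      rw [(IsSelfAdjoint.of_nonneg (hw0 k)).star_eq]
      exact h1.trans (ENNReal.ofReal_le_ofReal (by nlinarith))
    calc _ ≤ ENNReal.ofReal ((ε / 2) ^ 2) ^ (1 / 2 : ℝ) := ENNReal.rpow_le_rpow h2 (by norm_num)
      _ = ENNReal.ofReal (ε / 2) := by
        rw [ENNReal.ofReal_rpow_of_nonneg (by positivity) (by norm_num), ← Real.sqrt_eq_rpow,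
          Real.sqrt_sq (by positivity)]
  · obtain ⟨hup, ν, hν, hlow⟩ := (hs k).approximant_dim_bounds ha hη hδ
    obtain ⟨n, hn⟩ := exists_nat_one_div_lt hν
    refine lt_of_le_of_lt (iInf_le _ n) (lt_of_le_of_lt (b := ENNReal.ofReal δ)
      (iSup₂_le fun τ hτ => ?_) ((ENNReal.ofReal_lt_ofReal_iff hε).2 hδε))
    rw [tsub_le_iff_left, DenseQT.val_eq]
    refine (hup τ).trans ((hlow τ hτ).trans (add_le_add (ENNReal.ofReal_le_ofReal ?_) le_rfl))
    exact τ.rval_fEps_mono Nat.one_div_pos_of_nat hn.le hc0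

end SmallOscillation

/-! ### Hereditary subalgebras and the isomorphism given by a polar decomposition -/

section Hereditary

variable {D : Type u} [NonUnitalCStarAlgebra D] [PartialOrder D] [StarOrderedRing D]

/-- The hereditary C⋆-subalgebra of the `x` such that `x` and `x⋆` belong to the closed right ideal
generated by `r`. -/
def herAlg (r : D) : NonUnitalStarSubalgebra ℂ D where
  carrier := {x | x ∈ rid r ∧ star x ∈ rid r}
  add_mem' hx hy := ⟨add_mem_rid hx.1 hy.1, by rw [star_add]; exact add_mem_rid hx.2 hy.2⟩
  zero_mem' := ⟨zero_mem_rid r, by rw [star_zero]; exact zero_mem_rid r⟩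
  mul_mem' hx hy := ⟨mul_mem_rid hx.1 _, by rw [star_mul]; exact mul_mem_rid hy.2 _⟩
  smul_mem' c x hx := ⟨smul_mem_rid c hx.1, by rw [star_smul]; exact smul_mem_rid _ hx.2⟩
  star_mem' hx := ⟨hx.2, by rw [star_star]; exact hx.1⟩

theorem mem_herAlg {r x : D} : x ∈ herAlg r ↔ x ∈ rid r ∧ star x ∈ rid r := Iff.rfl

theorem isClosed_herAlg (r : D) : IsClosed (herAlg r : Set D) :=
  (isClosed_rid r).inter ((isClosed_rid r).preimage continuous_star)

theorem herAlg_eq_of_rid_eq {r s : D} (h : rid r = rid s) : herAlg r = herAlg s := by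
  ext x
  rw [mem_herAlg, mem_herAlg, h]

theorem herAlg_eq_top {r : D} (h : rid r = Set.univ) : herAlg r = ⊤ := by
  ext x
  rw [mem_herAlg, h]
  simp

/-- Conjugation by the polar approximations converges on `herAlg r⋆`, with limit in `herAlg r`. -/
theorem exists_tendsto_polarSeq_conj {r b : D} (hb : b ∈ herAlg (star r)) :
    ∃ y ∈ herAlg r,
      Tendsto (fun n => polarSeq r n * b * star (polarSeq r n)) atTop (𝓝 y) := by
  have key : ∀ w ∈ rid (star r), CauchySeq fun n => polarSeq r n * w := fun w hw =>
    cauchySeq_mul_of_mem_rid (norm_polarSeq_le_one r) (cauchySeq_polarSeq_mul_star r) hw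
  obtain ⟨v, hv⟩ := cauchySeq_tendsto_of_complete (key b hb.1)
  have hv' : star v ∈ rid (star r) := by
    refine (isClosed_rid _).mem_of_tendsto hv.star (Eventually.of_forall fun n => ?_)
    rw [star_mul]
    exact mul_mem_rid hb.2 _
  obtain ⟨z, hz⟩ := cauchySeq_tendsto_of_complete (key _ hv')
  have hlim : Tendsto (fun n => polarSeq r n * b * star (polarSeq r n)) atTop (𝓝 (star z)) := by
    have h1 : Tendsto (fun n => (polarSeq r n * b - v) * star (polarSeq r n)) atTop (𝓝 0) := by
      refine squeeze_zero_norm (fun n => ?_) (tendsto_iff_norm_sub_tendsto_zero.1 hv)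
      refine (norm_mul_le _ _).trans ?_
      rw [norm_star]
      exact mul_le_of_le_one_right (norm_nonneg _) (norm_polarSeq_le_one r n)
    have h2 := h1.add hz.star
    rw [zero_add] at h2
    refine h2.congr fun n => ?_
    rw [star_mul, star_star]
    noncomm_ring
  have hmem : ∀ c, Tendsto (fun n => polarSeq r n * c * star (polarSeq r n)) atTop (𝓝 (star z)) →
      star z ∈ rid r := fun c hc =>
    (isClosed_rid r).mem_of_tendsto hc (Eventually.of_forall fun n => by
      rw [mul_assoc]; exact polarSeq_mul_mem_rid r n _)
  refine ⟨star z, ⟨hmem b hlim, ?_⟩, hlim⟩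
  refine (isClosed_rid r).mem_of_tendsto hlim.star (Eventually.of_forall fun n => ?_)
  rw [star_mul, star_star]
  exact polarSeq_mul_mem_rid r n _

theorem tendsto_polarSeq_conj_mul {r b c y z : D} (hc : c ∈ herAlg (star r))
    (hy : Tendsto (fun n => polarSeq r n * b * star (polarSeq r n)) atTop (𝓝 y))
    (hz : Tendsto (fun n => polarSeq r n * c * star (polarSeq r n)) atTop (𝓝 z)) :
    Tendsto (fun n => polarSeq r n * (b * c) * star (polarSeq r n)) atTop (𝓝 (y * z)) := by
  have h1 := (tendsto_iff_norm_sub_tendsto_zero.1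
    (tendsto_star_polarSeq_mul_of_mem hc.1)).const_mul ‖b‖
  rw [mul_zero] at h1
  have h2 : Tendsto (fun n => polarSeq r n * (b * (star (polarSeq r n) * (polarSeq r n * c) - c))
      * star (polarSeq r n)) atTop (𝓝 0) := by
    refine squeeze_zero_norm (fun n => ?_) h1
    refine (norm_mul_le _ _).trans ?_
    rw [norm_star]
    refine (mul_le_of_le_one_right (norm_nonneg _) (norm_polarSeq_le_one r n)).trans ?_
    refine (norm_mul_le _ _).trans ?_
    refine (mul_le_of_le_one_left (norm_nonneg _) (norm_polarSeq_le_one r n)).trans ?_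
    exact norm_mul_le _ _
  have h3 := (hy.mul hz).sub h2
  rw [sub_zero] at h3
  refine h3.congr fun n => ?_
  noncomm_ring

/-- Conjugating by `polarSeq r` and then by `polarSeq r⋆` is asymptotically the identity. -/
theorem tendsto_polarSeq_star_conj {r b y : D} (hb : b ∈ herAlg (star r))
    (hy : Tendsto (fun n => polarSeq r n * b * star (polarSeq r n)) atTop (𝓝 y)) :
    Tendsto (fun n => polarSeq (star r) n * y * star (polarSeq (star r) n)) atTop (𝓝 b) := by
  simp_rw [← star_polarSeq, star_star]
  have h1 : Tendsto (fun n => star (polarSeq r n) *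
      (polarSeq r n * b * star (polarSeq r n) - y) * polarSeq r n) atTop (𝓝 0) := by
    refine squeeze_zero_norm (fun n => ?_) (tendsto_iff_norm_sub_tendsto_zero.1 hy)
    refine (norm_mul_le _ _).trans ?_
    refine (mul_le_of_le_one_right (norm_nonneg _) (norm_polarSeq_le_one r n)).trans ?_
    refine (norm_mul_le _ _).trans ?_
    rw [norm_star]
    exact mul_le_of_le_one_left (norm_nonneg _) (norm_polarSeq_le_one r n)
  have h2 : Tendsto (fun n => star (polarSeq r n) * (polarSeq r n * b)
      * (star (polarSeq r n) * polarSeq r n)) atTop (𝓝 b) := by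
    have h3 := tendsto_star_polarSeq_mul_of_mem hb.1
    have h4 := (tendsto_star_polarSeq_mul_of_mem hb.2).star
    rw [star_star] at h4
    have h5 : Tendsto (fun n => (star (polarSeq r n) * (polarSeq r n * b) - b)
        * (star (polarSeq r n) * polarSeq r n)) atTop (𝓝 0) := by
      refine squeeze_zero_norm (fun n => ?_) (tendsto_iff_norm_sub_tendsto_zero.1 h3)
      refine (norm_mul_le _ _).trans (mul_le_of_le_one_right (norm_nonneg _) ?_)
      refine (norm_mul_le _ _).trans ?_
      rw [norm_star]
      exact mul_le_one₀ (norm_polarSeq_le_one r n) (norm_nonneg _) (norm_polarSeq_le_one r n)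
    have h6 := h5.add h4
    rw [zero_add] at h6
    refine h6.congr fun n => ?_
    simp only [star_mul, star_star]
    noncomm_ring
  have h7 := h2.sub h1
  rw [sub_zero] at h7
  refine h7.congr fun n => ?_
  noncomm_ring

/-- The limit of the conjugates of `b` by the polar approximations. -/
def polarConj (r : D) (b : herAlg (star r)) : herAlg r :=
  ⟨(exists_tendsto_polarSeq_conj b.2).choose, (exists_tendsto_polarSeq_conj b.2).choose_spec.1⟩

theorem tendsto_polarConj (r : D) (b : herAlg (star r)) :
    Tendsto (fun n => polarSeq r n * (b : D) * star (polarSeq r n)) atTop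
      (𝓝 (polarConj r b : D)) :=
  (exists_tendsto_polarSeq_conj b.2).choose_spec.2

theorem polarConj_eq {r : D} {b : herAlg (star r)} {y : herAlg r}
    (h : Tendsto (fun n => polarSeq r n * (b : D) * star (polarSeq r n)) atTop (𝓝 (y : D))) :
    polarConj r b = y :=
  Subtype.ext (tendsto_nhds_unique (tendsto_polarConj r b) h)

/-- Conjugation by the partial isometry in the polar decomposition of `r`. -/
def herConj (r : D) : herAlg (star r) →⋆ₙₐ[ℂ] herAlg r where
  toFun := polarConj r
  map_smul' c b := polarConj_eq <| ((tendsto_polarConj r b).const_smul c).congr fun n => by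
    change _ = polarSeq r n * (c • (b : D)) * _
    rw [mul_smul_comm, smul_mul_assoc]
  map_zero' := polarConj_eq <| tendsto_const_nhds.congr fun n => by
    change (0 : D) = polarSeq r n * 0 * _
    rw [mul_zero, zero_mul]
  map_add' b c := polarConj_eq <|
    ((tendsto_polarConj r b).add (tendsto_polarConj r c)).congr fun n => by
      change _ = polarSeq r n * ((b : D) + c) * _
      rw [mul_add, add_mul]
  map_mul' b c := polarConj_eq <|
    tendsto_polarSeq_conj_mul c.2 (tendsto_polarConj r b) (tendsto_polarConj r c)
  map_star' b := polarConj_eq <| (tendsto_polarConj r b).star.congr fun n => by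
    change _ = polarSeq r n * star (b : D) * _
    rw [star_mul, star_mul, star_star, mul_assoc]

theorem tendsto_herConj (r : D) (b : herAlg (star r)) :
    Tendsto (fun n => polarSeq r n * (b : D) * star (polarSeq r n)) atTop (𝓝 (herConj r b : D)) :=
  tendsto_polarConj r b

theorem herConj_bijective (r : D) : Function.Bijective (herConj r) := by
  refine ⟨fun b c h => Subtype.ext ?_, fun y => ?_⟩
  · have h1 := tendsto_polarSeq_star_conj b.2 (tendsto_herConj r b)
    rw [h] at h1
    exact tendsto_nhds_unique h1 (tendsto_polarSeq_star_conj c.2 (tendsto_herConj r c))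
  · have hy : (y : D) ∈ herAlg (star (star r)) := by rw [star_star]; exact y.2
    obtain ⟨b, hb, hlim⟩ := exists_tendsto_polarSeq_conj hy
    have h1 := tendsto_polarSeq_star_conj hy hlim
    rw [star_star] at h1
    exact ⟨⟨b, hb⟩, Subtype.ext (tendsto_nhds_unique (tendsto_herConj r ⟨b, hb⟩) h1)⟩

/-- The hereditary subalgebras generated by `r⋆` and by `r` (that is, by `r⋆r` and `rr⋆`) are
isomorphic. -/
def herEquiv (r : D) : herAlg (star r) ≃⋆ₐ[ℂ] herAlg r :=
  StarAlgEquiv.ofBijective (herConj r) (herConj_bijective r)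

/-- `herAlg r` as a C⋆-algebra in its own right; a separate type, so that it can carry the order of
a C⋆-algebra instead of the one inherited from `D`. -/
def HerAlg (r : D) : Type u := herAlg r

instance (r : D) : NonUnitalCStarAlgebra (HerAlg r) :=
  NonUnitalStarSubalgebra.nonUnitalCStarAlgebra (herAlg r) (h_closed := isClosed_herAlg r)

instance (r : D) : PartialOrder (HerAlg r) := CStarAlgebra.spectralOrder _

instance (r : D) : StarOrderedRing (HerAlg r) := CStarAlgebra.spectralOrderedRing _

/-- The inclusion of a hereditary subalgebra. -/
def HerAlg.incl (r : D) : HerAlg r →⋆ₙₐ[ℂ] D where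
  toFun x := x.1
  map_smul' _ _ := rfl
  map_zero' := rfl
  map_add' _ _ := rfl
  map_mul' _ _ := rfl
  map_star' _ := rfl

theorem HerAlg.incl_injective (r : D) : Function.Injective (HerAlg.incl r) :=
  Subtype.val_injective

theorem HerAlg.range_incl (r : D) :
    Set.range (HerAlg.incl r) = {x | x ∈ rid r ∧ star x ∈ rid r} := Subtype.range_val

end Hereditary

/-! ### Functoriality of the stabilization -/

section Map

variable {A B : Type u} [NonUnitalCStarAlgebra A] [PartialOrder A] [StarOrderedRing A]
  [NonUnitalCStarAlgebra B] [PartialOrder B] [StarOrderedRing B]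

namespace FinMat

/-- Entrywise application of a ⋆-homomorphism. -/
def map (φ : B →⋆ₙₐ[ℂ] A) (x : FinMat B) : FinMat A :=
  ⟨fun n => CStarMatrix.mapₙₐ φ (x.1 n), x.2.choose, fun n hn => by
    ext i j
    have h := congrFun (congrFun (x.2.choose_spec n hn) i) j
    rw [padMatrix_apply] at h ⊢
    change φ (x.1 n i j) = _
    rw [h]
    split_ifs with hij
    · rfl
    · exact map_zero φ⟩

theorem map_coherent (φ : B →⋆ₙₐ[ℂ] A) {x : FinMat B} {N : ℕ} (hx : IsCoherentFrom B N x.1) :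
    IsCoherentFrom A N (map φ x).1 := fun n hn => by
  ext i j
  have h := congrFun (congrFun (hx n hn) i) j
  rw [padMatrix_apply] at h ⊢
  change φ (x.1 n i j) = _
  rw [h]
  split_ifs with hij
  · rfl
  · exact map_zero φ

theorem entry_map (φ : B →⋆ₙₐ[ℂ] A) (x : FinMat B) (i j : ℕ) :
    (map φ x).entry i j = φ (x.entry i j) := by
  obtain ⟨N, hx⟩ := x.2
  have h := le_max_left N (max i j + 1)
  rw [← apply_eq_entry (M := max N (max i j + 1)) hx h ⟨i, by omega⟩ ⟨j, by omega⟩,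
    ← apply_eq_entry (M := max N (max i j + 1)) (map_coherent φ hx) h ⟨i, by omega⟩ ⟨j, by omega⟩]
  rfl

theorem norm_map {φ : B →⋆ₙₐ[ℂ] A} (hφ : Function.Injective φ) (x : FinMat B) :
    ‖map φ x‖ = ‖x‖ := by
  obtain ⟨N, hx⟩ := x.2
  rw [norm_eq hx, norm_eq (map_coherent φ hx)]
  refine NonUnitalStarAlgHom.norm_map (CStarMatrix.mapₙₐ φ) (fun y z hyz => ?_) _
  ext i j
  exact hφ (congrFun (congrFun hyz i) j)

theorem map_add' (φ : B →⋆ₙₐ[ℂ] A) (x y : FinMat B) : map φ (x + y) = map φ x + map φ y :=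
  FinMat.ext' A fun n i j => map_add φ (x.1 n i j) (y.1 n i j)

theorem map_smul' (φ : B →⋆ₙₐ[ℂ] A) (c : ℂ) (x : FinMat B) : map φ (c • x) = c • map φ x :=
  FinMat.ext' A fun n i j => map_smul φ c (x.1 n i j)

theorem map_star' (φ : B →⋆ₙₐ[ℂ] A) (x : FinMat B) : map φ (star x) = star (map φ x) :=
  FinMat.ext' A fun n i j => map_star φ (x.1 n j i)

theorem map_mul' (φ : B →⋆ₙₐ[ℂ] A) (x y : FinMat B) : map φ (x * y) = map φ x * map φ y :=
  Subtype.ext (funext fun n => map_mul (CStarMatrix.mapₙₐ φ) (x.1 n) (y.1 n))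

end FinMat

namespace Stab

/-- The linear isometry `B ⊗ 𝕂 → A ⊗ 𝕂` induced by an injective ⋆-homomorphism. -/
def mapIsometry {φ : B →⋆ₙₐ[ℂ] A} (hφ : Function.Injective φ) :
    NormedAddGroupHom (FinMat B) (Stab A) where
  toFun x := of (FinMat.map φ x)
  map_add' x y := by rw [FinMat.map_add', of_add]
  bound' := ⟨1, fun x => by rw [norm_of, FinMat.norm_map hφ, one_mul]⟩

/-- The underlying map of `Stab.map`. -/
def mapFun {φ : B →⋆ₙₐ[ℂ] A} (hφ : Function.Injective φ) : Stab B → Stab A :=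
  (mapIsometry hφ).extension

theorem continuous_mapFun {φ : B →⋆ₙₐ[ℂ] A} (hφ : Function.Injective φ) :
    Continuous (mapFun hφ) := (mapIsometry hφ).extension.continuous

theorem mapFun_of {φ : B →⋆ₙₐ[ℂ] A} (hφ : Function.Injective φ) (x : FinMat B) :
    mapFun hφ (of x) = of (FinMat.map φ x) :=
  NormedAddGroupHom.extension_coe (mapIsometry hφ) x

/-- The ⋆-homomorphism `B ⊗ 𝕂 → A ⊗ 𝕂` induced by an injective ⋆-homomorphism `B → A`. -/
def map {φ : B →⋆ₙₐ[ℂ] A} (hφ : Function.Injective φ) : Stab B →⋆ₙₐ[ℂ] Stab A where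
  toFun := mapFun hφ
  map_smul' c x := by
    have hc := continuous_mapFun hφ
    refine ind₁ (p := fun x => mapFun hφ (c • x) = c • mapFun hφ x)
      (isClosed_eq (hc.comp (continuous_smul' B c)) ((continuous_smul' A c).comp hc))
      (fun x => ?_) x
    rw [← of_smul, mapFun_of, mapFun_of, FinMat.map_smul', of_smul]
  map_zero' := map_zero (mapIsometry hφ).extension
  map_add' := map_add (mapIsometry hφ).extension
  map_mul' x y := by
    have hc := continuous_mapFun hφ
    refine ind₂ (p := fun x y => mapFun hφ (x * y) = mapFun hφ x * mapFun hφ y)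
      (isClosed_eq (hc.comp continuous_mul)
        ((hc.comp continuous_fst).mul (hc.comp continuous_snd))) (fun x y => ?_) x y
    rw [← of_mul, mapFun_of, mapFun_of, mapFun_of, FinMat.map_mul', of_mul]
  map_star' x := by
    have hc := continuous_mapFun hφ
    refine ind₁ (p := fun x => mapFun hφ (star x) = star (mapFun hφ x))
      (isClosed_eq (hc.comp continuous_star) (continuous_star.comp hc)) (fun x => ?_) x
    rw [← of_star, mapFun_of, mapFun_of, FinMat.map_star', of_star]

variable {φ : B →⋆ₙₐ[ℂ] A} (hφ : Function.Injective φ)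

theorem map_of (x : FinMat B) : map hφ (of x) = of (FinMat.map φ x) := mapFun_of hφ x

theorem continuous_map : Continuous (map hφ) := continuous_mapFun hφ

theorem norm_map (x : Stab B) : ‖map hφ x‖ = ‖x‖ := by
  refine ind₁ (p := fun x => ‖map hφ x‖ = ‖x‖)
    (isClosed_eq (continuous_map hφ).norm continuous_norm) (fun x => ?_) x
  rw [map_of, norm_of, norm_of, FinMat.norm_map hφ]

theorem isClosed_range_map : IsClosed (Set.range (map hφ)) :=
  (AddMonoidHomClass.isometry_of_norm (map hφ) (norm_map hφ)).isClosedEmbedding.isClosed_range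

theorem map_injective : Function.Injective (map hφ) :=
  (AddMonoidHomClass.isometry_of_norm (map hφ) (norm_map hφ)).injective

theorem map_row (f : ℕ ≃. ℕ) (x : Stab B) : map hφ (row f x) = row f (map hφ x) := by
  refine ind₁ (p := fun x => map hφ (row f x) = row f (map hφ x))
    (isClosed_eq ((continuous_map hφ).comp (continuous_row f))
      ((continuous_row f).comp (continuous_map hφ))) (fun x => ?_) x
  rw [row_of, map_of, map_of, row_of]
  refine FinMat.of_eq_of fun i j => ?_
  rw [FinMat.entry_map, FinMat.entry_row, FinMat.entry_row]
  unfold FinMat.selectRow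
  cases f i with
  | none => exact map_zero φ
  | some k => exact (FinMat.entry_map φ x k j).symm

theorem map_col (f : ℕ ≃. ℕ) (x : Stab B) : map hφ (col f x) = col f (map hφ x) := by
  unfold col
  rw [map_star, map_row, map_star]

theorem map_corner (b : B) : map hφ (corner B b) = corner A (φ b) := by
  change map hφ (of (cornerFin b)) = of (cornerFin (φ b))
  rw [map_of]
  refine FinMat.of_eq_of fun i j => ?_
  rw [FinMat.entry_map, entry_cornerFin, entry_cornerFin]
  split_ifs
  · rfl
  · exact map_zero φ

end Stab

end Map

/-! ### Closed right ideals of the stabilization that are invariant under row operations -/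

section RowIdeals

variable {A : Type u} [NonUnitalCStarAlgebra A] [PartialOrder A] [StarOrderedRing A]

namespace Stab

theorem row_mem_rid (f : ℕ ≃. ℕ) {r x : Stab A} (hx : x ∈ rid r) : row f x ∈ rid (row f r) := by
  refine map_mem_closure (continuous_row f) hx ?_
  rintro _ ⟨d, rfl⟩
  exact ⟨d, (row_mul f r d).symm⟩

theorem col_mem_rid (f : ℕ ≃. ℕ) {r x : Stab A} (hx : x ∈ rid r) : col f x ∈ rid r := by
  refine (map_mem_closure (continuous_col f) hx ?_ : _ ∈ closure (Set.range fun d => r * d))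
  rintro _ ⟨d, rfl⟩
  exact ⟨col f d, mul_col f r d⟩

theorem corner_mem_rid {e a : A} (ha : a ∈ rid e) : corner A a ∈ rid (corner A e) := by
  refine map_mem_closure
    (AddMonoidHomClass.isometry_of_norm (corner A) (corner_norm A)).continuous ha ?_
  rintro _ ⟨d, rfl⟩
  exact ⟨corner A d, (map_mul _ _ _).symm⟩

theorem mem_rid_of_corner_mem {e a : A} (ha : corner A a ∈ rid (corner A e)) : a ∈ rid e := by
  have hiso : Isometry (corner A) := AddMonoidHomClass.isometry_of_norm (corner A) (corner_norm A)
  rw [rid, hiso.isEmbedding.closure_eq_preimage_closure_image, Set.mem_preimage]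
  have h := map_mem_closure (continuous_col (PEquiv.single 0 0)) ha
    (t := corner A '' Set.range fun d => e * d) ?_
  · rwa [col_single_corner] at h
  · rintro _ ⟨d, rfl⟩
    obtain ⟨c, hc⟩ := exists_compress_eq_corner d
    refine ⟨e * c, ⟨c, rfl⟩, ?_⟩
    change _ = col (PEquiv.single 0 0) (corner A e * d)
    rw [map_mul, ← hc, ← mul_col]
    have h1 := col_mul (PEquiv.single 0 0) (corner A e) (col (PEquiv.single 0 0) d)
    rw [col_single_corner, PEquiv.symm_single] at h1
    exact h1.symm

/-- The matrices all of whose rows, moved to the top, lie in the closed right ideal generated by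
`e ⊗ e₁₁`. -/
def rowIdeal (e : A) : AddSubmonoid (Stab A) where
  carrier := {x | ∀ i, row (PEquiv.single 0 i) x ∈ rid (corner A e)}
  add_mem' hx hy i := by
    rw [row_add]; exact add_mem_rid (hx i) (hy i)
  zero_mem' i := by
    rw [row_zero]; exact zero_mem_rid _

theorem mem_rowIdeal {e : A} {x : Stab A} :
    x ∈ rowIdeal e ↔ ∀ i, row (PEquiv.single 0 i) x ∈ rid (corner A e) := Iff.rfl

theorem isClosed_rowIdeal (e : A) : IsClosed (rowIdeal e : Set (Stab A)) := by
  have : (rowIdeal e : Set (Stab A))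
      = ⋂ i, {x | row (PEquiv.single 0 i) x ∈ rid (corner A e)} := by
    ext x
    simp [mem_rowIdeal]
  rw [this]
  exact isClosed_iInter fun i => (isClosed_rid _).preimage (continuous_row _)

theorem col_mem_rowIdeal (f : ℕ ≃. ℕ) {e : A} {x : Stab A} (hx : x ∈ rowIdeal e) :
    col f x ∈ rowIdeal e := fun i => by
  rw [row_col]
  exact col_mem_rid f (hx i)

theorem single_trans_eq (i : ℕ) (f : ℕ ≃. ℕ) :
    (PEquiv.single 0 i : ℕ ≃. ℕ).trans f = (f i).elim ⊥ fun k => PEquiv.single 0 k := by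
  cases h : f i with
  | none => exact PEquiv.single_trans_of_eq_none 0 h
  | some k => exact PEquiv.single_trans_of_mem 0 h

theorem row_mem_rowIdeal (f : ℕ ≃. ℕ) {e : A} {x : Stab A} (hx : x ∈ rowIdeal e) :
    row f x ∈ rowIdeal e := fun i => by
  rw [row_row, single_trans_eq]
  cases f i with
  | none =>
    change row ⊥ x ∈ _
    rw [row_bot]
    exact zero_mem_rid _
  | some k => exact hx k

theorem mem_rowIdeal_of_mem_rid {e : A} {x : Stab A} (hx : x ∈ rid (corner A e)) :
    x ∈ rowIdeal e := fun i => by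
  have h := row_mem_rid (PEquiv.single 0 i) hx
  by_cases hi : i = 0
  · subst hi
    rwa [row_single_corner] at h
  · rw [← row_single_corner, row_row, PEquiv.single_trans_single_of_ne hi, row_bot] at h
    exact rid_subset (zero_mem_rid _) h

/-- The matrix unit decomposition of an entry. -/
theorem row_col_single (i j : ℕ) (x : Stab A) :
    ∃ a, row (PEquiv.single 0 i) (col (PEquiv.single 0 j) x) = corner A a ∧
      row (PEquiv.single i i) (col (PEquiv.single j j) x)
        = row (PEquiv.single i 0) (col (PEquiv.single j 0) (corner A a)) := by
  obtain ⟨a, ha⟩ := exists_compress_eq_corner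
    (row (PEquiv.single 0 i) (col (PEquiv.single 0 j) x))
  rw [← row_col, row_row, single_trans_single', col_col, single_trans_single'] at ha
  refine ⟨a, ha, ?_⟩
  rw [← ha, ← row_col (PEquiv.single 0 i) (PEquiv.single j 0), row_row, single_trans_single',
    col_col, single_trans_single']

theorem mem_rowIdeal_of_entries {e : A} {x : Stab A}
    (h : ∀ i j a, row (PEquiv.single 0 i) (col (PEquiv.single 0 j) x) = corner A a → a ∈ rid e) :
    x ∈ rowIdeal e := by
  refine mem_of_entries (isClosed_rowIdeal e) fun i j => ?_
  obtain ⟨a, ha, h2⟩ := row_col_single i j x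
  rw [h2]
  exact row_mem_rowIdeal _ (col_mem_rowIdeal _
    (mem_rowIdeal_of_mem_rid (corner_mem_rid (h i j a ha))))

theorem star_row_col (f g : ℕ ≃. ℕ) (x : Stab A) :
    star (row f (col g x)) = row g (col f (star x)) := by
  rw [row_col g f]
  rfl

/-- The ideal `rowIdeal e` is generated by a weighted sum of copies of `e` along the diagonal. -/
theorem exists_rid_eq_rowIdeal {e : A} (he : IsSelfAdjoint e) :
    ∃ h : Stab A, IsSelfAdjoint h ∧ rid h = rowIdeal e := by
  let t : ℕ → Stab A := fun n =>
    (1 / 2 : ℂ) ^ n • row (PEquiv.single n 0) (col (PEquiv.single n 0) (corner A e))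
  have hnorm : ∀ n, ‖t n‖ ≤ (1 / 2 : ℝ) ^ n * ‖corner A e‖ := fun n => by
    have h1 : ‖t n‖ = (1 / 2 : ℝ) ^ n
        * ‖row (PEquiv.single n 0) (col (PEquiv.single n 0) (corner A e))‖ := by
      rw [norm_smul, norm_pow]
      norm_num
    rw [h1]
    gcongr
    refine (norm_row_le _ _).trans ?_
    rw [col, norm_star]
    exact (norm_row_le _ _).trans (norm_star _).le
  have hsum : Summable t := Summable.of_norm_bounded (g := fun n => (1 / 2 : ℝ) ^ n * ‖corner A e‖)
    (summable_geometric_two.mul_right _) hnorm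
  have hsa : ∀ n, star (t n) = t n := fun n => by
    have : star ((1 / 2 : ℂ) ^ n) = (1 / 2 : ℂ) ^ n := by simp
    simp only [t]
    rw [star_smul, this, star_row_col, ← map_star, he.star_eq]
  have hmul : ∀ n d, (∑' m, t m) * row (PEquiv.single n 0) d
      = (1 / 2 : ℂ) ^ n • row (PEquiv.single n 0) (corner A e * d) := fun n d => by
    have hterm : ∀ m, t m * row (PEquiv.single n 0) d
        = if m = n then (1 / 2 : ℂ) ^ n • row (PEquiv.single n 0) (corner A e * d) else 0 := by
      intro m
      simp only [t]
      rw [smul_mul_assoc, ← row_mul, col_mul, PEquiv.symm_single, row_row]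
      split_ifs with hmn
      · subst hmn
        rw [single_trans_single']
        have h1 := col_mul (PEquiv.single 0 0) (corner A e) d
        rw [col_single_corner, PEquiv.symm_single] at h1
        rw [h1]
      · rw [PEquiv.single_trans_single_of_ne hmn, row_bot, mul_zero, row_zero, smul_zero]
    rw [← hsum.tsum_mul_right, tsum_congr hterm, tsum_ite_eq]
  refine ⟨∑' n, t n, ?_, subset_antisymm ?_ fun x hx => ?_⟩
  · exact (hsum.hasSum.star.congr_fun fun n => (hsa n).symm).unique hsum.hasSum
  · have hH : ∑' n, t n ∈ rowIdeal e := by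
      refine (isClosed_rowIdeal e).mem_of_tendsto hsum.hasSum.tendsto_sum_nat
        (Eventually.of_forall fun n => (rowIdeal e).sum_mem fun i _ j => ?_)
      simp only [t]
      rw [row_smul]
      exact smul_mem_rid _ (row_mem_rowIdeal _ (col_mem_rowIdeal _
        (mem_rowIdeal_of_mem_rid (self_mem_rid _))) j)
    refine closure_minimal ?_ (isClosed_rowIdeal e)
    rintro _ ⟨d, rfl⟩ i
    rw [row_mul]
    exact mul_mem_rid (hH i) d
  · have hrow : ∀ n, ∀ y ∈ rid (corner A e), row (PEquiv.single n 0) y ∈ rid (∑' n, t n) := by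
      intro n y hy
      refine (map_mem_closure (continuous_row _) hy ?_ :
        _ ∈ closure (Set.range fun d => (∑' n, t n) * d))
      rintro _ ⟨d, rfl⟩
      refine ⟨row (PEquiv.single n 0) ((2 : ℂ) ^ n • d), ?_⟩
      change (∑' n, t n) * _ = row _ (corner A e * d)
      rw [hmul, mul_smul_comm, row_smul, smul_smul, ← mul_pow]
      norm_num
    refine (isClosed_rid _).mem_of_tendsto (tendsto_sum_row_single x)
      (Eventually.of_forall fun n => ?_)
    refine Finset.sum_induction _ (· ∈ rid (∑' n, t n)) (fun _ _ => add_mem_rid) (zero_mem_rid _)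
      fun i _ => ?_
    have h1 := hrow i _ (hx i)
    rwa [row_row, single_trans_single'] at h1

theorem mem_rid_of_mem_rowIdeal {e a : A} {x : Stab A} (hx : x ∈ rowIdeal e) {i j : ℕ}
    (ha : row (PEquiv.single 0 i) (col (PEquiv.single 0 j) x) = corner A a) : a ∈ rid e := by
  refine mem_rid_of_corner_mem ?_
  rw [← ha, row_col]
  exact col_mem_rid _ (hx i)

theorem rowIdeal_eq_univ {e : A} (he : rid e = Set.univ) :
    (rowIdeal e : Set (Stab A)) = Set.univ :=
  Set.eq_univ_of_forall fun _ => mem_rowIdeal_of_entries fun _ _ _ _ => he ▸ Set.mem_univ _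

/-- If `φ` identifies `B` with the hereditary subalgebra generated by `e`, then `B ⊗ 𝕂` is
identified with the hereditary subalgebra defined by `rowIdeal e`. -/
theorem range_map {B : Type u} [NonUnitalCStarAlgebra B] [PartialOrder B] [StarOrderedRing B]
    {φ : B →⋆ₙₐ[ℂ] A} (hφ : Function.Injective φ) {e : A}
    (he : Set.range φ = {x | x ∈ rid e ∧ star x ∈ rid e}) :
    Set.range (map hφ) = {x | x ∈ rowIdeal e ∧ star x ∈ rowIdeal e} := by
  have hmem : ∀ y : Stab B, map hφ y ∈ rowIdeal e := fun y => by
    refine mem_rowIdeal_of_entries fun i j a ha => ?_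
    rw [← map_col, ← map_row] at ha
    obtain ⟨b, hb, -⟩ := row_col_single i j y
    rw [hb, map_corner] at ha
    rw [← corner_injective ha]
    exact (he ▸ Set.mem_range_self b : φ b ∈ {x | x ∈ rid e ∧ star x ∈ rid e}).1
  refine subset_antisymm ?_ ?_
  · rintro _ ⟨y, rfl⟩
    refine ⟨hmem y, ?_⟩
    rw [← map_star]
    exact hmem _
  · rintro x ⟨hx, hx'⟩
    let S : AddSubmonoid (Stab A) := AddMonoidHom.mrange (map hφ : Stab B →+ Stab A)
    have hS : (S : Set (Stab A)) = Set.range (map hφ) := AddMonoidHom.coe_mrange _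
    have hxS : x ∈ S := by
      refine mem_of_entries (hS ▸ isClosed_range_map hφ) fun i j => ?_
      obtain ⟨a, ha, h2⟩ := row_col_single i j x
      have ha' : star a ∈ rid e := by
        refine mem_rid_of_mem_rowIdeal hx' (i := j) (j := i) ?_
        rw [map_star, ← ha, star_row_col]
      obtain ⟨b, rfl⟩ : a ∈ Set.range φ := he ▸ ⟨mem_rid_of_mem_rowIdeal hx ha, ha'⟩
      rw [h2, ← map_corner hφ, ← map_col, ← map_row]
      exact ⟨_, rfl⟩
    rwa [← SetLike.mem_coe, hS] at hxS

end Stab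

/-- A `σ`-unital algebra is the closed right ideal generated by a single positive element. -/
theorem IsSigmaUnital.exists_rid_eq_univ (hA : IsSigmaUnital A) :
    ∃ e : A, 0 ≤ e ∧ rid e = Set.univ := by
  obtain ⟨u, -, hu, hlim⟩ := hA
  let t : ℕ → A := fun n => (1 / 2 : ℝ) ^ n • u n
  have hsum : Summable t := by
    refine Summable.of_norm_bounded (g := fun n => (1 / 2 : ℝ) ^ n) summable_geometric_two
      fun n => ?_
    simp only [t]
    rw [norm_smul]
    have : ‖(1 / 2 : ℝ) ^ n‖ = (1 / 2 : ℝ) ^ n := Real.norm_of_nonneg (by positivity)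
    rw [this]
    exact mul_le_of_le_one_right (by positivity) (hu n).2
  have ht0 : ∀ n, 0 ≤ t n := fun n => smul_nonneg (by positivity) (hu n).1
  have he0 : 0 ≤ ∑' n, t n := tsum_nonneg ht0
  refine ⟨∑' n, t n, he0, Set.eq_univ_of_forall fun a => ?_⟩
  refine (isClosed_rid _).mem_of_tendsto (hlim a).1 (Eventually.of_forall fun n => ?_)
  refine mul_mem_rid ?_ a
  obtain ⟨q, hq, hq0, hqq⟩ := exists_sqrt he0
  obtain ⟨w, hw, hw0, hww⟩ := exists_sqrt (ht0 n)
  have h1 : star w ∈ rid (star q) := star_mem_rid_of_le (by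
    rw [hw.star_eq, hq.star_eq, hww, hqq]
    exact hsum.le_tsum n fun m _ => ht0 m)
  rw [hw.star_eq, hq.star_eq] at h1
  have h2 : q ∈ rid (∑' n, t n) := hqq ▸ self_mem_rid_mul_self hq0
  have h3 : t n ∈ rid (∑' n, t n) := by
    rw [← hww]
    exact mul_mem_rid (rid_subset h2 h1) w
  have h4 : u n = ((2 : ℂ) ^ n) • t n := by
    simp only [t]
    rw [← Complex.coe_smul, smul_smul]
    push_cast
    rw [← mul_pow]
    norm_num
  rw [h4]
  exact smul_mem_rid _ h3

end RowIdeals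

/-! ### Stable isomorphism with full hereditary subalgebras -/

section Absorption

/-- In a simple algebra, countably many translates of `h ≠ 0` suffice to recover the right ideal
generated by `k`. -/
theorem IsSimpleCStar.exists_seq_translates {D : Type u} [NonUnitalCStarAlgebra D]
    [PartialOrder D] [StarOrderedRing D] (hD : IsSimpleCStar D) {h : D} (hh : h ≠ 0) (k : D) :
    ∃ u : ℕ → D, (∀ n, ‖u n‖ ≤ 1) ∧ ∀ T : AddSubmonoid D, IsClosed (T : Set D) →
      (∀ n d, k * u n * h * d ∈ T) → ∀ d, k * d ∈ T := by
  let I : Submodule ℂ D := Submodule.span ℂ {y | ∃ x d, y = x * h * d}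
  have hI : IsIdeal I := fun x hx a => by
    refine ⟨?_, ?_⟩
    · induction hx using Submodule.span_induction with
      | mem x hx =>
        obtain ⟨x, d, rfl⟩ := hx
        exact Submodule.subset_span ⟨a * x, d, by noncomm_ring⟩
      | zero => rw [mul_zero]; exact I.zero_mem
      | add x y _ _ hx hy => rw [mul_add]; exact I.add_mem hx hy
      | smul c x _ hx => rw [mul_smul_comm]; exact I.smul_mem c hx
    · induction hx using Submodule.span_induction with
      | mem x hx =>
        obtain ⟨x, d, rfl⟩ := hx
        exact Submodule.subset_span ⟨x, d * a, by noncomm_ring⟩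
      | zero => rw [zero_mul]; exact I.zero_mem
      | add x y _ _ hx hy => rw [add_mul]; exact I.add_mem hx hy
      | smul c x _ hx => rw [smul_mul_assoc]; exact I.smul_mem c hx
  have hIne : I ≠ ⊥ := by
    intro hbot
    have h1 : star h * h * (star h * h) ∈ I := Submodule.subset_span ⟨star h, star h * h, rfl⟩
    rw [hbot, Submodule.mem_bot] at h1
    have h2 : star (star h * h) * (star h * h) = 0 := by rwa [star_mul, star_star]
    exact hh (CStarRing.star_mul_self_eq_zero_iff h |>.1
      (CStarRing.star_mul_self_eq_zero_iff _ |>.1 h2))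
  have hdense : Dense (I : Set D) := hD.dense_of_ne_bot hI hIne
  -- every element of `I` involves only finitely many left factors
  have hcount : ∀ y ∈ I, ∃ S : Set D, S.Countable ∧ ∀ T : AddSubmonoid D,
      (∀ x ∈ S, ∀ d, k * x * h * d ∈ T) → ∀ d, k * y * d ∈ T := by
    intro y hy
    induction hy using Submodule.span_induction with
    | mem y hy =>
      obtain ⟨x, d, rfl⟩ := hy
      refine ⟨{x}, Set.countable_singleton x, fun T hT d' => ?_⟩
      have := hT x rfl (d * d')
      convert this using 1
      noncomm_ring
    | zero => exact ⟨∅, Set.countable_empty, fun T _ d => by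
        rw [mul_zero, zero_mul]; exact T.zero_mem⟩
    | add x y _ _ hx hy =>
      obtain ⟨S, hS, hS'⟩ := hx
      obtain ⟨S', hT, hT'⟩ := hy
      refine ⟨S ∪ S', hS.union hT, fun T h d => ?_⟩
      rw [mul_add, add_mul]
      exact T.add_mem (hS' T (fun x hx => h x (Or.inl hx)) d)
        (hT' T (fun x hx => h x (Or.inr hx)) d)
    | smul c x _ hx =>
      obtain ⟨S, hS, hS'⟩ := hx
      refine ⟨S, hS, fun T h d => ?_⟩
      rw [mul_smul_comm, smul_mul_assoc, ← mul_smul_comm]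
      exact hS' T h _
  have hk : k ∈ closure ((fun y => k * y) '' I) := by
    refine closure_minimal ?_ isClosed_closure (self_mem_rid k)
    rintro _ ⟨d, rfl⟩
    exact map_mem_closure (f := fun y => k * y) (by fun_prop) (hdense d)
      fun y hy => Set.mem_image_of_mem _ hy
  obtain ⟨y, hy, hlim⟩ := mem_closure_iff_seq_limit.1 hk
  have hy' : ∀ n, ∃ S : Set D, S.Countable ∧ ∀ T : AddSubmonoid D,
      (∀ x ∈ S, ∀ d, k * x * h * d ∈ T) → ∀ d, y n * d ∈ T := fun n => by
    obtain ⟨z, hz, h1⟩ := hy n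
    rw [← h1]
    exact hcount z hz
  choose S hS hST using hy'
  obtain ⟨v, hv⟩ := ((Set.countable_iUnion hS).insert 0).exists_eq_range (Set.insert_nonempty _ _)
  refine ⟨fun n => ((1 / (‖v n‖ + 1) : ℝ) : ℂ) • v n, fun n => ?_, fun T hT hmem d => ?_⟩
  · rw [norm_smul, Complex.norm_real, Real.norm_of_nonneg (by positivity), one_div_mul_eq_div,
      div_le_one (by positivity)]
    linarith
  · refine hT.mem_of_tendsto (hlim.mul_const d) (Eventually.of_forall fun n => ?_)
    refine hST n T (fun x hx d' => ?_) d
    obtain ⟨m, rfl⟩ : x ∈ Set.range v := hv ▸ Set.mem_insert_of_mem _ (Set.mem_iUnion.2 ⟨n, hx⟩)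
    have hne : ((‖v m‖ + 1 : ℝ) : ℂ) ≠ 0 := by
      exact_mod_cast (by positivity : ‖v m‖ + 1 ≠ 0)
    have := hmem m (((‖v m‖ + 1 : ℝ) : ℂ) • d')
    rw [mul_smul_comm, mul_smul_comm, smul_mul_assoc, smul_mul_assoc, smul_smul] at this
    rwa [show ((‖v m‖ + 1 : ℝ) : ℂ) * ((1 / (‖v m‖ + 1) : ℝ) : ℂ) = 1 by
      rw [← Complex.ofReal_mul, mul_one_div_cancel (by positivity), Complex.ofReal_one],
      one_smul] at this

/-- The closed right ideal generated by `r` as an additive submonoid. -/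
def ridSubmonoid {D : Type u} [NonUnitalCStarAlgebra D] [PartialOrder D] [StarOrderedRing D]
    (r : D) : AddSubmonoid D where
  carrier := rid r
  add_mem' := add_mem_rid
  zero_mem' := zero_mem_rid r

namespace Stab

variable {A : Type u} [NonUnitalCStarAlgebra A] [PartialOrder A] [StarOrderedRing A]

theorem norm_col_le (f : ℕ ≃. ℕ) (x : Stab A) : ‖col f x‖ ≤ ‖x‖ := by
  rw [col, norm_star, ← norm_star x]
  exact norm_row_le f _

theorem continuous_shift (n : ℕ) : Continuous (shift n : Stab A → Stab A) := continuous_row _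

theorem shift_smul (n : ℕ) (c : ℂ) (x : Stab A) : shift n (c • x) = c • shift n x := row_smul _ _ _

theorem conj_mul_shift (i n m : ℕ) (x d : Stab A) :
    conj i n x * shift m d = if n = m then shift i (x * d) else 0 := by
  rw [conj, ← row_mul, col_mul, shift_symm_shift]
  split_ifs
  · rfl
  · rw [mul_zero, row_zero]

theorem shiftEquiv_trans_single (s : ℕ) :
    (shiftEquiv s.unpair.1).trans (PEquiv.single s.unpair.2 s) = PEquiv.single s s := by
  ext a b
  have h : (shiftEquiv s.unpair.1).trans (PEquiv.single s.unpair.2 s) a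
      = (shiftEquiv s.unpair.1 a).bind (PEquiv.single s.unpair.2 s) := rfl
  have h2 : shiftEquiv s.unpair.1 a
      = if a.unpair.1 = s.unpair.1 then some a.unpair.2 else none := rfl
  rw [h, h2]
  by_cases has : a = s
  · subst has
    rw [if_pos rfl, Option.bind_some, PEquiv.single_apply, PEquiv.single_apply]
  · rw [PEquiv.single_apply_of_ne (Ne.symm has)]
    split_ifs with h1
    · have h3 : s.unpair.2 ≠ a.unpair.2 := fun h3 => has (by
        rw [← Nat.pair_unpair a, ← Nat.pair_unpair s, h1, h3])
      rw [Option.bind_some, PEquiv.single_apply_of_ne h3]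
      simp
    · simp

/-- A row-invariant right ideal is recovered from its shifts. -/
theorem mem_of_shift_mem {h : Stab A} (hinv : ∀ f, ∀ x ∈ rid h, row f x ∈ rid h)
    {T : AddSubmonoid (Stab A)} (hT : IsClosed (T : Set (Stab A)))
    (hmem : ∀ m d, shift m (h * d) ∈ T) : ∀ x ∈ rid h, x ∈ T := by
  have h1 : ∀ m, ∀ x ∈ rid h, shift m x ∈ T := fun m x hx => by
    refine closure_minimal (t := {x | shift m x ∈ T}) ?_ (hT.preimage (continuous_shift m)) hx
    rintro _ ⟨d, rfl⟩
    exact hmem m d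
  intro x hx
  refine hT.mem_of_tendsto (tendsto_sum_row_single x)
    (Eventually.of_forall fun n => T.sum_mem fun s _ => ?_)
  rw [← shiftEquiv_trans_single, ← row_row]
  exact h1 _ _ (hinv _ x hx)

/-- The matrices of the form `shift i z + shift j w` with `z ∈ rid k` and `w ∈ rid h`. -/
def twoRows (i j : ℕ) (k h : Stab A) : AddSubmonoid (Stab A) where
  carrier := {x | row (shiftEquiv i).symm x ∈ rid k ∧ row (shiftEquiv j).symm x ∈ rid h ∧
    shift i (row (shiftEquiv i).symm x) + shift j (row (shiftEquiv j).symm x) = x}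
  add_mem' := by
    rintro x y ⟨h1, h2, h3⟩ ⟨h4, h5, h6⟩
    refine ⟨?_, ?_, ?_⟩
    · rw [row_add]; exact add_mem_rid h1 h4
    · rw [row_add]; exact add_mem_rid h2 h5
    · rw [row_add, row_add, shift_add, shift_add]
      nth_rewrite 3 [← h3]
      nth_rewrite 3 [← h6]
      abel
  zero_mem' := by
    refine ⟨?_, ?_, ?_⟩
    · rw [row_zero]; exact zero_mem_rid k
    · rw [row_zero]; exact zero_mem_rid h
    · rw [row_zero, row_zero, shift, shift, row_zero, row_zero, add_zero]

theorem mem_twoRows {i j : ℕ} {k h x : Stab A} : x ∈ twoRows i j k h ↔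
    row (shiftEquiv i).symm x ∈ rid k ∧ row (shiftEquiv j).symm x ∈ rid h ∧
      shift i (row (shiftEquiv i).symm x) + shift j (row (shiftEquiv j).symm x) = x := Iff.rfl

theorem twoRows_comm (i j : ℕ) (k h : Stab A) : twoRows i j k h = twoRows j i h k := by
  ext x
  rw [mem_twoRows, mem_twoRows, add_comm]
  tauto

theorem isClosed_twoRows (i j : ℕ) (k h : Stab A) :
    IsClosed (twoRows i j k h : Set (Stab A)) := by
  have h1 := (isClosed_rid k).preimage (continuous_row (shiftEquiv i).symm)
  have h2 := (isClosed_rid h).preimage (continuous_row (shiftEquiv j).symm)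
  have h3 : IsClosed {x : Stab A |
      shift i (row (shiftEquiv i).symm x) + shift j (row (shiftEquiv j).symm x) = x} :=
    isClosed_eq (((continuous_shift i).comp (continuous_row _)).add
      ((continuous_shift j).comp (continuous_row _))) continuous_id
  exact h1.inter (h2.inter h3)

theorem shift_mem_twoRows_left {i j : ℕ} (hij : i ≠ j) {k h z : Stab A} (hz : z ∈ rid k) :
    shift i z ∈ twoRows i j k h := by
  rw [mem_twoRows, shift_symm_shift, shift_symm_shift, if_pos rfl, if_neg hij.symm]
  refine ⟨hz, zero_mem_rid h, ?_⟩
  rw [shift, shift, row_zero, add_zero]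

theorem shift_mem_twoRows_right {i j : ℕ} (hij : i ≠ j) {k h z : Stab A} (hz : z ∈ rid h) :
    shift j z ∈ twoRows i j k h := by
  rw [twoRows_comm]
  exact shift_mem_twoRows_left hij.symm hz

theorem norm_conj_le (i j : ℕ) (x : Stab A) : ‖conj i j x‖ ≤ ‖x‖ :=
  (norm_row_le _ _).trans (norm_col_le _ _)

/-- The terms of the series defining `absorb`. -/
def absorbTerm (i j : ℕ) (h k : Stab A) (v : ℕ → Stab A) (n : ℕ) : Stab A :=
  (1 / 2 : ℂ) ^ n • conj i n (k * v n * h) + (1 / 4 : ℂ) ^ n • shift j (conj n n h)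

/-- The infinite matrix that contains the elements `2⁻ⁿ k (v n) h` in one block row and the elements
`4⁻ⁿ h` on the diagonal of another block. -/
def absorb (i j : ℕ) (h k : Stab A) (v : ℕ → Stab A) : Stab A := ∑' n, absorbTerm i j h k v n

theorem summable_absorbTerm (i j : ℕ) (h k : Stab A) {v : ℕ → Stab A} (hv : ∀ n, ‖v n‖ ≤ 1) :
    Summable (absorbTerm i j h k v) := by
  refine Summable.of_norm_bounded (g := fun n => (1 / 2 : ℝ) ^ n * (‖k‖ * ‖h‖ + ‖h‖))
    (summable_geometric_two.mul_right _) fun n => ?_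
  have h1 : ‖(1 / 2 : ℂ) ^ n • conj i n (k * v n * h)‖ ≤ (1 / 2 : ℝ) ^ n * (‖k‖ * ‖h‖) := by
    rw [norm_smul, norm_pow]
    have : ‖(1 / 2 : ℂ)‖ = 1 / 2 := by norm_num
    rw [this]
    gcongr
    refine (norm_conj_le _ _ _).trans ((norm_mul_le _ _).trans ?_)
    gcongr
    refine (norm_mul_le _ _).trans ?_
    exact mul_le_of_le_one_right (norm_nonneg _) (hv _)
  have h2 : ‖(1 / 4 : ℂ) ^ n • shift j (conj n n h)‖ ≤ (1 / 2 : ℝ) ^ n * ‖h‖ := by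
    rw [norm_smul, norm_pow]
    have : ‖(1 / 4 : ℂ)‖ = 1 / 4 := by norm_num
    rw [this]
    gcongr
    · norm_num
    · exact (norm_row_le _ _).trans (norm_conj_le _ _ _)
  rw [mul_add]
  exact (norm_add_le _ _).trans (add_le_add h1 h2)

theorem star_absorbTerm (i j : ℕ) {h : Stab A} (hsa : IsSelfAdjoint h) (k : Stab A)
    (v : ℕ → Stab A) (n : ℕ) : star (absorbTerm i j h k v n)
      = (1 / 2 : ℂ) ^ n • conj n i (h * star (v n) * star k)
        + (1 / 4 : ℂ) ^ n • star (shift j (conj n n h)) := by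
  have h2 : star ((1 / 2 : ℂ) ^ n) = (1 / 2 : ℂ) ^ n := by simp
  have h4 : star ((1 / 4 : ℂ) ^ n) = (1 / 4 : ℂ) ^ n := by simp
  rw [absorbTerm, star_add, star_smul, star_smul, h2, h4, star_conj, star_mul, star_mul,
    hsa.star_eq, mul_assoc]

theorem absorb_mul_shift (i j : ℕ) (h k : Stab A) {v : ℕ → Stab A} (hv : ∀ n, ‖v n‖ ≤ 1) (m : ℕ)
    (d : Stab A) : absorb i j h k v * shift m d = (1 / 2 : ℂ) ^ m • shift i (k * v m * h * d)
      + (1 / 4 : ℂ) ^ m • shift j (shift m (h * d)) := by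
  have hterm : ∀ n, absorbTerm i j h k v n * shift m d = if n = m then
      (1 / 2 : ℂ) ^ m • shift i (k * v m * h * d)
        + (1 / 4 : ℂ) ^ m • shift j (shift m (h * d)) else 0 := fun n => by
    rw [absorbTerm, add_mul, smul_mul_assoc, smul_mul_assoc, ← shift_mul, conj_mul_shift,
      conj_mul_shift]
    split_ifs with hnm
    · rw [hnm]
    · rw [shift, row_zero, smul_zero, smul_zero, add_zero]
  rw [absorb, ← (summable_absorbTerm i j h k hv).tsum_mul_right, tsum_congr hterm, tsum_ite_eq]

theorem star_absorb_mul_shift {i j : ℕ} (hij : i ≠ j) {h : Stab A} (hsa : IsSelfAdjoint h)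
    (k : Stab A) {v : ℕ → Stab A} (hv : ∀ n, ‖v n‖ ≤ 1) (m : ℕ) (d : Stab A) :
    star (absorb i j h k v) * shift j (shift m d) = (1 / 4 : ℂ) ^ m • shift m (h * d) := by
  have hterm : ∀ n, star (absorbTerm i j h k v n) * shift j (shift m d) = if n = m then
      (1 / 4 : ℂ) ^ m • shift m (h * d) else 0 := fun n => by
    rw [star_absorbTerm i j hsa, add_mul, smul_mul_assoc, smul_mul_assoc, conj_mul_shift,
      if_neg hij, smul_zero, zero_add, star_shift_mul_shift, if_pos rfl, star_conj, hsa.star_eq,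
      conj_mul_shift]
    split_ifs with hnm
    · rw [hnm]
    · rw [smul_zero]
  have h1 := ((summable_absorbTerm i j h k hv).hasSum.star.mul_right (shift j (shift m d))).tsum_eq
  rw [absorb, ← h1, tsum_congr hterm, tsum_ite_eq]

theorem rid_star_absorb {i j : ℕ} (hij : i ≠ j) {h : Stab A} (hsa : IsSelfAdjoint h)
    (hinv : ∀ f, ∀ x ∈ rid h, row f x ∈ rid h) (k : Stab A) {v : ℕ → Stab A}
    (hv : ∀ n, ‖v n‖ ≤ 1) : rid (star (absorb i j h k v)) = rid h := by
  refine subset_antisymm (rid_subset ?_) ?_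
  · refine (isClosed_rid h).mem_of_tendsto
      (summable_absorbTerm i j h k hv).hasSum.star.tendsto_sum_nat
      (Eventually.of_forall fun n => ?_)
    refine (ridSubmonoid h).sum_mem fun n _ => ?_
    rw [star_absorbTerm i j hsa]
    refine add_mem_rid (smul_mem_rid _ ?_) (smul_mem_rid _ ?_)
    · refine hinv _ _ (col_mem_rid _ ?_)
      exact mul_mem_rid (mul_mem_rid_self _ _) _
    · rw [shift, conj, row_row, star_row_col, hsa.star_eq]
      exact hinv _ _ (col_mem_rid _ (self_mem_rid h))
  · refine mem_of_shift_mem hinv (T := ridSubmonoid (star (absorb i j h k v))) (isClosed_rid _)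
      fun m d => ?_
    have h1 : shift m (h * d)
        = (4 : ℂ) ^ m • (star (absorb i j h k v) * shift j (shift m d)) := by
      rw [star_absorb_mul_shift hij hsa k hv, smul_smul, ← mul_pow]
      norm_num
    rw [h1]
    exact smul_mem_rid _ (mul_mem_rid_self _ _)

theorem absorb_mem_twoRows {i j : ℕ} (hij : i ≠ j) {h : Stab A}
    (hinv : ∀ f, ∀ x ∈ rid h, row f x ∈ rid h) (k : Stab A) {v : ℕ → Stab A}
    (hv : ∀ n, ‖v n‖ ≤ 1) : absorb i j h k v ∈ twoRows i j k h := by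
  refine (isClosed_twoRows i j k h).mem_of_tendsto
    (summable_absorbTerm i j h k hv).hasSum.tendsto_sum_nat
    (Eventually.of_forall fun n => AddSubmonoid.sum_mem _ fun n _ => AddSubmonoid.add_mem _ ?_ ?_)
  · rw [conj, ← row_smul]
    refine shift_mem_twoRows_left hij (smul_mem_rid _ (col_mem_rid _ ?_))
    rw [mul_assoc]
    exact mul_mem_rid_self _ _
  · rw [← shift_smul]
    exact shift_mem_twoRows_right hij (smul_mem_rid _ (hinv _ _ (col_mem_rid _ (self_mem_rid h))))

theorem rid_subset_twoRows {i j : ℕ} {h k r : Stab A} (hr : r ∈ twoRows i j k h) :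
    rid r ⊆ twoRows i j k h := by
  refine closure_minimal ?_ (isClosed_twoRows i j k h)
  rintro _ ⟨d, rfl⟩
  obtain ⟨h1, h2, h3⟩ := hr
  refine ⟨?_, ?_, ?_⟩
  · rw [row_mul]; exact mul_mem_rid h1 d
  · rw [row_mul]; exact mul_mem_rid h2 d
  · rw [row_mul, row_mul, shift_mul, shift_mul, ← add_mul, h3]

/-- The sequence `n ↦ u n.unpair.1` takes each of its values infinitely often. Letting `m` run
through the indices `pair l s` in `absorb_mul_shift` isolates the first block row of `absorb`. -/
theorem shift_mem_rid_absorb (i j : ℕ) (h k : Stab A) {u : ℕ → Stab A} (hu : ∀ n, ‖u n‖ ≤ 1)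
    (l : ℕ) (d : Stab A) :
    shift i (k * u l * h * d) ∈ rid (absorb i j h k fun n => u n.unpair.1) := by
  set r := absorb i j h k fun n => u n.unpair.1 with hr
  have h1 : ∀ s : ℕ, (2 : ℂ) ^ (Nat.pair l s) • (r * shift (Nat.pair l s) d)
      = shift i (k * u l * h * d)
        + (1 / 2 : ℂ) ^ (Nat.pair l s) • shift j (shift (Nat.pair l s) (h * d)) := fun s => by
    rw [hr, absorb_mul_shift i j h k fun n => hu _]
    generalize hp : Nat.pair l s = p
    have hl : p.unpair.1 = l := by rw [← hp, Nat.unpair_pair]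
    rw [smul_add, smul_smul, smul_smul, ← mul_pow, ← mul_pow, hl]
    norm_num
  have h2 : Tendsto (fun s : ℕ => (1 / 2 : ℂ) ^ (Nat.pair l s)
      • shift j (shift (Nat.pair l s) (h * d))) atTop (𝓝 0) := by
    have h3 : Tendsto (fun s : ℕ => (1 / 2 : ℝ) ^ s * ‖h * d‖) atTop (𝓝 0) := by
      have := (tendsto_pow_atTop_nhds_zero_of_lt_one (r := (1 / 2 : ℝ)) (by norm_num)
        (by norm_num)).mul_const ‖h * d‖
      rwa [zero_mul] at this
    refine squeeze_zero_norm (fun s => ?_) h3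
    rw [norm_smul, norm_pow]
    have : ‖(1 / 2 : ℂ)‖ = 1 / 2 := by norm_num
    rw [this]
    refine mul_le_mul (pow_le_pow_of_le_one (by norm_num) (by norm_num)
      (Nat.right_le_pair l s)) ((norm_row_le _ _).trans (norm_row_le _ _))
      (norm_nonneg _) (by positivity)
  have h3 := (tendsto_const_nhds (x := shift i (k * u l * h * d))).add h2
  rw [add_zero] at h3
  refine (isClosed_rid r).mem_of_tendsto h3 (Eventually.of_forall fun s => ?_)
  rw [← h1]
  exact smul_mem_rid _ (mul_mem_rid_self _ _)

/-- The elements whose `n`-th shift belongs to the closed right ideal generated by `r`. -/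
def shiftComap (n : ℕ) (r : Stab A) : AddSubmonoid (Stab A) where
  carrier := {z | shift n z ∈ rid r}
  add_mem' := fun {x y} hx hy => by
    rw [Set.mem_ofPred_eq, shift_add]
    exact add_mem_rid hx hy
  zero_mem' := by
    rw [Set.mem_ofPred_eq, shift, row_zero]
    exact zero_mem_rid r

theorem mem_shiftComap {n : ℕ} {r z : Stab A} : z ∈ shiftComap n r ↔ shift n z ∈ rid r := Iff.rfl

theorem isClosed_shiftComap (n : ℕ) (r : Stab A) : IsClosed (shiftComap n r : Set (Stab A)) :=
  (isClosed_rid r).preimage (continuous_shift n)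

theorem mem_shiftComap_of_mem_rid {n : ℕ} {r k : Stab A} (h : ∀ d, k * d ∈ shiftComap n r) :
    ∀ z ∈ rid k, z ∈ shiftComap n r := fun z hz => by
  refine closure_minimal ?_ (isClosed_shiftComap n r) hz
  rintro _ ⟨d, rfl⟩
  exact h d

/-- The main step of the absorption argument: for row-invariant right ideals `rid k` and `rid h`
there is an element `r` whose source is `rid h` and whose range is `twoRows i j k h`. -/
theorem exists_rid_eq_twoRows (hA : IsSimpleCStar A) {i j : ℕ} (hij : i ≠ j) {h k : Stab A}
    (hh : h ≠ 0) (hsa : IsSelfAdjoint h) (hinv : ∀ f, ∀ x ∈ rid h, row f x ∈ rid h) :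
    ∃ r : Stab A, rid (star r) = rid h ∧ rid r = twoRows i j k h := by
  obtain ⟨u, hu, hT⟩ := (isSimpleCStar hA).exists_seq_translates hh k
  have hv : ∀ n : ℕ, ‖u n.unpair.1‖ ≤ 1 := fun n => hu _
  have hi0 := shift_mem_rid_absorb i j h k hu
  have hmul := absorb_mul_shift i j h k hv
  have hmem := absorb_mem_twoRows hij hinv k hv
  refine ⟨_, rid_star_absorb hij hsa hinv k hv, subset_antisymm (rid_subset_twoRows hmem) ?_⟩
  generalize (absorb i j h k fun n => u n.unpair.1) = r at *
  have hi : ∀ z ∈ rid k, z ∈ shiftComap i r :=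
    mem_shiftComap_of_mem_rid (hT _ (isClosed_shiftComap i r) fun l d => mem_shiftComap.2 (hi0 l d))
  have hj : ∀ z ∈ rid h, z ∈ shiftComap j r := by
    refine mem_of_shift_mem hinv (isClosed_shiftComap j r) fun m d => ?_
    have h1 : shift j (shift m (h * d)) = (4 : ℂ) ^ m • (r * shift m d
        + (-1 : ℂ) • (1 / 2 : ℂ) ^ m • shift i (k * u m.unpair.1 * h * d)) := by
      rw [hmul, neg_one_smul, add_comm, neg_add_cancel_left, smul_smul, ← mul_pow]
      norm_num
    rw [mem_shiftComap, h1]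
    exact smul_mem_rid _ (add_mem_rid (mul_mem_rid_self _ _)
      (smul_mem_rid _ (smul_mem_rid _ (hi0 _ _))))
  rintro x ⟨h1, h2, h3⟩
  rw [← h3]
  exact add_mem_rid (mem_shiftComap.1 (hi _ h1)) (mem_shiftComap.1 (hj _ h2))

/-- Any two nonzero row-invariant hereditary subalgebras of `A ⊗ 𝕂` are isomorphic, if `A` is
simple. -/
theorem nonempty_herAlg_equiv (hA : IsSimpleCStar A) {h k : Stab A} (hh : h ≠ 0) (hk : k ≠ 0)
    (hsa : IsSelfAdjoint h) (ksa : IsSelfAdjoint k) (hinv : ∀ f, ∀ x ∈ rid h, row f x ∈ rid h)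
    (kinv : ∀ f, ∀ x ∈ rid k, row f x ∈ rid k) : Nonempty (herAlg h ≃⋆ₐ[ℂ] herAlg k) := by
  obtain ⟨r, hr, hr'⟩ := exists_rid_eq_twoRows hA (i := 0) (j := 1) (by norm_num) (k := k)
    hh hsa hinv
  obtain ⟨s, hs, hs'⟩ := exists_rid_eq_twoRows hA (i := 1) (j := 0) (by norm_num) (k := h)
    hk ksa kinv
  have h1 : herAlg r = herAlg s := herAlg_eq_of_rid_eq (by rw [hr', hs', twoRows_comm])
  have e1 := herEquiv r
  have e2 := (herEquiv s).symm
  rw [herAlg_eq_of_rid_eq hr, h1] at e1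
  rw [herAlg_eq_of_rid_eq hs] at e2
  exact ⟨e1.trans e2⟩

/-- A simple `σ`-unital algebra is stably isomorphic to the hereditary subalgebra generated by a
nonzero self-adjoint element. -/
theorem nonempty_starAlgEquiv {B : Type u} [NonUnitalCStarAlgebra B] [PartialOrder B]
    [StarOrderedRing B] (hA : IsSimpleCStar A) (hσ : IsSigmaUnital A) {φ : B →⋆ₙₐ[ℂ] A}
    (hφ : Function.Injective φ) {e : A} (he : IsSelfAdjoint e) (he0 : e ≠ 0)
    (hrange : Set.range φ = {x | x ∈ rid e ∧ star x ∈ rid e}) :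
    Nonempty (Stab A ≃⋆ₐ[ℂ] Stab B) := by
  obtain ⟨a, ha, hau⟩ := hσ.exists_rid_eq_univ
  obtain ⟨h, hsa, hh⟩ := exists_rid_eq_rowIdeal (IsSelfAdjoint.of_nonneg ha)
  obtain ⟨k, ksa, hk⟩ := exists_rid_eq_rowIdeal he
  have hinv : ∀ f, ∀ x ∈ rid h, row f x ∈ rid h := fun f x hx => by
    rw [hh] at hx ⊢; exact row_mem_rowIdeal f hx
  have kinv : ∀ f, ∀ x ∈ rid k, row f x ∈ rid k := fun f x hx => by
    rw [hk] at hx ⊢; exact row_mem_rowIdeal f hx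
  have hne : ∀ y : Stab A, corner A e ∈ rid y → y ≠ 0 := by
    rintro _ hy rfl
    have h1 := mul_eq_zero_of_mem_rid (E := star (corner A e)) (mul_zero _) hy
    exact he0 (corner_injective (by
      rw [map_zero]; exact (CStarRing.star_mul_self_eq_zero_iff _).1 h1))
  have h0 : h ≠ 0 := hne h (by rw [hh, rowIdeal_eq_univ hau]; trivial)
  have k0 : k ≠ 0 := hne k (by rw [hk]; exact mem_rowIdeal_of_mem_rid (self_mem_rid _))
  obtain ⟨E⟩ := nonempty_herAlg_equiv hA h0 k0 hsa ksa hinv kinv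
  rw [herAlg_eq_top (hh.trans (rowIdeal_eq_univ hau))] at E
  have hB : ∀ y, map hφ y ∈ herAlg k := fun y => by
    rw [mem_herAlg, hk]
    exact (range_map hφ hrange ▸ Set.mem_range_self y :
      map hφ y ∈ {x | x ∈ rowIdeal e ∧ star x ∈ rowIdeal e})
  have F : Stab B ≃⋆ₐ[ℂ] herAlg k :=
    StarAlgEquiv.ofBijective (NonUnitalStarAlgHom.codRestrict (map hφ) (herAlg k) hB) (by
      refine ⟨fun x y hxy => map_injective hφ (congrArg Subtype.val hxy), fun y => ?_⟩
      obtain ⟨x, hx⟩ : (y : Stab A) ∈ Set.range (map hφ) := by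
        rw [range_map hφ hrange]
        have := y.2
        rwa [mem_herAlg, hk] at this
      exact ⟨x, Subtype.ext hx⟩)
  have G : Stab A ≃⋆ₐ[ℂ] (⊤ : NonUnitalStarSubalgebra ℂ (Stab A)) :=
    StarAlgEquiv.ofBijective (NonUnitalStarAlgHom.codRestrict (NonUnitalStarAlgHom.id ℂ (Stab A)) ⊤
      fun _ => trivial) ⟨fun x y hxy => congrArg Subtype.val hxy, fun y => ⟨y.1, rfl⟩⟩
  exact ⟨(G.trans E).trans F.symm⟩

end Stab

end Absorption

/-! ### Transport of densely defined quasitraces along stable isomorphisms -/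

section Transport

theorem starAlgEquiv_nonneg {C D : Type u} [NonUnitalCStarAlgebra C] [PartialOrder C]
    [StarOrderedRing C] [NonUnitalCStarAlgebra D] [PartialOrder D] [StarOrderedRing D]
    (Φ : C ≃⋆ₐ[ℂ] D) {a : C} (ha : 0 ≤ a) : 0 ≤ Φ a := by
  obtain ⟨w, hw, -, rfl⟩ := exists_sqrt ha
  have h : Φ (w * w) = star (Φ w) * Φ w := by rw [map_mul, ← map_star, hw.star_eq]
  rw [h]
  exact star_mul_self_nonneg _

theorem starAlgEquiv_mem_pedersen {C D : Type u} [NonUnitalCStarAlgebra C]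
    [NonUnitalCStarAlgebra D] (Φ : C ≃⋆ₐ[ℂ] D) {x : C} (hx : x ∈ pedersen C) :
    Φ x ∈ pedersen D := by
  intro I hI hd
  refine hx (I.comap (Φ : C →ₗ[ℂ] D)) (fun y hy a => ?_) ?_
  · have hy' : Φ y ∈ I := hy
    refine ⟨?_, ?_⟩
    · change Φ (a * y) ∈ I
      rw [map_mul]; exact (hI _ hy' _).1
    · change Φ (y * a) ∈ I
      rw [map_mul]; exact (hI _ hy' _).2
  · have h1 : IsOpenMap Φ := by
      have hc : Continuous Φ.symm := (StarAlgEquiv.isometry Φ.symm).continuous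
      exact IsOpenMap.of_inverse hc Φ.apply_symm_apply Φ.symm_apply_apply
    exact hd.preimage h1

variable {A B : Type u} [NonUnitalCStarAlgebra A] [PartialOrder A] [StarOrderedRing A]
  [NonUnitalCStarAlgebra B] [PartialOrder B] [StarOrderedRing B]

/-- The restriction of a stable isomorphism to the Pedersen ideals. -/
def pedersenHom (Φ : Stab A ≃⋆ₐ[ℂ] Stab B) : pedersen (Stab A) →⋆ₙₐ[ℂ] pedersen (Stab B) where
  toFun x := ⟨Φ x, starAlgEquiv_mem_pedersen Φ x.2⟩
  map_smul' c x := Subtype.ext (map_smul Φ c (x : Stab A))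
  map_zero' := Subtype.ext (map_zero Φ)
  map_add' x y := Subtype.ext (map_add Φ (x : Stab A) y)
  map_mul' x y := Subtype.ext (map_mul Φ (x : Stab A) y)
  map_star' x := Subtype.ext (map_star Φ (x : Stab A))

namespace DenseQT

/-- The pullback of a densely defined 2-quasitrace along a stable isomorphism. -/
def pull (hA : IsSimpleCStar A) (Φ : Stab A ≃⋆ₐ[ℂ] Stab B) (τ : DenseQT B) : DenseQT A :=
  ⟨fun x => τ.1 (pedersenHom Φ x), (τ.2.1.comp (pedersenHom Φ)).isTwoQuasitrace hA⟩

variable (hA : IsSimpleCStar A) (Φ : Stab A ≃⋆ₐ[ℂ] Stab B)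

theorem pull_pull (hB : IsSimpleCStar B) (τ : DenseQT B) : pull hB Φ.symm (pull hA Φ τ) = τ := by
  refine Subtype.ext (funext fun x => ?_)
  refine congrArg τ.1 (Subtype.ext ?_)
  exact Φ.apply_symm_apply x

theorem pull_zero : pull hA Φ (0 : DenseQT B) = 0 := rfl

theorem continuous_pull : Continuous (pull hA Φ) :=
  Continuous.subtype_mk (continuous_pi fun x => continuous_apply (pedersenHom Φ x)) _

theorem pull_ne_zero (hB : IsSimpleCStar B) {τ : DenseQT B} (hτ : τ ≠ 0) :
    pull hA Φ τ ≠ 0 := fun h => hτ (by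
  rw [← pull_pull hA Φ hB τ, h, pull_zero])

theorem dim_pull (τ : DenseQT B) {a : Stab A} (ha : 0 ≤ a) :
    (pull hA Φ τ).dim a = τ.dim (Φ a) := by
  unfold dim
  refine iSup_congr fun n => congrArg ENNReal.ofReal (congrArg Complex.re
    (congrArg τ.1 (Subtype.ext ?_)))
  have hn : 0 < 1 / ((n : ℝ) + 1) := Nat.one_div_pos_of_nat
  exact NonUnitalStarAlgHomClass.map_cfcₙ Φ (fEps (1 / ((n : ℝ) + 1))) a
    (fEps_continuous _).continuousOn (fEps_zero hn) (StarAlgEquiv.isometry Φ).continuous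
    (.of_nonneg ha) ((IsSelfAdjoint.of_nonneg ha).map Φ)

end DenseQT

/-- Hereditary surjectivity is a property of the stabilization. -/
theorem HereditarySurjective.of_stab_equiv (hA : IsSimpleCStar A) (hB : IsSimpleCStar B)
    (Φ : Stab A ≃⋆ₐ[ℂ] Stab B) (h : HereditarySurjective A) : HereditarySurjective B := by
  intro a ha f hf hlt
  obtain ⟨g, hg, hmono, hlim⟩ := hf
  have ha' : 0 ≤ Φ.symm a := starAlgEquiv_nonneg Φ.symm ha
  have hdim : ∀ τ : DenseQT A, (DenseQT.pull hB Φ.symm τ).dim a = τ.dim (Φ.symm a) := fun τ =>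
    DenseQT.dim_pull hB Φ.symm τ ha
  have hg' : ∀ n, IsAffPos fun τ : DenseQT A => g n (DenseQT.pull hB Φ.symm τ) := fun n =>
    ⟨⟨(hg n).1.continuous.comp (DenseQT.continuous_pull hB Φ.symm),
      fun s τ => (hg n).1.map_smul s (DenseQT.pull hB Φ.symm τ),
      fun τ σ => (hg n).1.map_add (DenseQT.pull hB Φ.symm τ) (DenseQT.pull hB Φ.symm σ)⟩,
      (hg n).2.imp (fun h τ hτ => h _ (DenseQT.pull_ne_zero hB Φ.symm hA hτ)) fun h τ => h _⟩
  obtain ⟨b, hb, ⟨x, hx⟩, hbdim⟩ := h (Φ.symm a) ha' (fun τ => f (DenseQT.pull hB Φ.symm τ))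
    ⟨_, hg', fun n τ => hmono n _, fun τ => hlim _⟩
    (fun τ hτ => hdim τ ▸ hlt _ (DenseQT.pull_ne_zero hB Φ.symm hA hτ))
  refine ⟨Φ b, starAlgEquiv_nonneg Φ hb, ⟨fun k => Φ (x k), hx.congr fun k => ?_⟩, fun τ => ?_⟩
  · rw [← StarAlgEquiv.norm_map Φ]
    simp only [map_sub, map_mul, map_star, Φ.apply_symm_apply]
  · rw [← DenseQT.dim_pull hA Φ τ hb, hbdim, DenseQT.pull_pull]

end Transport

/-! ### Hereditary subalgebras inside the Pedersen ideal -/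

section Corner

variable {A B : Type u} [NonUnitalCStarAlgebra A] [PartialOrder A] [StarOrderedRing A]
  [NonUnitalCStarAlgebra B] [PartialOrder B] [StarOrderedRing B]

theorem IsAlgSimple.isSimpleCStar (h : IsAlgSimple B) : IsSimpleCStar B :=
  ⟨h.1, fun I hI _ => h.2 I hI⟩

theorem IsAlgSimple.mem_pedersen (h : IsAlgSimple B) (b : B) : b ∈ pedersen B := by
  have := h.1
  intro I hI hd
  rcases h.2 I hI with rfl | rfl
  · exfalso
    obtain ⟨x, hx⟩ := exists_ne (0 : B)
    have h1 := hd x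
    rw [Submodule.bot_coe, closure_singleton] at h1
    exact hx h1
  · trivial

/-- A hereditary subalgebra of a simple algebra on which some element acts as a unit is
algebraically simple: it lies in the Pedersen ideal, hence in every ideal of the large algebra. -/
theorem isAlgSimple_of_unit (hA : IsSimpleCStar A) {φ : B →⋆ₙₐ[ℂ] A} (hφ : Function.Injective φ)
    {e E : A} (he : IsSelfAdjoint e) (he0 : e ≠ 0) (hE : E * e = e)
    (hrange : Set.range φ = {x | x ∈ rid e ∧ star x ∈ rid e}) : IsAlgSimple B := by
  have hmem : ∀ b, φ b ∈ rid e := fun b =>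
    (hrange ▸ Set.mem_range_self b : φ b ∈ {x | x ∈ rid e ∧ star x ∈ rid e}).1
  have hlift : ∀ (b c : B) (x : A), ∃ d, φ d = φ b * x * φ c := fun b c x => by
    have : φ b * x * φ c ∈ Set.range φ := by
      rw [hrange]
      refine ⟨mul_mem_rid (mul_mem_rid (hmem b) _) _, ?_⟩
      rw [star_mul, ← map_star]
      exact mul_mem_rid (hmem _) _
    exact this
  refine ⟨?_, fun I hI => ?_⟩
  · obtain ⟨b, hb⟩ : e ∈ Set.range φ := by
      rw [hrange]
      exact ⟨self_mem_rid e, he.star_eq.symm ▸ self_mem_rid e⟩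
    exact ⟨b, 0, fun h => he0 (by rw [← hb, h, map_zero])⟩
  · refine or_iff_not_imp_left.2 fun hne => ?_
    obtain ⟨d, hd, hd0⟩ := Submodule.exists_mem_ne_zero_of_ne_bot hne
    -- the elements of `A` whose compressions to `B` all lie in `I`
    let L : Submodule ℂ A :=
      { carrier := {x | ∀ (b c : B) (α β : A), ∃ y ∈ I, φ y = φ b * α * x * β * φ c}
        add_mem' := by
          rintro x x' hx hx' b c α β
          obtain ⟨y, hy, h1⟩ := hx b c α β
          obtain ⟨y', hy', h1'⟩ := hx' b c α β
          exact ⟨y + y', I.add_mem hy hy', by rw [map_add, h1, h1']; noncomm_ring⟩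
        zero_mem' := fun b c α β => ⟨0, I.zero_mem, by simp⟩
        smul_mem' := by
          rintro s x hx b c α β
          obtain ⟨y, hy, h1⟩ := hx b c α β
          refine ⟨s • y, I.smul_mem s hy, ?_⟩
          rw [map_smul, h1, mul_smul_comm, smul_mul_assoc, smul_mul_assoc] }
    have hL : IsIdeal L := by
      refine fun x hx a => ⟨fun b c α β => ?_, fun b c α β => ?_⟩
      · obtain ⟨y, hy, h1⟩ := hx b c (α * a) β
        exact ⟨y, hy, by rw [h1]; noncomm_ring⟩
      · obtain ⟨y, hy, h1⟩ := hx b c α (a * β)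
        exact ⟨y, hy, by rw [h1]; noncomm_ring⟩
    have hLne : L ≠ ⊥ := by
      have h1 : φ (star d * d * (star d * d)) ∈ L := fun b c α β => by
        obtain ⟨p, hp⟩ := hlift b (star d) α
        obtain ⟨q, hq⟩ := hlift (star d * d) c β
        refine ⟨p * d * q, (hI _ (hI d hd p).1 q).2, ?_⟩
        rw [map_mul, map_mul, hp, hq]
        simp only [map_mul]
        noncomm_ring
      intro h
      rw [h, Submodule.mem_bot] at h1
      have h2 := hφ (h1.trans (map_zero φ).symm)
      have h3 : star (star d * d) * (star d * d) = 0 := by rwa [star_mul, star_star]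
      exact hd0 ((CStarRing.star_mul_self_eq_zero_iff _).1
        ((CStarRing.star_mul_self_eq_zero_iff _).1 h3))
    have hBL : ∀ b, φ b ∈ L := fun b =>
      mem_pedersen_of_mul_eq (mul_eq_of_mem_rid hE (hmem b)) L hL (hA.dense_of_ne_bot hL hLne)
    have h5 : ∀ b c α β x : B, b * α * x * β * c ∈ I := fun b c α β x => by
      obtain ⟨y, hy, h1⟩ := hBL x b c (φ α) (φ β)
      simp only [← map_mul] at h1
      rwa [← hφ h1]
    -- a product of five elements of `B` lies in `I`, and so does `b = t⁸` for positive `b`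
    have hpos : ∀ b : B, 0 ≤ b → b ∈ I := fun b hb => by
      obtain ⟨w, -, hw0, rfl⟩ := exists_sqrt hb
      obtain ⟨v, -, hv0, rfl⟩ := exists_sqrt hw0
      obtain ⟨t, -, -, rfl⟩ := exists_sqrt hv0
      have h1 := (hI _ (h5 t t t t t) (t * t * t)).2
      convert h1 using 1
      noncomm_ring
    rw [eq_top_iff, ← CStarAlgebra.span_nonneg (A := B), Submodule.span_le]
    exact hpos

/-- An element of `B` that generates `B` as a hereditary subalgebra of `A` also generates `B` as a
closed right ideal of `B` itself. -/
theorem rid_eq_univ_of_range {φ : B →⋆ₙₐ[ℂ] A} (hφ : Function.Injective φ) {b : B}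
    (hb : IsSelfAdjoint b) (hrange : Set.range φ = {x | x ∈ rid (φ b) ∧ star x ∈ rid (φ b)}) :
    rid b = Set.univ := by
  refine Set.eq_univ_of_forall fun c => ?_
  have hc : φ c ∈ rid (φ b) :=
    (hrange ▸ Set.mem_range_self c : φ c ∈ {x | x ∈ rid (φ b) ∧ star x ∈ rid (φ b)}).1
  have hbs : star (φ b) = φ b := (hb.map φ).star_eq
  have hiso : Isometry φ := NonUnitalStarAlgHom.isometry φ hφ
  have h1 := tendsto_star_polarSeq_mul_of_mem (r := φ b) (w := φ c) (by rwa [hbs])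
  have h2 : ∀ n, ∃ d ∈ rid b, φ d = star (polarSeq (φ b) n) * (polarSeq (φ b) n * φ c) := by
    intro n
    have h3 : ∀ n, polarSeq (φ b) n = φ (polarSeq b n) := fun n => by
      unfold polarSeq
      rw [map_mul, NonUnitalStarAlgHom.map_cfcₙ φ (polarFun n) (star b * b)
        (polarFun_continuous n).continuousOn (polarFun_zero n) hiso.continuous
        (.star_mul_self b) ((IsSelfAdjoint.star_mul_self b).map φ), map_mul, map_star]
    refine ⟨star (polarSeq b n) * (polarSeq b n * c), ?_, ?_⟩
    · rw [star_polarSeq, hb.star_eq]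
      exact polarSeq_mul_mem_rid _ _ _
    · rw [h3, map_mul, map_mul, map_star]
  choose d hd hd' using h2
  have h4 : Tendsto (fun n => φ (d n)) atTop (𝓝 (φ c)) := by
    simp_rw [hd']
    exact h1
  exact (isClosed_rid b).mem_of_tendsto (hiso.isEmbedding.tendsto_nhds_iff.2 h4)
    (Eventually.of_forall hd)

theorem DenseQT.normOn_smul (s : ℝ≥0) (τ : DenseQT B) : (s • τ).normOn = s * τ.normOn := by
  unfold normOn
  rw [ENNReal.mul_iSup]
  refine iSup_congr fun a => ?_
  rw [val_eq, val_eq, rval_smul_apply, ENNReal.ofReal_mul (NNReal.coe_nonneg s),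
    ENNReal.ofReal_coe_nnreal]

/-- A nonzero densely defined quasitrace is bounded on an algebraically simple algebra that is
singly generated as a closed right ideal, so it can be normalized. -/
theorem QT_nonempty_of_ne_zero (hB : IsAlgSimple B) {b : B} (hb : IsSelfAdjoint b)
    (hrid : rid b = Set.univ) {σ : DenseQT B} (hσ : σ ≠ 0) : (QT B).Nonempty := by
  have hS := hB.isSimpleCStar
  have := hB.1
  have hbP : corner B b ∈ pedersen (Stab B) := corner_mem_pedersen (hB.mem_pedersen b)
  obtain ⟨r, E, C, hE, hEr, hdim, hle⟩ := isDominated_of_mem_pedersen hS hbP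
  have h1 : corner B b ∈ rid (star r) := by
    have := star_mem_rid_of_le hle
    rwa [← map_star, hb.star_eq] at this
  have hfin : σ.normOn ≠ ⊤ := by
    refine ne_top_of_le_ne_top (hdim σ).2 (iSup_le fun a => ?_)
    have h2 : corner B (a.1 : B) ∈ rid (star r) :=
      rid_subset h1 (Stab.corner_mem_rid (hrid ▸ Set.mem_univ _))
    have h3 : 0 ≤ corner B (a.1 : B) := by
      obtain ⟨w, hw, -, hww⟩ := exists_sqrt a.2.1
      have : corner B (a.1 : B) = star (corner B w) * corner B w := by
        rw [← map_star, ← map_mul, hw.star_eq, hww]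
      rw [this]
      exact star_mul_self_nonneg _
    obtain ⟨-, -, -, h4⟩ := exists_factor_of_mem_rid hE hEr h3 h2
    rw [DenseQT.val_eq]
    refine (h4 σ).trans ?_
    have h5 : (‖corner B (a.1 : B)‖₊ : ℝ≥0∞) ≤ 1 := by
      have : ‖corner B (a.1 : B)‖ ≤ 1 := (corner_norm B _).le.trans a.2.2
      exact_mod_cast this
    calc _ ≤ 1 * σ.dim E := mul_le_mul' h5 le_rfl
      _ = σ.dim E := one_mul _
  have hpos : σ.normOn ≠ 0 := by
    obtain ⟨p, hp, hp0⟩ := exists_nonneg_ne_zero (B := B)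
    have h2 : corner B p ≠ 0 := fun h => hp0 (Stab.corner_injective (by rw [h, map_zero]))
    have h3 : 0 ≤ corner B p := by
      obtain ⟨w, hw, -, rfl⟩ := exists_sqrt hp
      rw [map_mul]
      nth_rewrite 1 [← hw.star_eq]
      rw [map_star]
      exact star_mul_self_nonneg _
    exact ((DenseQT.dim_pos hS hσ h3 h2).trans_le (σ.dim_corner_le hp)).ne'
  refine ⟨(σ.normOn.toNNReal)⁻¹ • σ, ?_⟩
  change DenseQT.normOn B _ = 1
  rw [DenseQT.normOn_smul]
  have h6 : σ.normOn.toNNReal ≠ 0 := by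
    rw [Ne, ENNReal.toNNReal_eq_zero_iff]
    exact fun h => h.elim hpos hfin
  rw [ENNReal.coe_inv h6, ENNReal.coe_toNNReal hfin]
  exact ENNReal.inv_mul_cancel hpos hfin

/-- A simple `σ`-unital algebra that admits a normalized quasitrace is stably isomorphic to an
algebraically simple one that does. -/
theorem exists_isAlgSimple_stab_equiv (hσ : IsSigmaUnital A) (hA : IsSimpleCStar A)
    (hQT : (QT A).Nonempty) :
    ∃ (B : Type u) (_ : NonUnitalCStarAlgebra B) (_ : PartialOrder B) (_ : StarOrderedRing B),
      IsAlgSimple B ∧ (QT B).Nonempty ∧ Nonempty (Stab A ≃⋆ₐ[ℂ] Stab B) := by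
  have := hA.1
  obtain ⟨a, ha, ha0⟩ := exists_nonneg_ne_zero (B := A)
  obtain ⟨ε, hε, hne⟩ := exists_cfcₙ_fEps_ne_zero ha ha0
  set e := cfcₙ (fEps ε) a with he
  have hesa : IsSelfAdjoint e := cfcₙ_predicate _ _
  have he0 : e ≠ 0 := hne ε hε le_rfl
  have hE : cfcₙ (fEps (ε / 2)) a * e = e := by
    rw [he, cfcₙ_fEps_mul_cfcₙ_fEps]
    all_goals first | positivity | linarith
  have hrange := HerAlg.range_incl e
  have hinj := HerAlg.incl_injective e
  have hB : IsAlgSimple (HerAlg e) := isAlgSimple_of_unit hA hinj hesa he0 hE hrange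
  obtain ⟨Φ⟩ := Stab.nonempty_starAlgEquiv hA hσ hinj hesa he0 hrange
  refine ⟨HerAlg e, inferInstance, inferInstance, inferInstance, hB, ?_, ⟨Φ⟩⟩
  obtain ⟨τ, hτ⟩ := hQT
  have hτ0 : τ ≠ 0 := by
    rintro rfl
    have h1 : DenseQT.normOn A 0 = 1 := hτ
    have h2 : DenseQT.normOn A (0 : DenseQT A) = 0 := by
      unfold DenseQT.normOn
      refine ENNReal.iSup_eq_zero.2 fun a => ?_
      exact ENNReal.ofReal_zero
    rw [h2] at h1
    exact zero_ne_one h1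
  obtain ⟨b, hb⟩ : e ∈ Set.range (HerAlg.incl e) := by
    rw [hrange]
    exact ⟨self_mem_rid e, hesa.star_eq.symm ▸ self_mem_rid e⟩
  have hbsa : IsSelfAdjoint b := hinj (by rw [map_star, hb, hesa.star_eq])
  refine QT_nonempty_of_ne_zero hB hbsa (rid_eq_univ_of_range hinj hbsa ?_)
    (DenseQT.pull_ne_zero hB.isSimpleCStar Φ.symm hA hτ0)
  rw [hb]
  exact hrange

end Corner

end TAOZ

end

theorem mainTheorem3 {A : Type u} [NonUnitalCStarAlgebra A] [PartialOrder A] [StarOrderedRing A]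
    (hσ : TAOZ.IsSigmaUnital A) (hsimple : TAOZ.IsSimpleCStar A) (hQT : (TAOZ.QT A).Nonempty)
    (hΓ : TAOZ.HereditarySurjective A) :
    TAOZ.HasTAOZ A := by
  by_cases h : TAOZ.IsAlgSimple A ∧ (TAOZ.QT A).Nonempty
  · exact Or.inl ⟨h.1, h.2, TAOZ.allElementsTAOZ hsimple hΓ⟩
  · obtain ⟨B, i1, i2, i3, hB, hQB, ⟨Φ⟩⟩ := TAOZ.exists_isAlgSimple_stab_equiv hσ hsimple hQT
    exact Or.inr ⟨h, B, i1, i2, i3, hB, hQB, TAOZ.allElementsTAOZ hB.isSimpleCStar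
      (hΓ.of_stab_equiv hsimple hB.isSimpleCStar Φ), ⟨Φ⟩⟩
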